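/- Let $X_1,\dots,X_n$ be i.i.d. $\mathcal N_p(0,\Sigma)$ vectors, $X_k=(X_{k,1},\dots,X_{k,p})^\top$, $\Sigma=[\sigma_{ij}]$, and write $\mathbb E_\Sigma$, $\mathrm{Var}_\Sigma$ for moments under this law. Let $\alpha>0$, $L>0$ be fixed and $\varphi>0$. Put $$T=\lfloor C_T\,\varphi^{-1/\alpha}\rfloor,\quad \lambda=C_\lambda\,\varphi^{\frac{2\alpha+1}{\alpha}},\quad b(\varphi)=C^{1/2}\varphi^{2+\frac1{2\alpha}},\quad w^*_{ij}=\frac{\lambda}{2b(\varphi)}\Big(1-\Big(\frac{|i-j|}{T}\Big)^{2\alpha}\Big)_+,$$ where $C_T=((4\alpha+1)L)^{\frac1{2\alpha}}$, $C_\lambda=\frac{2\alpha+1}{2\alpha}((4\alpha+1)L)^{-\frac1{2\alpha}}$, $C=\frac{2\alpha+1}{(4\alpha+1)^{1+1/(2\alpha)}}L^{-\frac1{2\alpha}}$, and, for $n\ge2$, $$\widehat{\mathcal D}_n=\frac1{n(n-1)p}\sum_{1\le k\ne l\le n}\ \sum_{1\le i<j\le p}w^*_{ij}X_{k,i}X_{k,j}X_{l,i}X_{l,j}.$$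 Let $Q(\alpha,L,\varphi)$ be the set of positive semidefinite $p\times p$ matrices $\Sigma$ with $\sigma_{ii}=1$ for all $i$, $\frac1p\sum_{i<j}\sigma_{ij}^2|i-j|^{2\alpha}\le L$ and $\frac1p\sum_{i<j}\sigma_{ij}^2\ge\varphi^2$. Asymptotics are taken as $n\to\infty$, $p\to\infty$, $\varphi=\varphi_{n,p}\to0$ and $p\,\varphi^{1/\alpha}\to\infty$. (1) Under the null hypothesis $\Sigma=I$, for all $n\ge2$, $p\ge1$, $\varphi>0$: $\widehat{\mathcal D}_n$ is square integrable, $$\mathbb E_I(\widehat{\mathcal D}_n)=0,\qquad \mathrm{Var}_I(\widehat{\mathcal D}_n)=\frac2{n(n-1)p^2}\sum_{1\le i<j\le p}w_{ij}^{*2},$$ and in the above asymptotics $\mathrm{Var}_I(\widehat{\mathcal D}_n)=\frac{1+o(1)}{n(n-1)p}$ and $n\sqrt p\,\widehat{\mathcal D}_n\to\mathcal N(0,1)$ in distribution. (2) Let $\alpha>1/2$. For all $n\ge2$, $p\ge1$, $\varphi>0$ and all $\Sigma\in Q(\alpha,L,\varphi)$, $\widehat{\mathcal D}_n$ is square integrable,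 $$\mathbb E_\Sigma(\widehat{\mathcal D}_n)=\frac1p\sum_{1\le i<j\le p}w^*_{ij}\sigma_{ij}^2,\qquad \mathrm{Var}_\Sigma(\widehat{\mathcal D}_n)=\frac{T_1}{n(n-1)p^2}+\frac{T_2}{np^2},$$ where $$T_1=2\,\mathbb E_\Sigma\Big\{\sum_{i<j}w^*_{ij}(X_{1,i}X_{1,j}-\sigma_{ij})(X_{2,i}X_{2,j}-\sigma_{ij})\Big\}^2,\qquad T_2=4\,\mathbb E_\Sigma\Big\{\sum_{i<j}w^*_{ij}(X_{1,i}X_{1,j}-\sigma_{ij})\sigma_{ij}\Big\}^2,$$ and $\mathbb E_\Sigma(\widehat{\mathcal D}_n)\ge b(\varphi)$ whenever $C_T\varphi^{-1/\alpha}$ is an integer. In the above asymptotics, uniformly over $\Sigma\in Q(\alpha,L,\varphi)$, $$\mathbb E_\Sigma(\widehat{\mathcal D}_n)\ge b(\varphi)(1-o(1)),\qquad T_1\le p\,(1+o(1))+p\,\mathbb E_\Sigma(\widehat{\mathcal D}_n)\,O(T\sqrt T),$$ $$T_2\le p\,\mathbb E_\Sigma(\widehat{\mathcal D}_n)\,O(\sqrt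 T)+p^{3/2}\Big(\mathbb E_\Sigma^{3/2}(\widehat{\mathcal D}_n)\,O(T^{3/4})+\mathbb E_\Sigma(\widehat{\mathcal D}_n)\,o(1)\Big),$$ where the constants in the $O$ terms depend only on $\alpha$ and $L$. -/

import Mathlib

open MeasureTheory ProbabilityTheory Filter Topology

noncomputable section

namespace CovTest

/-- `C_T(α, L) = ((4α+1)L)^{1/(2α)}`. -/
def constT (α L : ℝ) : ℝ := ((4 * α + 1) * L) ^ (1 / (2 * α))

/-- `C_λ(α, L) = (2α+1)/(2α) · ((4α+1)L)^{-1/(2α)}`. -/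
def constLam (α L : ℝ) : ℝ :=
  (2 * α + 1) / (2 * α) * ((4 * α + 1) * L) ^ (-(1 / (2 * α)))

/-- `C(α, L) = (2α+1)/(4α+1)^{1+1/(2α)} · L^{-1/(2α)}`. -/
def constC (α L : ℝ) : ℝ :=
  (2 * α + 1) / (4 * α + 1) ^ (1 + 1 / (2 * α)) * L ^ (-(1 / (2 * α)))

/-- `T = ⌊C_T(α, L) φ^{-1/α}⌋`. -/
def bandT (α L φ : ℝ) : ℕ := ⌊constT α L * φ ^ (-(1 / α))⌋₊

/-- `λ = C_λ(α, L) φ^{(2α+1)/α}`. -/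
def lam (α L φ : ℝ) : ℝ := constLam α L * φ ^ ((2 * α + 1) / α)

/-- `b(φ) = C(α, L)^{1/2} φ^{2+1/(2α)}`. -/
def bFun (α L φ : ℝ) : ℝ := √(constC α L) * φ ^ (2 + 1 / (2 * α))

/-- The distance `|i - j|` between two indices, as a real number. -/
def idist {p : ℕ} (i j : Fin p) : ℝ := |((i : ℕ) : ℝ) - ((j : ℕ) : ℝ)|

/-- The weights `w*_{ij} = λ / (2 b(φ)) · (1 - (|i-j|/T)^{2α})_+`. -/
def weight (α L φ : ℝ) {p : ℕ} (i j : Fin p) : ℝ :=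
  lam α L φ / (2 * bFun α L φ) *
    max (1 - (idist i j / (bandT α L φ : ℝ)) ^ (2 * α)) 0

/-- The class `F(α, L)` of `p × p` covariance matrices: positive semidefinite (in particular
symmetric), unit diagonal, and `(1/p) ∑_{i<j} σ_{ij}² |i-j|^{2α} ≤ L`. -/
def classF (α L : ℝ) (p : ℕ) : Set (Matrix (Fin p) (Fin p) ℝ) :=
  {S | S.PosSemidef ∧ (∀ i, S i i = 1) ∧
    1 / (p : ℝ) * ∑ i : Fin p, ∑ j ∈ Finset.Ioi i, S i j ^ 2 * idist i j ^ (2 * α) ≤ L}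

/-- The class `Q(α, L, φ)`: the matrices of `F(α, L)` with `(1/p) ∑_{i<j} σ_{ij}² ≥ φ²`. -/
def classQ (α L φ : ℝ) (p : ℕ) : Set (Matrix (Fin p) (Fin p) ℝ) :=
  {S | S ∈ classF α L p ∧
    φ ^ 2 ≤ 1 / (p : ℝ) * ∑ i : Fin p, ∑ j ∈ Finset.Ioi i, S i j ^ 2}

/-- A sample of `n` vectors of `ℝ^p`. -/
abbrev Sample (n p : ℕ) : Type := Fin n → EuclideanSpace ℝ (Fin p)

/-- The law of a sample of `n` independent `N_p(0, Σ)` vectors. -/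
abbrev law (n : ℕ) {p : ℕ} (S : Matrix (Fin p) (Fin p) ℝ) : Measure (Sample n p) :=
  Measure.pi fun _ : Fin n => multivariateGaussian (0 : EuclideanSpace ℝ (Fin p)) S

/-- The weighted U-statistic `D̂_n`. -/
def stat (α L φ : ℝ) (n p : ℕ) (X : Sample n p) : ℝ :=
  1 / ((n : ℝ) * ((n : ℝ) - 1) * (p : ℝ)) *
    ∑ k : Fin n, ∑ l ∈ Finset.univ.erase k, ∑ i : Fin p, ∑ j ∈ Finset.Ioi i,
      weight α L φ i j * (X k i * X k j * X l i * X l j)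

/-- `T₁ = 2 E_Σ {∑_{i<j} w*_{ij} (X_{1,i} X_{1,j} - σ_{ij}) (X_{2,i} X_{2,j} - σ_{ij})}²`, with
`X₁, X₂` independent `N_p(0, Σ)` vectors. -/
def term₁ (α L φ : ℝ) {p : ℕ} (S : Matrix (Fin p) (Fin p) ℝ) : ℝ :=
  2 * ∫ x : EuclideanSpace ℝ (Fin p) × EuclideanSpace ℝ (Fin p),
    (∑ i : Fin p, ∑ j ∈ Finset.Ioi i, weight α L φ i j *
      ((x.1 i * x.1 j - S i j) * (x.2 i * x.2 j - S i j))) ^ 2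
    ∂((multivariateGaussian 0 S).prod (multivariateGaussian 0 S))

/-- `T₂ = 4 E_Σ {∑_{i<j} w*_{ij} (X_{1,i} X_{1,j} - σ_{ij}) σ_{ij}}²`, with `X₁` an
`N_p(0, Σ)` vector. -/
def term₂ (α L φ : ℝ) {p : ℕ} (S : Matrix (Fin p) (Fin p) ℝ) : ℝ :=
  4 * ∫ x : EuclideanSpace ℝ (Fin p),
    (∑ i : Fin p, ∑ j ∈ Finset.Ioi i, weight α L φ i j *
      ((x i * x j - S i j) * S i j)) ^ 2
    ∂(multivariateGaussian 0 S)

/-- The asymptotic regime along which `n → ∞`, `p → ∞`, `φ → 0` (with `φ > 0`) and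
`p φ^{1/α} → ∞`. -/
structure Regime (α : ℝ) (n p : ℕ → ℕ) (φ : ℕ → ℝ) : Prop where
  tendsto_n : Tendsto n atTop atTop
  tendsto_p : Tendsto p atTop atTop
  phi_pos : ∀ m, 0 < φ m
  tendsto_phi : Tendsto φ atTop (𝓝 0)
  tendsto_p_phi : Tendsto (fun m => (p m : ℝ) * φ m ^ (1 / α)) atTop atTop

end CovTest

end

/-!
The statistic is a weighted U-statistic of order two in the products `X_i X_j`, and the proof works
with arbitrary weights `w` (`ustat`) until the weights `w*` are substituted.

*Moments.* After centring the products, the Hoeffding decomposition (`pairSum_const_add`) splits the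
statistic into a degenerate part, a linear part and its mean, which are uncorrelated
(`variance_sum_pairSum`). The covariances of products of Gaussian coordinates come from the Wick
formula (`integral_eval_mul_four`), so that `T₁` and `T₂` become explicit sums over pairs of index
pairs (`term₁_eq`, `term₂_eq`).

*Asymptotic normality for `Σ = I`.* All coordinates of all observations are independent standard
Gaussian variables, and the weights vanish beyond the band width `T`, which is small compared with
`p`. The coordinates are cut into blocks of length about `√(T p)`. The pairs within a block give
independent summands, the pairs across two blocks are few and have negligible total variance, and
Lyapunov's condition for the blocks is Gaussian hypercontractivity
(`integral_multilinear_pow_four_le`): a multilinear polynomial of degree four has a fourth moment at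
most `9 ^ 4` times its squared variance. Characteristic functions then converge
(`norm_charFun_sum_sub_le`, `tendsto_charFun_ustat`). The variance is normalized because
`∑ w*_{ij}²` is `p` times a Riemann sum of `∫ (1 - x^{2α})² dx` (`Regime.tendsto_sum_weight_sq`).

*Alternatives.* On `Q(α, L, φ)` the smoothness condition shows that the weights lose at most a
fraction close to `1 / (4α + 1)` of `∑ σ_{ij}²` (`amp_mul_le_sum_weight`), which gives the lower
bound `b(φ)` for the mean and, as this fraction is below `1 / 2`, bounds `∑ σ_{ij}²` by a multiple
of `p √T` times the mean. In the sums for `T₁` and `T₂` the terms with coinciding indices are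
estimated by the mean, and the others by counting within the band and, for `T₂`, by the
Cauchy-Schwarz inequality (`sum_mul_prodCov_sq_le`, `sum_mul_prodCov_le`).
-/

/-! ### Random variables with moments of every order -/

namespace CovTest

/-- A real random variable has moments of every order if it lies in `L^q` for every natural `q`. -/
def HasMoments {Ω : Type*} {mΩ : MeasurableSpace Ω} (f : Ω → ℝ) (P : Measure Ω) : Prop :=
  ∀ q : ℕ, MemLp f q P

namespace HasMoments

variable {Ω : Type*} {mΩ : MeasurableSpace Ω} {P : Measure Ω} {f g : Ω → ℝ}

lemma mul (hf : HasMoments f P) (hg : HasMoments g P) :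
    HasMoments (fun ω => f ω * g ω) P := by
  intro q
  have : ENNReal.HolderTriple ((2 * q : ℕ) : ENNReal) ((2 * q : ℕ) : ENNReal) (q : ENNReal) := by
    constructor
    push_cast
    rw [ENNReal.mul_inv (by simp) (by simp), ← two_mul, ← mul_assoc,
      ENNReal.mul_inv_cancel (by simp) (by simp), one_mul]
  exact (hg (2 * q)).mul' (hf (2 * q))

lemma add (hf : HasMoments f P) (hg : HasMoments g P) :
    HasMoments (fun ω => f ω + g ω) P := fun q => (hf q).add (hg q)

lemma sub (hf : HasMoments f P) (hg : HasMoments g P) :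
    HasMoments (fun ω => f ω - g ω) P := fun q => (hf q).sub (hg q)

lemma const_mul (hf : HasMoments f P) (c : ℝ) : HasMoments (fun ω => c * f ω) P :=
  fun q => (hf q).const_mul c

lemma const [IsFiniteMeasure P] (c : ℝ) : HasMoments (fun _ => c) P := fun _ => memLp_const c

lemma pow [IsFiniteMeasure P] (hf : HasMoments f P) (k : ℕ) :
    HasMoments (fun ω => f ω ^ k) P := by
  induction k with
  | zero => simpa using const (P := P) 1
  | succ k ih => simpa only [pow_succ] using ih.mul hf

lemma sum {ι : Type*} (s : Finset ι) {F : ι → Ω → ℝ} (h : ∀ i ∈ s, HasMoments (F i) P) :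
    HasMoments (fun ω => ∑ i ∈ s, F i ω) P :=
  fun q => memLp_finsetSum s fun i hi => h i hi q

lemma prod [IsFiniteMeasure P] {ι : Type*} (s : Finset ι) {F : ι → Ω → ℝ}
    (h : ∀ i ∈ s, HasMoments (F i) P) : HasMoments (fun ω => ∏ i ∈ s, F i ω) P := by
  classical
  induction s using Finset.induction_on with
  | empty => simpa using const (P := P) 1
  | insert a s ha ih =>
    simp only [Finset.prod_insert ha]
    exact (h a (by simp)).mul (ih fun i hi => h i (by simp [hi]))

lemma integrable (hf : HasMoments f P) : Integrable f P :=
  memLp_one_iff_integrable.1 (by simpa using hf 1)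

lemma memLp_two (hf : HasMoments f P) : MemLp f 2 P := by simpa using hf 2

lemma comp_measurePreserving {Ω' : Type*} {mΩ' : MeasurableSpace Ω'} {Q : Measure Ω'}
    (hf : HasMoments f P) {T : Ω' → Ω} (hT : MeasurePreserving T Q P) :
    HasMoments (fun ω => f (T ω)) Q := fun q => (hf q).comp_measurePreserving hT

end HasMoments

lemma hasMoments_of_map_gaussianReal {Ω : Type*} {mΩ : MeasurableSpace Ω} {P : Measure Ω}
    {f : Ω → ℝ} (hf : Measurable f) {m : ℝ} {v : NNReal} (h : P.map f = gaussianReal m v) :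
    HasMoments f P := by
  intro q
  have := (memLp_id_gaussianReal' (μ := m) (v := v) (q : ENNReal) (by simp))
  rw [← h, memLp_map_measure_iff (by fun_prop) hf.aemeasurable] at this
  exact this

/-! ### Gaussian moments of order at most four -/

/-- The first four moments of a centred real Gaussian law, read off from the derivatives at `0` of
its moment generating function `t ↦ exp (v t² / 2)`. -/
lemma gaussianReal_moments (v : NNReal) :
    ∫ x, x ∂(gaussianReal 0 v) = 0 ∧ ∫ x, x ^ 2 ∂(gaussianReal 0 v) = v ∧
      ∫ x, x ^ 3 ∂(gaussianReal 0 v) = 0 ∧ ∫ x, x ^ 4 ∂(gaussianReal 0 v) = 3 * (v : ℝ) ^ 2 := by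
  have key : ∀ k : ℕ, ∫ x, x ^ k ∂(gaussianReal 0 v)
      = iteratedDeriv k (fun t : ℝ => Real.exp (v * t ^ 2 / 2)) 0 := by
    intro k
    have h := iteratedDeriv_mgf_zero (X := id) (μ := gaussianReal 0 v) (by simp) k
    rw [mgf_id_gaussianReal] at h
    simpa using h.symm
  have he : ∀ t : ℝ, HasDerivAt (fun t : ℝ => Real.exp (v * t ^ 2 / 2))
      (v * t * Real.exp (v * t ^ 2 / 2)) t := by
    intro t
    have h := (((hasDerivAt_pow 2 t).const_mul (v : ℝ)).div_const 2).exp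
    convert h using 1
    push_cast; ring
  have d1 : iteratedDeriv 1 (fun t : ℝ => Real.exp (v * t ^ 2 / 2))
      = fun t : ℝ => v * t * Real.exp (v * t ^ 2 / 2) := by
    rw [iteratedDeriv_one]; ext t; exact (he t).deriv
  have d2 : iteratedDeriv 2 (fun t : ℝ => Real.exp (v * t ^ 2 / 2))
      = fun t : ℝ => (v + v ^ 2 * t ^ 2) * Real.exp (v * t ^ 2 / 2) := by
    rw [iteratedDeriv_succ, d1]; ext t
    refine HasDerivAt.deriv ?_
    convert! ((hasDerivAt_id t).const_mul (v : ℝ)).mul (he t) using 1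
    simp; ring
  have d3 : iteratedDeriv 3 (fun t : ℝ => Real.exp (v * t ^ 2 / 2))
      = fun t : ℝ => (3 * v ^ 2 * t + v ^ 3 * t ^ 3) * Real.exp (v * t ^ 2 / 2) := by
    rw [iteratedDeriv_succ, d2]; ext t
    refine HasDerivAt.deriv ?_
    convert! (((hasDerivAt_pow 2 t).const_mul ((v : ℝ) ^ 2)).const_add (v : ℝ)).mul (he t) using 1
    simp; ring
  have d4 : iteratedDeriv 4 (fun t : ℝ => Real.exp (v * t ^ 2 / 2))
      = fun t : ℝ => (3 * v ^ 2 + 6 * v ^ 3 * t ^ 2 + v ^ 4 * t ^ 4) *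
        Real.exp (v * t ^ 2 / 2) := by
    rw [iteratedDeriv_succ, d3]; ext t
    refine HasDerivAt.deriv ?_
    convert! (((hasDerivAt_id t).const_mul (3 * (v : ℝ) ^ 2)).add
      ((hasDerivAt_pow 3 t).const_mul ((v : ℝ) ^ 3))).mul (he t) using 1
    simp; ring
  refine ⟨?_, ?_, ?_, ?_⟩
  · have := key 1; rw [d1] at this; simpa only [pow_one, mul_zero, zero_mul] using this
  · rw [key 2, d2]; simp
  · rw [key 3, d3]; simp
  · rw [key 4, d4]; simp

section Wick

variable {p : ℕ} {S : Matrix (Fin p) (Fin p) ℝ}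

lemma map_inner_multivariateGaussian (S : Matrix (Fin p) (Fin p) ℝ)
    (v : EuclideanSpace ℝ (Fin p)) :
    (multivariateGaussian 0 S).map (fun x => inner ℝ v x)
      = gaussianReal 0 (covarianceBilin (multivariateGaussian 0 S) v v).toNNReal := by
  have h := IsGaussian.map_eq_gaussianReal (μ := multivariateGaussian 0 S) (innerSL ℝ v)
  rw [ContinuousLinearMap.integral_comp_id_comm IsGaussian.integrable_id,
    integral_id_multivariateGaussian, map_zero] at h
  rw [covarianceBilin_self IsGaussian.memLp_two_id]
  exact h

lemma hasMoments_eval (S : Matrix (Fin p) (Fin p) ℝ) (i : Fin p) :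
    HasMoments (fun x : EuclideanSpace ℝ (Fin p) => x i) (multivariateGaussian 0 S) := by
  have h := map_inner_multivariateGaussian S (EuclideanSpace.basisFun (Fin p) ℝ i)
  have hin : (fun x : EuclideanSpace ℝ (Fin p) => inner ℝ (EuclideanSpace.basisFun (Fin p) ℝ i) x)
      = fun x => x i := by
    ext x; simp [EuclideanSpace.basisFun_apply, EuclideanSpace.inner_single_left]
  rw [hin] at h
  exact hasMoments_of_map_gaussianReal (by fun_prop) h

lemma integral_inner_pow_four (S : Matrix (Fin p) (Fin p) ℝ) (v : EuclideanSpace ℝ (Fin p)) :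
    ∫ x, (inner ℝ v x) ^ 4 ∂(multivariateGaussian 0 S)
      = 3 * (covarianceBilin (multivariateGaussian 0 S) v v) ^ 2 := by
  have h := (gaussianReal_moments
    (covarianceBilin (multivariateGaussian 0 S) v v).toNNReal).2.2.2
  rw [← map_inner_multivariateGaussian S v, integral_map (by fun_prop) (by fun_prop)] at h
  rw [h, Real.coe_toNNReal _ (covarianceBilin_self_nonneg v)]

lemma integral_eval (S : Matrix (Fin p) (Fin p) ℝ) (i : Fin p) :
    ∫ x : EuclideanSpace ℝ (Fin p), x i ∂(multivariateGaussian 0 S) = 0 := by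
  have h := ContinuousLinearMap.integral_comp_id_comm
    (IsGaussian.integrable_id (μ := multivariateGaussian (0 : EuclideanSpace ℝ (Fin p)) S))
    (EuclideanSpace.proj (𝕜 := ℝ) i)
  rw [integral_id_multivariateGaussian] at h
  simpa using h

lemma integral_eval_mul (hS : S.PosSemidef) (i j : Fin p) :
    ∫ x : EuclideanSpace ℝ (Fin p), x i * x j ∂(multivariateGaussian 0 S) = S i j := by
  rw [← covariance_eval_multivariateGaussian (μ := 0) hS i j,
    covariance_eq_sub (hasMoments_eval S i).memLp_two (hasMoments_eval S j).memLp_two,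
    integral_eval, zero_mul, sub_zero]
  rfl

/-- The Wick (Isserlis) formula for four coordinates of a centred Gaussian vector. It follows by
polarization from `E (u·X)⁴ = 3 (Var (u·X))²`. -/
lemma integral_eval_mul_four (hS : S.PosSemidef) (i j k l : Fin p) :
    ∫ x : EuclideanSpace ℝ (Fin p), x i * x j * (x k * x l) ∂(multivariateGaussian 0 S)
      = S i j * S k l + S i k * S j l + S i l * S j k := by
  set μ := multivariateGaussian (0 : EuclideanSpace ℝ (Fin p)) S with hμ
  let e : Fin p → EuclideanSpace ℝ (Fin p) := fun i => EuclideanSpace.basisFun (Fin p) ℝ i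
  have hin : ∀ i x, inner ℝ (e i) x = x i := by
    intro i x; simp [e, EuclideanSpace.basisFun_apply, EuclideanSpace.inner_single_left]
  have hc : ∀ i j, covarianceBilin μ (e i) (e j) = S i j := by
    intro i j
    rw [covarianceBilin_multivariateGaussian hS]
    simp [e]
  have hsym : ∀ i j, S i j = S j i := fun i j => by
    simpa using (hS.1.apply i j).symm
  have hM : ∀ i, HasMoments (fun x : EuclideanSpace ℝ (Fin p) => inner ℝ (e i) x) μ := by
    intro i; simp only [hin]; exact hasMoments_eval S i
  have hI : ∀ v, Integrable (fun x => (inner ℝ v x) ^ 4) μ := by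
    intro v
    exact ((hasMoments_of_map_gaussianReal (by fun_prop)
      (map_inner_multivariateGaussian S v)).pow 4).integrable
  have hpol : ∀ x : EuclideanSpace ℝ (Fin p), x i * x j * (x k * x l) = 1 / 192 *
      ((inner ℝ (e i + e j + e k + e l) x) ^ 4 - (inner ℝ (e i + e j + e k - e l) x) ^ 4
        - (inner ℝ (e i + e j - e k + e l) x) ^ 4 + (inner ℝ (e i + e j - e k - e l) x) ^ 4
        - (inner ℝ (e i - e j + e k + e l) x) ^ 4 + (inner ℝ (e i - e j + e k - e l) x) ^ 4
        + (inner ℝ (e i - e j - e k + e l) x) ^ 4 - (inner ℝ (e i - e j - e k - e l) x) ^ 4) := by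
    intro x
    simp only [inner_add_left, inner_sub_left, hin]
    ring
  simp_rw [hpol]
  rw [integral_const_mul, integral_sub (by fun_prop) (by fun_prop),
    integral_add (by fun_prop) (by fun_prop), integral_add (by fun_prop) (by fun_prop),
    integral_sub (by fun_prop) (by fun_prop), integral_add (by fun_prop) (by fun_prop),
    integral_sub (by fun_prop) (by fun_prop), integral_sub (by fun_prop) (by fun_prop)]
  simp only [hμ, integral_inner_pow_four]
  simp only [← hμ, map_add, map_sub, add_apply, sub_apply,
    hc]
  rw [hsym j i, hsym k i, hsym l i, hsym k j, hsym l j, hsym l k]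
  ring

end Wick

end CovTest

/-! ### Moments of weighted U-statistics of order two -/

namespace CovTest

section UStatistic

variable {E : Type*} {mE : MeasurableSpace E} {μ : Measure E} [IsProbabilityMeasure μ] {n : ℕ}

lemma HasMoments.comp_eval {f : E → ℝ} (hf : HasMoments f μ) (k : Fin n) :
    HasMoments (fun X : Fin n → E => f (X k)) (Measure.pi fun _ => μ) :=
  hf.comp_measurePreserving (measurePreserving_eval (fun _ => μ) k)

lemma integral_pi_eval (f : E → ℝ) (k : Fin n) :
    ∫ X : Fin n → E, f (X k) ∂(Measure.pi fun _ => μ) = ∫ x, f x ∂μ := by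
  have h := integral_fintype_prod_eq_prod (𝕜 := ℝ) (μ := fun _ : Fin n => μ)
    (fun m x => if m = k then f x else 1)
  have h2 : ∀ m : Fin n, ∫ x, (if m = k then f x else 1) ∂μ = if m = k then ∫ x, f x ∂μ else 1 := by
    intro m; split_ifs <;> simp
  simpa [h2] using h

lemma integral_pi_mul_of_ne (f g : E → ℝ) {k l : Fin n} (hkl : k ≠ l) :
    ∫ X : Fin n → E, f (X k) * g (X l) ∂(Measure.pi fun _ => μ)
      = (∫ x, f x ∂μ) * ∫ x, g x ∂μ := by
  have h := integral_fintype_prod_eq_prod (𝕜 := ℝ) (μ := fun _ : Fin n => μ)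
    (fun m x => (if m = k then f x else 1) * (if m = l then g x else 1))
  have h2 : ∀ m : Fin n, ∫ x, (if m = k then f x else 1) * (if m = l then g x else 1) ∂μ
      = (if m = k then ∫ x, f x ∂μ else 1) * (if m = l then ∫ x, g x ∂μ else 1) := by
    intro m
    by_cases h1 : m = k
    · have : m ≠ l := h1 ▸ hkl
      simp [h1, h1 ▸ this]
    · by_cases h3 : m = l
      · simp only [if_neg h1, if_pos h3, one_mul]
      · simp [h1, h3]
  simpa only [h2, Finset.prod_mul_distrib, Finset.prod_ite_eq', Finset.mem_univ, if_true] using h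

/-- A product of functions of single observations integrates to zero if it contains a centred
factor whose observation occurs in no other factor. -/
lemma integral_pi_mul_four_eq_zero (f₁ f₂ f₃ f₄ : E → ℝ) {k l k' l' : Fin n}
    (h₁ : ∫ x, f₁ x ∂μ = 0) (hl : k ≠ l) (hk' : k ≠ k') (hl' : k ≠ l') :
    ∫ X : Fin n → E, f₁ (X k) * f₂ (X l) * (f₃ (X k') * f₄ (X l'))
      ∂(Measure.pi fun _ => μ) = 0 := by
  have h := integral_fintype_prod_eq_prod (𝕜 := ℝ) (μ := fun _ : Fin n => μ)
    (fun m x => (if m = k then f₁ x else 1) * (if m = l then f₂ x else 1) *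
      ((if m = k' then f₃ x else 1) * (if m = l' then f₄ x else 1)))
  rw [Finset.prod_eq_zero (i := k) (Finset.mem_univ k) (by simp [hl, hk', hl', h₁])] at h
  simpa only [Finset.prod_mul_distrib, Finset.prod_ite_eq', Finset.mem_univ, if_true] using h

variable {κ : Type*} {A : κ → E → ℝ}

/-- The sum over distinct observations `k ≠ l` of `f (X k) * f (X l)`. -/
def pairSum (f : E → ℝ) (X : Fin n → E) : ℝ :=
  ∑ k : Fin n, ∑ l ∈ Finset.univ.erase k, f (X k) * f (X l)

/-- The sum over the observations of `f (X k)`. -/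
def singleSum (f : E → ℝ) (X : Fin n → E) : ℝ := ∑ k : Fin n, f (X k)

lemma hasMoments_pairSum {f : E → ℝ} (hf : HasMoments f μ) :
    HasMoments (pairSum (n := n) f) (Measure.pi fun _ => μ) :=
  HasMoments.sum _ fun k _ => HasMoments.sum _ fun l _ => (hf.comp_eval k).mul (hf.comp_eval l)

lemma hasMoments_singleSum {f : E → ℝ} (hf : HasMoments f μ) :
    HasMoments (singleSum (n := n) f) (Measure.pi fun _ => μ) :=
  HasMoments.sum _ fun k _ => hf.comp_eval k

lemma pairSum_const_add (f : E → ℝ) (s : ℝ) (X : Fin n → E) :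
    pairSum (fun x => f x + s) X
      = pairSum f X + 2 * ((n : ℝ) - 1) * s * singleSum f X + (n : ℝ) * ((n : ℝ) - 1) * s ^ 2 := by
  have hsum : ∀ (g : Fin n → ℝ) (k : Fin n),
      ∑ l ∈ Finset.univ.erase k, g l = (∑ l, g l) - g k := fun g k => by
    rw [Finset.sum_erase_eq_sub (Finset.mem_univ k)]
  unfold pairSum singleSum
  simp only [hsum]
  simp only [add_mul, mul_add, Finset.sum_add_distrib, Finset.sum_sub_distrib, ← Finset.mul_sum,
    ← Finset.sum_mul, Finset.sum_const, Finset.card_univ, Fintype.card_fin, nsmul_eq_mul]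
  ring

lemma integral_pairSum {f : E → ℝ} (hf : HasMoments f μ) (h0 : ∫ x, f x ∂μ = 0) :
    ∫ X : Fin n → E, pairSum f X ∂(Measure.pi fun _ => μ) = 0 := by
  unfold pairSum
  rw [integral_finsetSum _ fun k _ => (HasMoments.sum _ fun l _ =>
    (hf.comp_eval k).mul (hf.comp_eval l)).integrable]
  refine Finset.sum_eq_zero fun k _ => ?_
  rw [integral_finsetSum _ fun l _ => ((hf.comp_eval k).mul (hf.comp_eval l)).integrable]
  refine Finset.sum_eq_zero fun l hl => ?_
  rw [integral_pi_mul_of_ne f f (Finset.ne_of_mem_erase hl).symm, h0, zero_mul]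

lemma integral_singleSum {f : E → ℝ} (hf : HasMoments f μ) (h0 : ∫ x, f x ∂μ = 0) :
    ∫ X : Fin n → E, singleSum f X ∂(Measure.pi fun _ => μ) = 0 := by
  unfold singleSum
  rw [integral_finsetSum _ fun k _ => (hf.comp_eval k).integrable]
  exact Finset.sum_eq_zero fun k _ => by rw [integral_pi_eval, h0]

lemma integral_singleSum_mul {f g : E → ℝ} (hf : HasMoments f μ) (hg : HasMoments g μ)
    (hf0 : ∫ x, f x ∂μ = 0) :
    ∫ X : Fin n → E, singleSum f X * singleSum g X ∂(Measure.pi fun _ => μ)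
      = n * ∫ x, f x * g x ∂μ := by
  unfold singleSum
  simp only [Finset.sum_mul_sum]
  rw [integral_finsetSum _ fun k _ => (HasMoments.sum _ fun l _ =>
    (hf.comp_eval k).mul (hg.comp_eval l)).integrable]
  have : ∀ k : Fin n, ∫ X : Fin n → E, ∑ l, f (X k) * g (X l) ∂(Measure.pi fun _ => μ)
      = ∫ x, f x * g x ∂μ := by
    intro k
    rw [integral_finsetSum _ fun l _ => ((hf.comp_eval k).mul (hg.comp_eval l)).integrable,
      Finset.sum_eq_single k]
    · exact integral_pi_eval (fun x => f x * g x) k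
    · intro l _ hl
      rw [integral_pi_mul_of_ne f g hl.symm, hf0, zero_mul]
    · simp
  simp [this]

lemma integral_pairSum_mul_singleSum {f g : E → ℝ} (hf : HasMoments f μ) (hg : HasMoments g μ)
    (hf0 : ∫ x, f x ∂μ = 0) :
    ∫ X : Fin n → E, pairSum f X * singleSum g X ∂(Measure.pi fun _ => μ) = 0 := by
  have hm : ∀ k l m : Fin n, HasMoments (fun X : Fin n → E => f (X k) * f (X l) * g (X m))
      (Measure.pi fun _ => μ) :=
    fun k l m => ((hf.comp_eval k).mul (hf.comp_eval l)).mul (hg.comp_eval m)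
  unfold pairSum singleSum
  simp only [Finset.sum_mul]
  simp only [Finset.mul_sum]
  rw [integral_finsetSum _ fun k _ => (HasMoments.sum _ fun l _ => HasMoments.sum _ fun m _ =>
    hm k l m).integrable]
  refine Finset.sum_eq_zero fun k _ => ?_
  rw [integral_finsetSum _ fun l _ => (HasMoments.sum _ fun m _ => hm k l m).integrable]
  refine Finset.sum_eq_zero fun l hl => ?_
  rw [integral_finsetSum _ fun m _ => (hm k l m).integrable]
  refine Finset.sum_eq_zero fun m _ => ?_
  have hkl := (Finset.ne_of_mem_erase hl).symm
  by_cases hkm : k = m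
  · have h := integral_pi_mul_four_eq_zero (μ := μ) f f g (fun _ => 1) hf0 hkl.symm
      (hkm ▸ hkl.symm : l ≠ m) (hkm ▸ hkl.symm : l ≠ m)
    simp only [mul_one] at h
    rw [← h]
    congr 1; ext X; ring
  · have h := integral_pi_mul_four_eq_zero (μ := μ) f f g (fun _ => 1) hf0 hkl hkm hkm
    simpa only [mul_one] using h

lemma integral_pairSum_mul {f g : E → ℝ} (hf : HasMoments f μ) (hg : HasMoments g μ)
    (hf0 : ∫ x, f x ∂μ = 0) :
    ∫ X : Fin n → E, pairSum f X * pairSum g X ∂(Measure.pi fun _ => μ)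
      = 2 * (n : ℝ) * ((n : ℝ) - 1) * (∫ x, f x * g x ∂μ) ^ 2 := by
  have hm : ∀ k l k' l' : Fin n, HasMoments
      (fun X : Fin n → E => f (X k) * f (X l) * (g (X k') * g (X l'))) (Measure.pi fun _ => μ) :=
    fun k l k' l' => ((hf.comp_eval k).mul (hf.comp_eval l)).mul
      ((hg.comp_eval k').mul (hg.comp_eval l'))
  have hval : ∀ k l k' l' : Fin n, k ≠ l → k' ≠ l' →
      ∫ X : Fin n → E, f (X k) * f (X l) * (g (X k') * g (X l')) ∂(Measure.pi fun _ => μ)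
        = (if k' = k ∧ l' = l then (∫ x, f x * g x ∂μ) ^ 2 else 0)
          + if k' = l ∧ l' = k then (∫ x, f x * g x ∂μ) ^ 2 else 0 := by
    intro k l k' l' hkl hkl'
    by_cases hk : k ≠ k' ∧ k ≠ l'
    · rw [integral_pi_mul_four_eq_zero f f g g hf0 hkl hk.1 hk.2, if_neg (by tauto),
        if_neg (by tauto), add_zero]
    by_cases hl : l ≠ k' ∧ l ≠ l'
    · have h := integral_pi_mul_four_eq_zero (μ := μ) f f g g hf0 hkl.symm hl.1 hl.2
      rw [if_neg (by tauto), if_neg (by tauto), add_zero, ← h]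
      congr 1; ext X; ring
    have hsq := integral_pi_mul_of_ne (μ := μ) (fun x => f x * g x) (fun x => f x * g x) hkl
    by_cases h1 : k' = k
    · have h2 : l' = l := by
        by_contra h
        exact hl ⟨fun h' => hkl (h1 ▸ h'.symm), fun h' => h h'.symm⟩
      subst h1 h2
      rw [if_pos ⟨rfl, rfl⟩, if_neg (by tauto), add_zero, sq, ← hsq]
      congr 1; ext X; ring
    · have h2 : l' = k := by
        by_contra h
        exact hk ⟨fun h' => h1 h'.symm, fun h' => h h'.symm⟩
      have h3 : k' = l := by
        by_contra h
        exact hl ⟨fun h' => h h'.symm, fun h' => hkl (h2 ▸ h'.symm)⟩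
      subst h2 h3
      rw [if_neg (by tauto), if_pos ⟨rfl, rfl⟩, zero_add, sq, ← hsq]
      congr 1; ext X; ring
  unfold pairSum
  simp only [Finset.sum_mul]
  simp only [Finset.mul_sum]
  rw [integral_finsetSum _ fun k _ => (HasMoments.sum _ fun l _ => HasMoments.sum _ fun k' _ =>
    HasMoments.sum _ fun l' _ => hm k l k' l').integrable]
  have hin : ∀ k : Fin n, ∀ l ∈ Finset.univ.erase k,
      ∑ k' : Fin n, ∑ l' ∈ Finset.univ.erase k',
        ∫ X : Fin n → E, f (X k) * f (X l) * (g (X k') * g (X l')) ∂(Measure.pi fun _ => μ)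
          = 2 * (∫ x, f x * g x ∂μ) ^ 2 := by
    intro k l hl
    have hkl := (Finset.ne_of_mem_erase hl).symm
    rw [Finset.sum_congr rfl fun k' _ => Finset.sum_congr rfl fun l' hl' =>
      hval k l k' l' hkl (Finset.ne_of_mem_erase hl').symm]
    simp only [Finset.sum_add_distrib, ite_and]
    rw [Finset.sum_eq_single k (by intro b _ hb; simp [hb]) (by simp),
      Finset.sum_eq_single l (by intro b _ hb; simp [hb]) (fun h => absurd hl h)]
    simp [hkl]
    ring
  have hout : ∀ k : Fin n, ∫ X : Fin n → E, ∑ l ∈ Finset.univ.erase k, ∑ k' : Fin n,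
      ∑ l' ∈ Finset.univ.erase k', f (X k) * f (X l) * (g (X k') * g (X l'))
        ∂(Measure.pi fun _ => μ)
      = ((n : ℝ) - 1) * (2 * (∫ x, f x * g x ∂μ) ^ 2) := by
    intro k
    rw [integral_finsetSum _ fun l _ => (HasMoments.sum _ fun k' _ =>
      HasMoments.sum _ fun l' _ => hm k l k' l').integrable]
    have : ∀ l ∈ Finset.univ.erase k, ∫ X : Fin n → E, ∑ k' : Fin n,
      ∑ l' ∈ Finset.univ.erase k', f (X k) * f (X l) * (g (X k') * g (X l'))
        ∂(Measure.pi fun _ => μ) = 2 * (∫ x, f x * g x ∂μ) ^ 2 := by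
      intro l hl
      rw [integral_finsetSum _ fun k' _ => (HasMoments.sum _ fun l' _ => hm k l k' l').integrable,
        ← hin k l hl]
      refine Finset.sum_congr rfl fun k' _ => ?_
      rw [integral_finsetSum _ fun l' _ => (hm k l k' l').integrable]
    rw [Finset.sum_congr rfl this, Finset.sum_const, nsmul_eq_mul,
      Finset.card_erase_of_mem (Finset.mem_univ k), Finset.card_univ, Fintype.card_fin,
      Nat.cast_pred (by have := k.2; omega)]
  rw [Finset.sum_congr rfl fun k _ => hout k, Finset.sum_const, nsmul_eq_mul, Finset.card_univ,
    Fintype.card_fin]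
  ring

variable (w s : κ → ℝ) (𝒜 : Finset κ)

lemma integral_sum_pairSum (hA : ∀ a ∈ 𝒜, HasMoments (A a) μ)
    (hA0 : ∀ a ∈ 𝒜, ∫ x, A a x ∂μ = 0) :
    ∫ X : Fin n → E, ∑ a ∈ 𝒜, w a * pairSum (fun x => A a x + s a) X ∂(Measure.pi fun _ => μ)
      = (n : ℝ) * ((n : ℝ) - 1) * ∑ a ∈ 𝒜, w a * s a ^ 2 := by
  have hm : ∀ a ∈ 𝒜, HasMoments (pairSum (n := n) fun x => A a x + s a)
      (Measure.pi fun _ => μ) :=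
    fun a ha => hasMoments_pairSum ((hA a ha).add (HasMoments.const _))
  rw [integral_finsetSum _ fun a ha => ((hm a ha).const_mul _).integrable, Finset.mul_sum]
  refine Finset.sum_congr rfl fun a ha => ?_
  rw [integral_const_mul]
  simp only [pairSum_const_add]
  have h1 := hasMoments_pairSum (n := n) (hA a ha)
  have h2 := (hasMoments_singleSum (n := n) (hA a ha)).const_mul (2 * ((n : ℝ) - 1) * s a)
  rw [integral_add (h1.add h2).integrable (integrable_const _),
    integral_add h1.integrable h2.integrable, integral_const_mul,
    integral_pairSum (hA a ha) (hA0 a ha), integral_singleSum (hA a ha) (hA0 a ha)]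
  simp
  ring

/-- The variance of a weighted U-statistic, from its Hoeffding decomposition: the degenerate part
`pairSum` and the linear part `singleSum` are orthogonal. -/
lemma variance_sum_pairSum (hA : ∀ a ∈ 𝒜, HasMoments (A a) μ)
    (hA0 : ∀ a ∈ 𝒜, ∫ x, A a x ∂μ = 0) :
    Var[fun X : Fin n → E => ∑ a ∈ 𝒜, w a * pairSum (fun x => A a x + s a) X;
        Measure.pi fun _ => μ]
      = ∑ a ∈ 𝒜, ∑ b ∈ 𝒜, w a * w b *
          (2 * (n : ℝ) * ((n : ℝ) - 1) * (∫ x, A a x * A b x ∂μ) ^ 2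
            + 4 * (n : ℝ) * ((n : ℝ) - 1) ^ 2 * (s a * s b * ∫ x, A a x * A b x ∂μ)) := by
  have hm : ∀ a ∈ 𝒜, HasMoments (pairSum (n := n) fun x => A a x + s a)
      (Measure.pi fun _ => μ) :=
    fun a ha => hasMoments_pairSum ((hA a ha).add (HasMoments.const _))
  rw [variance_eq_integral
    (HasMoments.sum _ fun a ha => (hm a ha).const_mul (w a)).memLp_two.aemeasurable,
    integral_sum_pairSum w s 𝒜 hA hA0]
  set c : ℝ := 2 * ((n : ℝ) - 1) with hc
  have hexp : ∀ X : Fin n → E, (∑ a ∈ 𝒜, w a * pairSum (fun x => A a x + s a) X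
      - (n : ℝ) * ((n : ℝ) - 1) * ∑ a ∈ 𝒜, w a * s a ^ 2) ^ 2
      = ∑ a ∈ 𝒜, ∑ b ∈ 𝒜, w a * w b * (pairSum (A a) X * pairSum (A b) X
        + (c * s b) * (pairSum (A a) X * singleSum (A b) X)
        + (c * s a) * (pairSum (A b) X * singleSum (A a) X)
        + (c ^ 2 * s a * s b) * (singleSum (A a) X * singleSum (A b) X)) := by
    intro X
    have : ∑ a ∈ 𝒜, w a * pairSum (fun x => A a x + s a) X
        - (n : ℝ) * ((n : ℝ) - 1) * ∑ a ∈ 𝒜, w a * s a ^ 2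
        = ∑ a ∈ 𝒜, w a * (pairSum (A a) X + c * s a * singleSum (A a) X) := by
      rw [Finset.mul_sum, ← Finset.sum_sub_distrib]
      refine Finset.sum_congr rfl fun a _ => ?_
      rw [pairSum_const_add]
      ring
    rw [this, sq, Finset.sum_mul_sum]
    refine Finset.sum_congr rfl fun a _ => Finset.sum_congr rfl fun b _ => ?_
    ring
  have hqq : ∀ a ∈ 𝒜, ∀ b ∈ 𝒜, HasMoments (fun X : Fin n → E =>
      pairSum (A a) X * pairSum (A b) X) (Measure.pi fun _ => μ) :=
    fun a ha b hb => (hasMoments_pairSum (hA a ha)).mul (hasMoments_pairSum (hA b hb))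
  have hqr : ∀ a ∈ 𝒜, ∀ b ∈ 𝒜, HasMoments (fun X : Fin n → E =>
      pairSum (A a) X * singleSum (A b) X) (Measure.pi fun _ => μ) :=
    fun a ha b hb => (hasMoments_pairSum (hA a ha)).mul (hasMoments_singleSum (hA b hb))
  have hrr : ∀ a ∈ 𝒜, ∀ b ∈ 𝒜, HasMoments (fun X : Fin n → E =>
      singleSum (A a) X * singleSum (A b) X) (Measure.pi fun _ => μ) :=
    fun a ha b hb => (hasMoments_singleSum (hA a ha)).mul (hasMoments_singleSum (hA b hb))
  have hall : ∀ a ∈ 𝒜, ∀ b ∈ 𝒜, HasMoments (fun X : Fin n → E =>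
      w a * w b * (pairSum (A a) X * pairSum (A b) X
        + (c * s b) * (pairSum (A a) X * singleSum (A b) X)
        + (c * s a) * (pairSum (A b) X * singleSum (A a) X)
        + (c ^ 2 * s a * s b) * (singleSum (A a) X * singleSum (A b) X)))
      (Measure.pi fun _ => μ) :=
    fun a ha b hb => ((((hqq a ha b hb).add ((hqr a ha b hb).const_mul _)).add
      ((hqr b hb a ha).const_mul _)).add ((hrr a ha b hb).const_mul _)).const_mul _
  simp only [hexp]
  rw [integral_finsetSum _ fun a ha => (HasMoments.sum _ fun b hb => hall a ha b hb).integrable]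
  refine Finset.sum_congr rfl fun a ha => ?_
  rw [integral_finsetSum _ fun b hb => (hall a ha b hb).integrable]
  refine Finset.sum_congr rfl fun b hb => ?_
  have i1 := hqq a ha b hb
  have i2 := (hqr a ha b hb).const_mul (c * s b)
  have i3 := (hqr b hb a ha).const_mul (c * s a)
  have i4 := (hrr a ha b hb).const_mul (c ^ 2 * s a * s b)
  rw [integral_const_mul, integral_add ((i1.add i2).add i3).integrable i4.integrable,
    integral_add (i1.add i2).integrable i3.integrable, integral_add i1.integrable i2.integrable,
    integral_const_mul, integral_const_mul, integral_const_mul,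
    integral_pairSum_mul (hA a ha) (hA b hb) (hA0 a ha),
    integral_pairSum_mul_singleSum (hA a ha) (hA b hb) (hA0 a ha),
    integral_pairSum_mul_singleSum (hA b hb) (hA a ha) (hA0 b hb),
    integral_singleSum_mul (hA a ha) (hA b hb) (hA0 a ha), hc]
  ring

end UStatistic

end CovTest

/-! ### Mean and variance of the weighted covariance statistic -/

namespace CovTest

/-- The pairs `(i, j)` of indices with `i < j`. -/
def indexPairs (p : ℕ) : Finset (Fin p × Fin p) := Finset.univ.filter fun a => a.1 < a.2

lemma mem_indexPairs {p : ℕ} {a : Fin p × Fin p} : a ∈ indexPairs p ↔ a.1 < a.2 := by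
  simp [indexPairs]

lemma sum_Ioi_eq_sum_indexPairs {p : ℕ} (f : Fin p → Fin p → ℝ) :
    ∑ i : Fin p, ∑ j ∈ Finset.Ioi i, f i j = ∑ a ∈ indexPairs p, f a.1 a.2 := by
  rw [indexPairs, Finset.sum_filter, Fintype.sum_prod_type]
  refine Finset.sum_congr rfl fun i _ => ?_
  rw [← Finset.sum_filter]
  congr 1
  ext j
  simp

/-- The statistic of the problem, with arbitrary weights `w`. -/
noncomputable def ustat {p : ℕ} (w : Fin p → Fin p → ℝ) (n : ℕ) (X : Sample n p) : ℝ :=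
  1 / ((n : ℝ) * ((n : ℝ) - 1) * (p : ℝ)) *
    ∑ k : Fin n, ∑ l ∈ Finset.univ.erase k, ∑ i : Fin p, ∑ j ∈ Finset.Ioi i,
      w i j * (X k i * X k j * X l i * X l j)

lemma stat_eq_ustat (α L φ : ℝ) (n p : ℕ) :
    stat α L φ n p = ustat (fun i j : Fin p => weight α L φ i j) n := rfl

/-- The covariance of `X_i X_j` and `X_k X_l`, for `a = (i, j)` and `b = (k, l)`, when `X` is a
centred Gaussian vector with covariance matrix `S`. -/
noncomputable def prodCov {p : ℕ} (S : Matrix (Fin p) (Fin p) ℝ) (a b : Fin p × Fin p) : ℝ :=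
  S a.1 b.1 * S a.2 b.2 + S a.1 b.2 * S a.2 b.1

variable {p : ℕ}

/-- The product of two coordinates, centred at `S i j`. -/
noncomputable def centredProd (S : Matrix (Fin p) (Fin p) ℝ) (a : Fin p × Fin p)
    (x : EuclideanSpace ℝ (Fin p)) : ℝ := x a.1 * x a.2 - S a.1 a.2

lemma hasMoments_centredProd (S : Matrix (Fin p) (Fin p) ℝ) (a : Fin p × Fin p) :
    HasMoments (centredProd S a) (multivariateGaussian 0 S) :=
  ((hasMoments_eval S a.1).mul (hasMoments_eval S a.2)).sub (HasMoments.const _)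

section Moments

variable {S : Matrix (Fin p) (Fin p) ℝ}

lemma integral_centredProd (hS : S.PosSemidef) (a : Fin p × Fin p) :
    ∫ x, centredProd S a x ∂(multivariateGaussian 0 S) = 0 := by
  unfold centredProd
  rw [integral_sub ((hasMoments_eval S a.1).mul (hasMoments_eval S a.2)).integrable
    (integrable_const _), integral_eval_mul hS]
  simp

lemma integral_centredProd_mul (hS : S.PosSemidef) (a b : Fin p × Fin p) :
    ∫ x, centredProd S a x * centredProd S b x ∂(multivariateGaussian 0 S) = prodCov S a b := by
  have ha := (hasMoments_eval S a.1).mul (hasMoments_eval S a.2)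
  have hb := (hasMoments_eval S b.1).mul (hasMoments_eval S b.2)
  have hexp : ∀ x : EuclideanSpace ℝ (Fin p), centredProd S a x * centredProd S b x
      = x a.1 * x a.2 * (x b.1 * x b.2) - S b.1 b.2 * (x a.1 * x a.2)
        - S a.1 a.2 * (x b.1 * x b.2 - S b.1 b.2) := by
    intro x; unfold centredProd; ring
  have hb0 := integral_centredProd hS b
  unfold centredProd at hb0
  simp only [hexp]
  rw [integral_sub ((ha.mul hb).sub (ha.const_mul _)).integrable
      ((hb.sub (HasMoments.const _)).const_mul _).integrable,
    integral_sub (ha.mul hb).integrable (ha.const_mul _).integrable, integral_const_mul,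
    integral_const_mul, hb0, integral_eval_mul_four hS, integral_eval_mul hS, prodCov]
  ring

lemma ustat_eq_sum_pairSum (S : Matrix (Fin p) (Fin p) ℝ) (w : Fin p → Fin p → ℝ) (n : ℕ)
    (X : Sample n p) :
    ustat w n X = 1 / ((n : ℝ) * ((n : ℝ) - 1) * (p : ℝ)) *
      ∑ a ∈ indexPairs p, w a.1 a.2 *
        pairSum (fun x => centredProd S a x + S a.1 a.2) X := by
  unfold ustat pairSum centredProd
  refine congrArg _ ?_
  simp only [sum_Ioi_eq_sum_indexPairs, sub_add_cancel, Finset.mul_sum]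
  rw [Finset.sum_congr rfl fun k _ => Finset.sum_comm, Finset.sum_comm]
  refine Finset.sum_congr rfl fun a _ => Finset.sum_congr rfl fun k _ =>
    Finset.sum_congr rfl fun l _ => ?_
  ring

lemma hasMoments_ustat (S : Matrix (Fin p) (Fin p) ℝ) (w : Fin p → Fin p → ℝ) (n : ℕ) :
    HasMoments (ustat w n) (law n S) := by
  have h : ustat w n = fun X => 1 / ((n : ℝ) * ((n : ℝ) - 1) * (p : ℝ)) *
      ∑ a ∈ indexPairs p, w a.1 a.2 * pairSum (fun x => centredProd S a x + S a.1 a.2) X :=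
    funext fun X => ustat_eq_sum_pairSum S w n X
  rw [h]
  exact (HasMoments.sum _ fun a _ => (hasMoments_pairSum
    ((hasMoments_centredProd S a).add (HasMoments.const _))).const_mul _).const_mul _

lemma integral_ustat (hS : S.PosSemidef) (w : Fin p → Fin p → ℝ) {n : ℕ} (hn : 2 ≤ n) :
    ∫ X, ustat w n X ∂(law n S)
      = 1 / (p : ℝ) * ∑ i : Fin p, ∑ j ∈ Finset.Ioi i, w i j * S i j ^ 2 := by
  have hn' : (2 : ℝ) ≤ n := by exact_mod_cast hn
  simp only [ustat_eq_sum_pairSum S w n]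
  rw [integral_const_mul, integral_sum_pairSum (fun a => w a.1 a.2) (fun a => S a.1 a.2)
    (indexPairs p) (fun a _ => hasMoments_centredProd S a) (fun a _ => integral_centredProd hS a),
    sum_Ioi_eq_sum_indexPairs (fun i j => w i j * S i j ^ 2), ← mul_assoc]
  congr 1
  have h1 : (n : ℝ) - 1 ≠ 0 := by linarith
  have h2 : (n : ℝ) ≠ 0 := by linarith
  by_cases hp : (p : ℝ) = 0
  · simp [hp]
  · field_simp

lemma variance_ustat (hS : S.PosSemidef) (w : Fin p → Fin p → ℝ) {n : ℕ} (hn : 2 ≤ n) :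
    Var[ustat w n; law n S]
      = (2 * ∑ a ∈ indexPairs p, ∑ b ∈ indexPairs p,
            w a.1 a.2 * w b.1 b.2 * prodCov S a b ^ 2) / ((n : ℝ) * ((n : ℝ) - 1) * (p : ℝ) ^ 2)
        + (4 * ∑ a ∈ indexPairs p, ∑ b ∈ indexPairs p, w a.1 a.2 * w b.1 b.2 *
            (S a.1 a.2 * S b.1 b.2 * prodCov S a b)) / ((n : ℝ) * (p : ℝ) ^ 2) := by
  have hn' : (2 : ℝ) ≤ n := by exact_mod_cast hn
  have h : ustat w n = fun X => 1 / ((n : ℝ) * ((n : ℝ) - 1) * (p : ℝ)) *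
      ∑ a ∈ indexPairs p, w a.1 a.2 * pairSum (fun x => centredProd S a x + S a.1 a.2) X :=
    funext fun X => ustat_eq_sum_pairSum S w n X
  rw [h, variance_const_mul, variance_sum_pairSum (fun a => w a.1 a.2) (fun a => S a.1 a.2)
    (indexPairs p) (fun a _ => hasMoments_centredProd S a) (fun a _ => integral_centredProd hS a)]
  simp only [integral_centredProd_mul hS, Finset.mul_sum, Finset.sum_div,
    ← Finset.sum_add_distrib]
  refine Finset.sum_congr rfl fun a _ => Finset.sum_congr rfl fun b _ => ?_
  have h1 : (n : ℝ) - 1 ≠ 0 := by linarith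
  have h2 : (n : ℝ) ≠ 0 := by linarith
  by_cases hp : (p : ℝ) = 0
  · simp [hp]
  · field_simp

lemma prodCov_one {a b : Fin p × Fin p} (ha : a ∈ indexPairs p) (hb : b ∈ indexPairs p) :
    prodCov (1 : Matrix (Fin p) (Fin p) ℝ) a b = if a = b then 1 else 0 := by
  obtain ⟨i, j⟩ := a
  obtain ⟨k, l⟩ := b
  rw [mem_indexPairs] at ha hb
  simp only at ha hb
  have h2 : ¬(i = l ∧ j = k) := fun h => by
    obtain ⟨rfl, rfl⟩ := h
    exact absurd ha (lt_asymm hb)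
  simp only [prodCov, Matrix.one_apply, Prod.mk.injEq]
  by_cases h1 : i = k <;> by_cases h3 : j = l <;> by_cases h4 : i = l <;> by_cases h5 : j = k <;>
    simp_all

lemma variance_ustat_one (w : Fin p → Fin p → ℝ) {n : ℕ} (hn : 2 ≤ n) :
    Var[ustat w n; law n (1 : Matrix (Fin p) (Fin p) ℝ)]
      = 2 / ((n : ℝ) * ((n : ℝ) - 1) * (p : ℝ) ^ 2) *
          ∑ i : Fin p, ∑ j ∈ Finset.Ioi i, w i j ^ 2 := by
  rw [variance_ustat Matrix.PosSemidef.one w hn, sum_Ioi_eq_sum_indexPairs (fun i j => w i j ^ 2)]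
  have h1 : ∀ a ∈ indexPairs p, ∑ b ∈ indexPairs p,
      w a.1 a.2 * w b.1 b.2 * prodCov (1 : Matrix (Fin p) (Fin p) ℝ) a b ^ 2 = w a.1 a.2 ^ 2 := by
    intro a ha
    rw [Finset.sum_congr rfl fun b hb => by rw [prodCov_one ha hb]]
    simp [ha, sq]
  have h2 : ∀ a ∈ indexPairs p, ∑ b ∈ indexPairs p, w a.1 a.2 * w b.1 b.2 *
      ((1 : Matrix (Fin p) (Fin p) ℝ) a.1 a.2 * (1 : Matrix (Fin p) (Fin p) ℝ) b.1 b.2 *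
        prodCov (1 : Matrix (Fin p) (Fin p) ℝ) a b) = 0 := by
    intro a ha
    have : (1 : Matrix (Fin p) (Fin p) ℝ) a.1 a.2 = 0 :=
      Matrix.one_apply_ne (mem_indexPairs.1 ha).ne
    simp [this]
  rw [Finset.sum_congr rfl h1, Finset.sum_congr rfl h2]
  simp
  ring

lemma integral_ustat_one (w : Fin p → Fin p → ℝ) {n : ℕ} (hn : 2 ≤ n) :
    ∫ X, ustat w n X ∂(law n (1 : Matrix (Fin p) (Fin p) ℝ)) = 0 := by
  rw [integral_ustat Matrix.PosSemidef.one w hn,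
    sum_Ioi_eq_sum_indexPairs (fun i j => w i j * (1 : Matrix (Fin p) (Fin p) ℝ) i j ^ 2),
    Finset.sum_eq_zero, mul_zero]
  intro a ha
  rw [Matrix.one_apply_ne (mem_indexPairs.1 ha).ne]
  simp

lemma term₁_eq (hS : S.PosSemidef) (α L φ : ℝ) :
    term₁ α L φ S = 2 * ∑ a ∈ indexPairs p, ∑ b ∈ indexPairs p,
      weight α L φ a.1 a.2 * weight α L φ b.1 b.2 * prodCov S a b ^ 2 := by
  have hM : ∀ a b, Integrable (fun x => centredProd S a x * centredProd S b x)
      (multivariateGaussian 0 S) :=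
    fun a b => ((hasMoments_centredProd S a).mul (hasMoments_centredProd S b)).integrable
  have hexp : ∀ x : EuclideanSpace ℝ (Fin p) × EuclideanSpace ℝ (Fin p),
      (∑ i : Fin p, ∑ j ∈ Finset.Ioi i, weight α L φ i j *
        ((x.1 i * x.1 j - S i j) * (x.2 i * x.2 j - S i j))) ^ 2
      = ∑ a ∈ indexPairs p, ∑ b ∈ indexPairs p, weight α L φ a.1 a.2 * weight α L φ b.1 b.2 *
          ((centredProd S a x.1 * centredProd S b x.1) *
            (centredProd S a x.2 * centredProd S b x.2)) := by
    intro x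
    rw [sum_Ioi_eq_sum_indexPairs (fun i j => weight α L φ i j *
        ((x.1 i * x.1 j - S i j) * (x.2 i * x.2 j - S i j))), sq, Finset.sum_mul_sum]
    refine Finset.sum_congr rfl fun a _ => Finset.sum_congr rfl fun b _ => ?_
    unfold centredProd
    ring
  have hI : ∀ a b : Fin p × Fin p,
      Integrable (fun x : EuclideanSpace ℝ (Fin p) × EuclideanSpace ℝ (Fin p) =>
        weight α L φ a.1 a.2 * weight α L φ b.1 b.2 *
          ((centredProd S a x.1 * centredProd S b x.1) *
            (centredProd S a x.2 * centredProd S b x.2)))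
        ((multivariateGaussian 0 S).prod (multivariateGaussian 0 S)) :=
    fun a b => ((hM a b).mul_prod (hM a b)).const_mul _
  unfold term₁
  simp only [hexp]
  rw [integral_finsetSum _ fun a _ => integrable_finsetSum _ fun b _ => hI a b]
  congr 1
  refine Finset.sum_congr rfl fun a _ => ?_
  rw [integral_finsetSum _ fun b _ => hI a b]
  refine Finset.sum_congr rfl fun b _ => ?_
  rw [integral_const_mul, integral_prod_mul (fun x => centredProd S a x * centredProd S b x)
    (fun x => centredProd S a x * centredProd S b x), integral_centredProd_mul hS, sq]

lemma term₂_eq (hS : S.PosSemidef) (α L φ : ℝ) :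
    term₂ α L φ S = 4 * ∑ a ∈ indexPairs p, ∑ b ∈ indexPairs p,
      weight α L φ a.1 a.2 * weight α L φ b.1 b.2 *
        (S a.1 a.2 * S b.1 b.2 * prodCov S a b) := by
  have hM : ∀ a b, Integrable (fun x => weight α L φ a.1 a.2 * weight α L φ b.1 b.2 *
      (S a.1 a.2 * S b.1 b.2) * (centredProd S a x * centredProd S b x))
      (multivariateGaussian 0 S) :=
    fun a b => (((hasMoments_centredProd S a).mul
      (hasMoments_centredProd S b)).const_mul _).integrable
  have hexp : ∀ x : EuclideanSpace ℝ (Fin p),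
      (∑ i : Fin p, ∑ j ∈ Finset.Ioi i, weight α L φ i j * ((x i * x j - S i j) * S i j)) ^ 2
      = ∑ a ∈ indexPairs p, ∑ b ∈ indexPairs p, weight α L φ a.1 a.2 * weight α L φ b.1 b.2 *
          (S a.1 a.2 * S b.1 b.2) * (centredProd S a x * centredProd S b x) := by
    intro x
    rw [sum_Ioi_eq_sum_indexPairs (fun i j => weight α L φ i j * ((x i * x j - S i j) * S i j)),
      sq, Finset.sum_mul_sum]
    refine Finset.sum_congr rfl fun a _ => Finset.sum_congr rfl fun b _ => ?_
    unfold centredProd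
    ring
  unfold term₂
  simp only [hexp]
  rw [integral_finsetSum _ fun a _ => integrable_finsetSum _ fun b _ => hM a b]
  congr 1
  refine Finset.sum_congr rfl fun a _ => ?_
  rw [integral_finsetSum _ fun b _ => hM a b]
  refine Finset.sum_congr rfl fun b _ => ?_
  rw [integral_const_mul, integral_centredProd_mul hS]
  ring

end Moments

end CovTest

/-! ### Multilinear polynomials in independent Gaussian variables -/

namespace CovTest

lemma sq_integral_mul_le {Ω : Type*} {mΩ : MeasurableSpace Ω} {P : Measure Ω} {f g : Ω → ℝ}
    (hf : HasMoments f P) (hg : HasMoments g P) :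
    (∫ ω, f ω * g ω ∂P) ^ 2 ≤ (∫ ω, f ω * f ω ∂P) * ∫ ω, g ω * g ω ∂P := by
  have h : ∀ x : ℝ, 0 ≤ (∫ ω, f ω * f ω ∂P) * (x * x) + (2 * ∫ ω, f ω * g ω ∂P) * x
      + ∫ ω, g ω * g ω ∂P := by
    intro x
    have h1 : 0 ≤ ∫ ω, (x * f ω + g ω) ^ 2 ∂P := integral_nonneg fun ω => sq_nonneg _
    have h2 : ∀ ω, (x * f ω + g ω) ^ 2
        = (x * x) * (f ω * f ω) + (2 * x) * (f ω * g ω) + g ω * g ω := fun ω => by ring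
    simp only [h2] at h1
    rw [integral_add (((hf.mul hf).const_mul _).add ((hf.mul hg).const_mul _)).integrable
      (hg.mul hg).integrable, integral_add ((hf.mul hf).const_mul _).integrable
      ((hf.mul hg).const_mul _).integrable, integral_const_mul, integral_const_mul] at h1
    linarith
  have := discrim_le_zero h
  unfold discrim at this
  nlinarith

section Multilinear

variable {Ω ι τ : Type*} {mΩ : MeasurableSpace Ω} {P : Measure Ω}

/-- The polynomial `∑ t ∈ s, c t * ∏ a ∈ F t, Z a`, of degree at most one in each variable. -/
def multilinear (Z : ι → Ω → ℝ) (c : τ → ℝ) (F : τ → Finset ι) (s : Finset τ) (ω : Ω) : ℝ :=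
  ∑ t ∈ s, c t * ∏ a ∈ F t, Z a ω

/-- A family of independent standard Gaussian random variables. -/
structure IsStdGaussianFamily (Z : ι → Ω → ℝ) (P : Measure Ω) : Prop where
  measurable : ∀ a, Measurable (Z a)
  indep : iIndepFun Z P
  map_eq : ∀ a, P.map (Z a) = gaussianReal 0 1

/-- The polynomial `multilinear` as a function of the variables in `U`, for `F t ⊆ U`. -/
def multilinearOn [DecidableEq ι] (U : Finset ι) (c : τ → ℝ) (F : τ → Finset ι) (s : Finset τ)
    (y : U → ℝ) : ℝ :=
  ∑ t ∈ s, c t * ∏ a ∈ F t, if h : a ∈ U then y ⟨a, h⟩ else 0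

lemma measurable_multilinearOn [DecidableEq ι] (U : Finset ι) (c : τ → ℝ) (F : τ → Finset ι)
    (s : Finset τ) :
    Measurable (multilinearOn U c F s) := by
  refine Finset.measurable_fun_sum _ fun t _ => Measurable.const_mul
    (Finset.measurable_fun_prod _ fun a _ => ?_) _
  by_cases h : a ∈ U
  · simp only [h, dif_pos]; fun_prop
  · simp only [h]; exact measurable_const

lemma multilinear_eq_multilinearOn [DecidableEq ι] (Z : ι → Ω → ℝ) {U : Finset ι} (c : τ → ℝ)
    {F : τ → Finset ι} {s : Finset τ} (hF : ∀ t ∈ s, F t ⊆ U) (ω : Ω) :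
    multilinear Z c F s ω = multilinearOn U c F s (fun a => Z a ω) := by
  refine Finset.sum_congr rfl fun t ht => ?_
  congr 1
  refine Finset.prod_congr rfl fun a ha => ?_
  rw [dif_pos (hF t ht ha)]

lemma IsStdGaussianFamily.hasMoments {Z : ι → Ω → ℝ} (hZ : IsStdGaussianFamily Z P) (a : ι) :
    HasMoments (Z a) P := hasMoments_of_map_gaussianReal (hZ.measurable a) (hZ.map_eq a)

lemma IsStdGaussianFamily.integral_pow {Z : ι → Ω → ℝ} (hZ : IsStdGaussianFamily Z P) (a : ι)
    (k : ℕ) : ∫ ω, Z a ω ^ k ∂P = ∫ x, x ^ k ∂(gaussianReal 0 1) := by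
  rw [← hZ.map_eq a, integral_map (hZ.measurable a).aemeasurable (by fun_prop)]

lemma hasMoments_multilinear [IsProbabilityMeasure P] {Z : ι → Ω → ℝ}
    (hZ : IsStdGaussianFamily Z P) (c : τ → ℝ) (F : τ → Finset ι) (s : Finset τ) :
    HasMoments (multilinear Z c F s) P :=
  HasMoments.sum _ fun _ _ => (HasMoments.prod _ fun a _ => hZ.hasMoments a).const_mul _

lemma measurable_multilinear {Z : ι → Ω → ℝ}
    (hZ : IsStdGaussianFamily Z P) (c : τ → ℝ) (F : τ → Finset ι) (s : Finset τ) :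
    Measurable (multilinear Z c F s) :=
  Finset.measurable_fun_sum _ fun _ _ => Measurable.const_mul
    (Finset.measurable_fun_prod _ fun a _ => hZ.measurable a) _

/-- Gaussian hypercontractivity in the form of Bonami's lemma: the fourth moment of a multilinear
polynomial of degree `d` in independent standard Gaussian variables is at most `9 ^ d` times the
square of its second moment. The induction removes one variable `z` at a time, writing the
polynomial as `g + z h`, where `h` has degree `d - 1` and `g`, `h` do not involve `z`. -/
theorem integral_multilinear_pow_four_le [DecidableEq ι] [IsProbabilityMeasure P] {Z : ι → Ω → ℝ}
    (hZ : IsStdGaussianFamily Z P) (c : τ → ℝ) (U : Finset ι) :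
    ∀ (d : ℕ) (F : τ → Finset ι) (s : Finset τ), (∀ t ∈ s, F t ⊆ U) → (∀ t ∈ s, (F t).card ≤ d) →
      ∫ ω, multilinear Z c F s ω ^ 4 ∂P ≤ 9 ^ d * (∫ ω, multilinear Z c F s ω ^ 2 ∂P) ^ 2 := by
  have hconst : ∀ (d : ℕ) (F : τ → Finset ι) (s : Finset τ), (∀ t ∈ s, F t = ∅) →
      ∫ ω, multilinear Z c F s ω ^ 4 ∂P
        ≤ 9 ^ d * (∫ ω, multilinear Z c F s ω ^ 2 ∂P) ^ 2 := by
    intro d F s h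
    have : ∀ ω, multilinear Z c F s ω = ∑ t ∈ s, c t := fun ω =>
      Finset.sum_congr rfl fun t ht => by simp [h t ht]
    simp only [this, integral_const, probReal_univ, one_smul]
    have h9 : (1 : ℝ) ≤ 9 ^ d := one_le_pow₀ (by norm_num)
    have h4 : (0 : ℝ) ≤ (∑ t ∈ s, c t) ^ 4 := by positivity
    nlinarith
  induction U using Finset.induction_on with
  | empty =>
    intro d F s hF _
    exact hconst d F s fun t ht => Finset.subset_empty.1 (hF t ht)
  | insert a U ha ih =>
    intro d F s hF hd
    obtain _ | d := d
    · exact hconst 0 F s fun t ht => Finset.card_eq_zero.1 (Nat.le_zero.1 (hd t ht))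
    set s₁ := s.filter fun t => a ∉ F t with hs₁
    set s₂ := s.filter fun t => a ∈ F t with hs₂
    set F' : τ → Finset ι := fun t => (F t).erase a with hF'
    set g := multilinear Z c F s₁ with hg
    set h := multilinear Z c F' s₂ with hh
    have hFU : ∀ t ∈ s₁, F t ⊆ U := fun t ht => by
      rw [hs₁, Finset.mem_filter] at ht
      exact (Finset.subset_insert_iff_of_notMem ht.2).1 (hF t ht.1)
    have hFU' : ∀ t ∈ s₂, F' t ⊆ U := fun t ht => by
      rw [hs₂, Finset.mem_filter] at ht
      exact Finset.subset_insert_iff.1 (hF t ht.1)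
    have hG4 := ih (d + 1) F s₁ hFU fun t ht => hd t (Finset.mem_filter.1 ht).1
    have hH4 := ih d F' s₂ hFU' fun t ht => by
      rw [hs₂, Finset.mem_filter] at ht
      rw [hF', Finset.card_erase_of_mem ht.2]
      exact Nat.sub_le_of_le_add (hd t ht.1)
    rw [← hg] at hG4
    rw [← hh] at hH4
    have hsplit : ∀ ω, multilinear Z c F s ω = g ω + Z a ω * h ω := by
      intro ω
      rw [hg, hh, multilinear, multilinear, multilinear, Finset.mul_sum,
        ← Finset.sum_filter_add_sum_filter_not s (fun t => a ∉ F t)]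
      congr 1
      simp only [not_not]
      refine Finset.sum_congr rfl fun t ht => ?_
      rw [← Finset.mul_prod_erase (F t) _ (Finset.mem_filter.1 ht).2]
      ring
    have hgm : HasMoments g P := hasMoments_multilinear hZ _ _ _
    have hhm : HasMoments h P := hasMoments_multilinear hZ _ _ _
    have hzm : HasMoments (Z a) P := hZ.hasMoments a
    have hind : IndepFun (fun ω (i : U) => Z i ω) (Z a) P := by
      have h1 := hZ.indep.indepFun_finset U {a} (by simpa using ha) hZ.measurable
      have h2 : Measurable fun y : ({a} : Finset ι) → ℝ => y ⟨a, Finset.mem_singleton_self a⟩ :=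
        measurable_pi_apply _
      exact h1.comp measurable_id h2
    -- moments of `z` factor out of every monomial in `g`, `h` and `z`
    have hfac : ∀ i j k : ℕ, ∫ ω, g ω ^ i * h ω ^ j * Z a ω ^ k ∂P
        = (∫ ω, g ω ^ i * h ω ^ j ∂P) * ∫ x, x ^ k ∂(gaussianReal 0 1) := by
      intro i j k
      have hφ : Measurable fun y : U → ℝ =>
          multilinearOn U c F s₁ y ^ i * multilinearOn U c F' s₂ y ^ j :=
        ((measurable_multilinearOn _ _ _ _).pow_const i).mul
          ((measurable_multilinearOn _ _ _ _).pow_const j)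
      have h1 := hind.integral_fun_comp_mul_comp
        (f := fun y => multilinearOn U c F s₁ y ^ i * multilinearOn U c F' s₂ y ^ j)
        (g := fun x => x ^ k)
        (measurable_pi_lambda (fun ω (i : U) => Z i ω) fun i => hZ.measurable i).aemeasurable
        (hZ.measurable a).aemeasurable hφ.aestronglyMeasurable (by fun_prop)
      simp only [← multilinear_eq_multilinearOn Z c hFU,
        ← multilinear_eq_multilinearOn Z c hFU'] at h1
      rw [← hZ.integral_pow a k]
      exact h1
    obtain ⟨m1, m2, m3, m4⟩ := gaussianReal_moments 1
    simp only [NNReal.coe_one] at m2 m4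
    have hmon : ∀ i j k : ℕ, HasMoments (fun ω => g ω ^ i * h ω ^ j * Z a ω ^ k) P :=
      fun i j k => ((hgm.pow i).mul (hhm.pow j)).mul (hzm.pow k)
    have e2 : ∀ ω, multilinear Z c F s ω ^ 2 = g ω ^ 2 * h ω ^ 0 * Z a ω ^ 0
        + 2 * (g ω ^ 1 * h ω ^ 1 * Z a ω ^ 1) + g ω ^ 0 * h ω ^ 2 * Z a ω ^ 2 := fun ω => by
      rw [hsplit]; ring
    have e4 : ∀ ω, multilinear Z c F s ω ^ 4 = g ω ^ 4 * h ω ^ 0 * Z a ω ^ 0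
        + 4 * (g ω ^ 3 * h ω ^ 1 * Z a ω ^ 1) + 6 * (g ω ^ 2 * h ω ^ 2 * Z a ω ^ 2)
        + 4 * (g ω ^ 1 * h ω ^ 3 * Z a ω ^ 3) + g ω ^ 0 * h ω ^ 4 * Z a ω ^ 4 := fun ω => by
      rw [hsplit]; ring
    have i2 : ∫ ω, multilinear Z c F s ω ^ 2 ∂P = (∫ ω, g ω ^ 2 ∂P) + ∫ ω, h ω ^ 2 ∂P := by
      simp only [e2]
      rw [integral_add ((hmon 2 0 0).add ((hmon 1 1 1).const_mul _)).integrable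
          (hmon 0 2 2).integrable,
        integral_add (hmon 2 0 0).integrable ((hmon 1 1 1).const_mul _).integrable,
        integral_const_mul, hfac, hfac, hfac]
      simp [m1, m2]
    have i4 : ∫ ω, multilinear Z c F s ω ^ 4 ∂P = (∫ ω, g ω ^ 4 ∂P)
        + 6 * (∫ ω, g ω ^ 2 * h ω ^ 2 ∂P) + 3 * ∫ ω, h ω ^ 4 ∂P := by
      simp only [e4]
      have j1 := hmon 4 0 0
      have j2 := (hmon 3 1 1).const_mul 4
      have j3 := (hmon 2 2 2).const_mul 6
      have j4 := (hmon 1 3 3).const_mul 4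
      rw [integral_add (((j1.add j2).add j3).add j4).integrable (hmon 0 4 4).integrable,
        integral_add ((j1.add j2).add j3).integrable j4.integrable,
        integral_add (j1.add j2).integrable j3.integrable, integral_add j1.integrable j2.integrable,
        integral_const_mul, integral_const_mul, integral_const_mul, hfac, hfac, hfac, hfac, hfac]
      simp [m1, m2, m3, m4]
      ring
    have hCS := sq_integral_mul_le (hgm.pow 2) (hhm.pow 2)
    simp only [← pow_add] at hCS
    norm_num at hCS
    have hG2 : 0 ≤ ∫ ω, g ω ^ 2 ∂P := integral_nonneg fun ω => sq_nonneg _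
    have hH2 : 0 ≤ ∫ ω, h ω ^ 2 ∂P := integral_nonneg fun ω => sq_nonneg _
    have hH4' : 0 ≤ ∫ ω, h ω ^ 4 ∂P := integral_nonneg fun ω => by positivity
    have h9 : (0 : ℝ) < 9 ^ d := by positivity
    have hM : ∫ ω, g ω ^ 2 * h ω ^ 2 ∂P
        ≤ 3 * 9 ^ d * ((∫ ω, g ω ^ 2 ∂P) * ∫ ω, h ω ^ 2 ∂P) := by
      refine abs_le_of_sq_le_sq' ?_ (by positivity) |>.2
      calc _ ≤ _ := hCS
        _ ≤ (9 ^ (d + 1) * (∫ ω, g ω ^ 2 ∂P) ^ 2) * (9 ^ d * (∫ ω, h ω ^ 2 ∂P) ^ 2) :=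
            mul_le_mul hG4 hH4 hH4' (by positivity)
        _ = _ := by ring
    rw [i2, i4]
    rw [pow_succ] at hG4 ⊢
    nlinarith [mul_nonneg h9.le (sq_nonneg (∫ ω, h ω ^ 2 ∂P))]

end Multilinear

end CovTest

namespace CovTest

section BlockIndependence

variable {Ω ι τ : Type*} {mΩ : MeasurableSpace Ω} {P : Measure Ω}

/-- The characteristic function of a sum of polynomials in disjoint sets of the variables is the
product of their characteristic functions. -/
lemma charFun_sum_multilinear [DecidableEq ι] [IsProbabilityMeasure P] {Z : ι → Ω → ℝ}
    (hZ : IsStdGaussianFamily Z P) (c : τ → ℝ) (F : τ → Finset ι) (s : ℕ → Finset τ)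
    (U : ℕ → Finset ι) (hU : ∀ b b', b ≠ b' → Disjoint (U b) (U b'))
    (hF : ∀ b, ∀ t ∈ s b, F t ⊆ U b) (K : ℕ) (t : ℝ) :
    charFun (P.map fun ω => ∑ b ∈ Finset.range K, multilinear Z c F (s b) ω) t
      = ∏ b ∈ Finset.range K, charFun (P.map (multilinear Z c F (s b))) t := by
  induction K with
  | zero => simp
  | succ K ih =>
    rw [Finset.prod_range_succ, ← ih]
    simp only [Finset.sum_range_succ]
    have hm := fun b => measurable_multilinear hZ c F (s b)
    set V := (Finset.range K).biUnion U with hV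
    have hFV : ∀ b ∈ Finset.range K, ∀ t ∈ s b, F t ⊆ V := fun b hb t ht =>
      (hF b t ht).trans (Finset.subset_biUnion_of_mem U hb)
    have hdisj : Disjoint V (U K) := by
      rw [hV, Finset.disjoint_biUnion_left]
      intro b hb
      exact hU b K (Finset.mem_range.1 hb).ne
    have h1 := hZ.indep.indepFun_finset V (U K) hdisj hZ.measurable
    have h2 := h1.comp (Finset.measurable_fun_sum (Finset.range K) fun b _ =>
      measurable_multilinearOn V c F (s b)) (measurable_multilinearOn (U K) c F (s K))
    have e1 : (fun y => ∑ b ∈ Finset.range K, multilinearOn V c F (s b) y) ∘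
        (fun ω (i : V) => Z i ω) = fun ω => ∑ b ∈ Finset.range K, multilinear Z c F (s b) ω := by
      ext ω
      exact Finset.sum_congr rfl fun b hb =>
        (multilinear_eq_multilinearOn Z c (hFV b hb) ω).symm
    have e2 : multilinearOn (U K) c F (s K) ∘ (fun ω (i : U K) => Z i ω)
        = multilinear Z c F (s K) := by
      ext ω
      exact (multilinear_eq_multilinearOn Z c (hF K) ω).symm
    rw [e1, e2] at h2
    have h3 := h2.charFun_map_fun_add_eq_mul (Finset.measurable_fun_sum _ fun b _ =>
      hm b).aemeasurable (hm K).aemeasurable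
    rw [h3, Pi.mul_apply]

end BlockIndependence

/-! ### A quantitative central limit theorem -/

lemma norm_cexp_mul_I_sub_taylor_le (x : ℝ) :
    ‖Complex.exp (x * Complex.I) - (1 + x * Complex.I - x ^ 2 / 2)‖ ≤ 4 * |x| ^ 3 := by
  have hn : ‖(x : ℂ) * Complex.I‖ = |x| := by simp
  by_cases hx : |x| ≤ 1
  · have h := Complex.exp_bound (x := x * Complex.I) (by rw [hn]; exact hx) (n := 3) (by norm_num)
    rw [hn] at h
    have e : ∑ m ∈ Finset.range 3, ((x : ℂ) * Complex.I) ^ m / (m.factorial : ℂ)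
        = 1 + x * Complex.I - x ^ 2 / 2 := by
      simp [Finset.sum_range_succ, mul_pow, Nat.factorial]
      ring
    rw [e] at h
    refine h.trans ?_
    have : 0 ≤ |x| ^ 3 := by positivity
    norm_num [Nat.factorial]
    nlinarith
  · push Not at hx
    have h1 : ‖Complex.exp (x * Complex.I)‖ = 1 := Complex.norm_exp_ofReal_mul_I x
    have h2 : ‖(1 : ℂ) + x * Complex.I - x ^ 2 / 2‖ ≤ 1 + |x| + |x| ^ 2 / 2 := by
      refine (norm_sub_le _ _).trans (add_le_add ((norm_add_le _ _).trans ?_) ?_)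
      · simp
      · simp
    refine (norm_sub_le _ _).trans ?_
    rw [h1]
    have : |x| ^ 2 ≤ |x| ^ 3 := pow_le_pow_right₀ hx.le (by norm_num)
    have : |x| ≤ |x| ^ 3 := by simpa using pow_le_pow_right₀ hx.le (show 1 ≤ 3 by norm_num)
    nlinarith

lemma norm_prod_sub_prod_le (K : ℕ) (a b : ℕ → ℂ) (ha : ∀ i, ‖a i‖ ≤ 1) (hb : ∀ i, ‖b i‖ ≤ 1) :
    ‖∏ i ∈ Finset.range K, a i - ∏ i ∈ Finset.range K, b i‖
      ≤ ∑ i ∈ Finset.range K, ‖a i - b i‖ := by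
  induction K with
  | zero => simp
  | succ K ih =>
    rw [Finset.prod_range_succ, Finset.prod_range_succ, Finset.sum_range_succ]
    have e : (∏ i ∈ Finset.range K, a i) * a K - (∏ i ∈ Finset.range K, b i) * b K
        = (∏ i ∈ Finset.range K, a i - ∏ i ∈ Finset.range K, b i) * a K
          + (∏ i ∈ Finset.range K, b i) * (a K - b K) := by ring
    rw [e]
    refine (norm_add_le _ _).trans (add_le_add ?_ ?_)
    · rw [norm_mul]
      exact (mul_le_of_le_one_right (norm_nonneg _) (ha K)).trans ih
    · rw [norm_mul]
      refine mul_le_of_le_one_left (norm_nonneg _) ?_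
      rw [norm_prod]
      exact Finset.prod_le_one (fun i _ => norm_nonneg _) fun i _ => hb i

section CLT

variable {Ω : Type*} {mΩ : MeasurableSpace Ω} {P : Measure Ω}

lemma charFun_map_eq_integral {f : Ω → ℝ} (hf : AEMeasurable f P) (t : ℝ) :
    charFun (P.map f) t = ∫ ω, Complex.exp ((t * f ω : ℝ) * Complex.I) ∂P := by
  rw [charFun_apply_real, integral_map hf (by fun_prop)]
  simp

variable [IsProbabilityMeasure P]

lemma integrable_cexp_mul_I {f : Ω → ℝ} (hf : AEMeasurable f P) (t : ℝ) :
    Integrable (fun ω => Complex.exp ((t * f ω : ℝ) * Complex.I)) P :=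
  Integrable.of_bound (by fun_prop) 1 (ae_of_all _ fun ω => (Complex.norm_exp_ofReal_mul_I _).le)

lemma norm_charFun_map_add_sub_le {f g : Ω → ℝ} (hf : HasMoments f P) (hg : HasMoments g P)
    (t : ℝ) : ‖charFun (P.map fun ω => f ω + g ω) t - charFun (P.map f) t‖
      ≤ |t| * √(∫ ω, g ω ^ 2 ∂P) := by
  have hfm := hf.memLp_two.aemeasurable
  have hgm := hg.memLp_two.aemeasurable
  have hfgm : AEMeasurable (fun ω => f ω + g ω) P := hfm.add hgm
  rw [charFun_map_eq_integral hfgm, charFun_map_eq_integral hfm,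
    ← integral_sub (integrable_cexp_mul_I hfgm t) (integrable_cexp_mul_I hfm t)]
  have habs : HasMoments (fun ω => |g ω|) P := fun q => (hg q).abs
  have hpt : ∀ ω, ‖Complex.exp ((t * (f ω + g ω) : ℝ) * Complex.I)
      - Complex.exp ((t * f ω : ℝ) * Complex.I)‖ ≤ |t| * |g ω| := by
    intro ω
    have e : Complex.exp ((t * (f ω + g ω) : ℝ) * Complex.I)
        - Complex.exp ((t * f ω : ℝ) * Complex.I)
        = Complex.exp ((t * f ω : ℝ) * Complex.I) *
          (Complex.exp (Complex.I * (t * g ω : ℝ)) - 1) := by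
      rw [mul_sub, ← Complex.exp_add, mul_one]
      congr 2
      push_cast; ring
    rw [e, norm_mul, Complex.norm_exp_ofReal_mul_I, one_mul, ← abs_mul]
    exact Real.norm_exp_I_mul_ofReal_sub_one_le
  refine (norm_integral_le_of_norm_le (habs.const_mul |t|).integrable (ae_of_all _ hpt)).trans ?_
  rw [integral_const_mul]
  refine mul_le_mul_of_nonneg_left ?_ (abs_nonneg t)
  refine Real.le_sqrt_of_sq_le ?_
  have h := sq_integral_mul_le habs (HasMoments.const (P := P) 1)
  simpa [← sq] using h

lemma norm_charFun_sub_le {f : Ω → ℝ} (hf : HasMoments f P) (h0 : ∫ ω, f ω ∂P = 0) {A s : ℝ}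
    (hA : 0 ≤ A) (hs : 0 < s) (h4 : ∫ ω, f ω ^ 4 ∂P ≤ A * (∫ ω, f ω ^ 2 ∂P) ^ 2)
    (h2 : ∫ ω, f ω ^ 2 ∂P ≤ s ^ 2) (t : ℝ) :
    ‖charFun (P.map f) t - Complex.exp (-(t ^ 2 * (∫ ω, f ω ^ 2 ∂P) / 2 : ℝ))‖
      ≤ (∫ ω, f ω ^ 2 ∂P) * (2 * s * (t ^ 2 + A * t ^ 4) + t ^ 4 * s ^ 2) := by
  set v := ∫ ω, f ω ^ 2 ∂P with hv
  have hv0 : 0 ≤ v := integral_nonneg fun ω => sq_nonneg _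
  have hfm := hf.memLp_two.aemeasurable
  have hlin : Integrable (fun ω => ((t * f ω : ℝ) : ℂ)) P := (hf.const_mul t).integrable.ofReal
  have hquad : Integrable (fun ω => ((t ^ 2 / 2 * f ω ^ 2 : ℝ) : ℂ)) P :=
    ((hf.pow 2).const_mul (t ^ 2 / 2)).integrable.ofReal
  have hlin' : Integrable (fun ω => (1 : ℂ) + ((t * f ω : ℝ) : ℂ) * Complex.I) P :=
    (integrable_const _).add (hlin.mul_const _)
  have htay : Integrable (fun ω => (1 : ℂ) + ((t * f ω : ℝ) : ℂ) * Complex.I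
      - ((t ^ 2 / 2 * f ω ^ 2 : ℝ) : ℂ)) P := hlin'.sub hquad
  -- replace the characteristic function by its Taylor polynomial
  have hpoly : ∫ ω, (((1 : ℂ) + ((t * f ω : ℝ) : ℂ) * Complex.I)
      - ((t ^ 2 / 2 * f ω ^ 2 : ℝ) : ℂ)) ∂P = 1 - (t ^ 2 * v / 2 : ℝ) := by
    rw [integral_sub hlin' hquad,
      integral_add (integrable_const _) (hlin.mul_const _), integral_mul_const,
      integral_complex_ofReal, integral_complex_ofReal, integral_const_mul, integral_const_mul, h0]
    simp [← hv]
    ring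
  have hT : ‖charFun (P.map f) t - (1 - (t ^ 2 * v / 2 : ℝ))‖
      ≤ v * (2 * s * (t ^ 2 + A * t ^ 4)) := by
    rw [← hpoly, charFun_map_eq_integral hfm, ← integral_sub (integrable_cexp_mul_I hfm t) htay]
    have hdom : HasMoments (fun ω => 2 * s * t ^ 2 * f ω ^ 2 + 2 * t ^ 4 / s * f ω ^ 4) P :=
      ((hf.pow 2).const_mul _).add ((hf.pow 4).const_mul _)
    refine (norm_integral_le_of_norm_le hdom.integrable (ae_of_all _ fun ω => ?_)).trans ?_
    · have h := norm_cexp_mul_I_sub_taylor_le (t * f ω)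
      have e : ((t ^ 2 / 2 * f ω ^ 2 : ℝ) : ℂ) = ((t * f ω : ℝ) : ℂ) ^ 2 / 2 := by
        push_cast; ring
      rw [e]
      refine h.trans ?_
      set x := t * f ω with hx
      have e2 : 2 * s * t ^ 2 * f ω ^ 2 + 2 * t ^ 4 / s * f ω ^ 4
          = 2 * s * |x| ^ 2 + 2 * |x| ^ 4 / s := by
        rw [sq_abs, show |x| ^ 4 = (|x| ^ 2) ^ 2 by ring, sq_abs, hx]; ring
      rw [e2]
      have e3 : 2 * s * |x| ^ 2 + 2 * |x| ^ 4 / s - 4 * |x| ^ 3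
          = 2 * |x| ^ 2 / s * (s - |x|) ^ 2 := by
        field_simp; ring
      have : 0 ≤ 2 * |x| ^ 2 / s * (s - |x|) ^ 2 := by positivity
      linarith
    · rw [integral_add ((hf.pow 2).const_mul _).integrable ((hf.pow 4).const_mul _).integrable,
        integral_const_mul, integral_const_mul, ← hv]
      have h5 : 2 * t ^ 4 / s * ∫ ω, f ω ^ 4 ∂P ≤ 2 * t ^ 4 / s * (A * (v * s ^ 2)) := by
        refine mul_le_mul_of_nonneg_left (h4.trans (mul_le_mul_of_nonneg_left ?_ hA))
          (by positivity)
        rw [sq]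
        exact mul_le_mul_of_nonneg_left h2 hv0
      have e5 : 2 * t ^ 4 / s * (A * (v * s ^ 2)) = v * (2 * s * (A * t ^ 4)) := by
        field_simp
      rw [e5] at h5
      nlinarith
  have hE : ‖((1 : ℂ) - (t ^ 2 * v / 2 : ℝ)) - Complex.exp (-(t ^ 2 * v / 2 : ℝ))‖
      ≤ v * (t ^ 4 * s ^ 2) := by
    set u := t ^ 2 * v / 2 with hu
    have hu0 : 0 ≤ u := by positivity
    have h1 : |1 - u - Real.exp (-u)| ≤ u ^ 2 := by
      have hge := Real.add_one_le_exp (-u)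
      rw [abs_of_nonpos (by linarith)]
      by_cases hu1 : u ≤ 1
      · have := Real.abs_exp_sub_one_sub_id_le (x := -u)
          (by rw [abs_neg, abs_of_nonneg hu0]; exact hu1)
        have := (abs_le.1 this).2
        nlinarith
      · have := Real.exp_le_one_iff.2 (neg_nonpos.2 hu0)
        nlinarith
    have h2' : u ^ 2 ≤ v * (t ^ 4 * s ^ 2) := by
      have : v * v ≤ v * s ^ 2 := mul_le_mul_of_nonneg_left h2 hv0
      have h4' : 0 ≤ t ^ 4 := by positivity
      rw [hu]
      nlinarith [mul_le_mul_of_nonneg_left this h4', mul_nonneg h4' (mul_nonneg hv0 hv0)]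
    have e : ((1 : ℂ) - (u : ℝ)) - Complex.exp (-(u : ℝ)) = ((1 - u - Real.exp (-u) : ℝ) : ℂ) := by
      push_cast; ring
    rw [e, Complex.norm_real]
    exact h1.trans h2'
  calc _ = ‖(charFun (P.map f) t - (1 - (t ^ 2 * v / 2 : ℝ)))
        + (((1 : ℂ) - (t ^ 2 * v / 2 : ℝ)) - Complex.exp (-(t ^ 2 * v / 2 : ℝ)))‖ := by
        congr 1; ring
    _ ≤ _ := norm_add_le _ _
    _ ≤ v * (2 * s * (t ^ 2 + A * t ^ 4)) + v * (t ^ 4 * s ^ 2) := add_le_add hT hE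
    _ = _ := by ring

/-- A quantitative form of the Lyapunov central limit theorem. Independence enters only through the
factorization of the characteristic function of the sum. -/
theorem norm_charFun_sum_sub_le {K : ℕ} {Y : ℕ → Ω → ℝ} (hY : ∀ b, HasMoments (Y b) P)
    (h0 : ∀ b, ∫ ω, Y b ω ∂P = 0) {A s : ℝ} (hA : 0 ≤ A) (hs : 0 < s)
    (h4 : ∀ b, ∫ ω, Y b ω ^ 4 ∂P ≤ A * (∫ ω, Y b ω ^ 2 ∂P) ^ 2)
    (h2 : ∀ b, ∫ ω, Y b ω ^ 2 ∂P ≤ s ^ 2) (t : ℝ)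
    (hprod : charFun (P.map fun ω => ∑ b ∈ Finset.range K, Y b ω) t
      = ∏ b ∈ Finset.range K, charFun (P.map (Y b)) t) :
    ‖charFun (P.map fun ω => ∑ b ∈ Finset.range K, Y b ω) t
        - Complex.exp (-(t ^ 2 * (∑ b ∈ Finset.range K, ∫ ω, Y b ω ^ 2 ∂P) / 2 : ℝ))‖
      ≤ (∑ b ∈ Finset.range K, ∫ ω, Y b ω ^ 2 ∂P) *
        (2 * s * (t ^ 2 + A * t ^ 4) + t ^ 4 * s ^ 2) := by
  have e : Complex.exp (-(t ^ 2 * (∑ b ∈ Finset.range K, ∫ ω, Y b ω ^ 2 ∂P) / 2 : ℝ))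
      = ∏ b ∈ Finset.range K, Complex.exp (-(t ^ 2 * (∫ ω, Y b ω ^ 2 ∂P) / 2 : ℝ)) := by
    rw [← Complex.exp_sum]
    congr 1
    push_cast
    rw [Finset.sum_neg_distrib, ← Finset.sum_div, Finset.mul_sum]
  rw [hprod, e]
  refine (norm_prod_sub_prod_le K _ _ (fun b => ?_) fun b => ?_).trans ?_
  · have := Measure.isProbabilityMeasure_map (μ := P) (hY b).memLp_two.aemeasurable
    exact norm_charFun_le_one _
  · rw [← Complex.ofReal_neg, ← Complex.ofReal_exp, Complex.norm_real, Real.norm_eq_abs,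
      Real.abs_exp, Real.exp_le_one_iff, neg_nonpos]
    have : 0 ≤ ∫ ω, Y b ω ^ 2 ∂P := integral_nonneg fun ω => sq_nonneg _
    positivity
  · rw [Finset.sum_mul]
    exact Finset.sum_le_sum fun b _ => norm_charFun_sub_le (hY b) (h0 b) hA hs (h4 b) (h2 b) t

end CLT

end CovTest

/-! ### The statistic under the null hypothesis as a sum of independent blocks -/

namespace CovTest

section Null

variable {n p : ℕ}

lemma map_row_law (k : Fin n) :
    (law n (1 : Matrix (Fin p) (Fin p) ℝ)).map (fun X j => X k j)
      = Measure.pi fun _ : Fin p => gaussianReal 0 1 := by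
  have h1 : (law n (1 : Matrix (Fin p) (Fin p) ℝ)).map (fun X => X k)
      = stdGaussian (EuclideanSpace ℝ (Fin p)) := by
    rw [← multivariateGaussian_zero_one]
    exact (measurePreserving_eval (fun _ : Fin n =>
      multivariateGaussian (0 : EuclideanSpace ℝ (Fin p)) 1) k).map_eq
  have h2 : (fun (X : Sample n p) j => X k j)
      = (WithLp.ofLp : EuclideanSpace ℝ (Fin p) → Fin p → ℝ) ∘ fun X => X k := rfl
  rw [h2, ← Measure.map_map (by fun_prop) (by fun_prop), h1, ← map_pi_eq_stdGaussian,
    Measure.map_map (by fun_prop) (by fun_prop)]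
  exact Measure.map_id

lemma map_coord_law (k : Fin n) (j : Fin p) :
    (law n (1 : Matrix (Fin p) (Fin p) ℝ)).map (fun X => X k j) = gaussianReal 0 1 := by
  have h2 : (fun X : Sample n p => X k j) = (fun y : Fin p → ℝ => y j) ∘ fun X j => X k j := rfl
  rw [h2, ← Measure.map_map (by fun_prop) (by fun_prop), map_row_law]
  exact (measurePreserving_eval (fun _ : Fin p => gaussianReal 0 1) j).map_eq

lemma isStdGaussianFamily_coord :
    IsStdGaussianFamily (fun (a : Fin n × Fin p) (X : Sample n p) => X a.1 a.2)
      (law n (1 : Matrix (Fin p) (Fin p) ℝ)) where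
  measurable a := by fun_prop
  map_eq a := map_coord_law a.1 a.2
  indep := by
    refine iIndepFun_uncurry' (X := fun k j (X : Sample n p) => X k j)
      (fun k j => by fun_prop) ?_ ?_
    · exact iIndepFun_pi (X := fun _ (x : EuclideanSpace ℝ (Fin p)) j => x j)
        (fun k => by fun_prop)
    · intro k
      have hm : ∀ j : Fin p, Measurable fun X : Sample n p => X k j := fun j => by fun_prop
      rw [iIndepFun_iff_map_fun_eq_pi_map fun j => (hm j).aemeasurable, map_row_law]
      simp only [map_coord_law]

/-- The weights `w` on the pairs satisfying `B`, and zero on the other pairs. -/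
noncomputable def maskWeight (w : Fin p → Fin p → ℝ) (B : Fin p → Fin p → Prop)
    [∀ i j, Decidable (B i j)] (i j : Fin p) : ℝ := if B i j then w i j else 0

/-- The variables in the monomial of `ustat` with observations `t.1` and coordinates `t.2`. -/
def monomialSupport (t : (Fin n × Fin n) × (Fin p × Fin p)) : Finset (Fin n × Fin p) :=
  {(t.1.1, t.2.1), (t.1.1, t.2.2), (t.1.2, t.2.1), (t.1.2, t.2.2)}

lemma card_monomialSupport_le (t : (Fin n × Fin n) × (Fin p × Fin p)) :
    (monomialSupport t).card ≤ 4 := Finset.card_le_four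

/-- The indices of the monomials of `ustat` whose pair of coordinates satisfies `B`. -/
def monomials (n : ℕ) (B : Fin p → Fin p → Prop) [∀ i j, Decidable (B i j)] :
    Finset ((Fin n × Fin n) × (Fin p × Fin p)) :=
  (Finset.univ.filter fun a : Fin n × Fin n => a.2 ≠ a.1) ×ˢ
    (indexPairs p).filter fun a => B a.1 a.2

lemma const_mul_ustat_maskWeight (κ : ℝ) (w : Fin p → Fin p → ℝ) (B : Fin p → Fin p → Prop)
    [∀ i j, Decidable (B i j)] (X : Sample n p) :
    κ * ustat (maskWeight w B) n X
      = multilinear (fun (a : Fin n × Fin p) (X : Sample n p) => X a.1 a.2)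
          (fun t => κ * (1 / ((n : ℝ) * ((n : ℝ) - 1) * (p : ℝ)) * w t.2.1 t.2.2))
          monomialSupport (monomials n B) X := by
  unfold ustat multilinear monomials maskWeight
  simp only [sum_Ioi_eq_sum_indexPairs]
  rw [Finset.sum_product, Finset.sum_filter, Fintype.sum_prod_type, ← mul_assoc, Finset.mul_sum]
  refine Finset.sum_congr rfl fun k _ => ?_
  rw [Finset.mul_sum, ← Finset.sum_filter]
  refine Finset.sum_congr (by ext l; simp) fun l hl => ?_
  have hkl : l ≠ k := (Finset.mem_filter.1 hl).2
  rw [Finset.sum_filter, Finset.mul_sum]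
  refine Finset.sum_congr rfl fun a ha => ?_
  have hij : a.1 ≠ a.2 := (mem_indexPairs.1 ha).ne
  by_cases hB : B a.1 a.2
  · have hprod : ∏ b ∈ monomialSupport ((k, l), a), X b.1 b.2
        = X k a.1 * X k a.2 * X l a.1 * X l a.2 := by
      unfold monomialSupport
      rw [Finset.prod_insert (by simp [hij, hkl.symm]), Finset.prod_insert (by simp [hkl.symm]),
        Finset.prod_insert (by simp [hij]), Finset.prod_singleton]
      ring
    rw [if_pos hB, if_pos hB, hprod]
    ring
  · rw [if_neg hB, if_neg hB]
    ring

lemma integral_sq_const_mul_ustat (w : Fin p → Fin p → ℝ) (hn : 2 ≤ n) (κ : ℝ) :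
    ∫ X, (κ * ustat w n X) ^ 2 ∂(law n (1 : Matrix (Fin p) (Fin p) ℝ))
      = κ ^ 2 * (2 / ((n : ℝ) * ((n : ℝ) - 1) * (p : ℝ) ^ 2) *
          ∑ i : Fin p, ∑ j ∈ Finset.Ioi i, w i j ^ 2) := by
  rw [← variance_ustat_one w hn, variance_of_integral_eq_zero
    (hasMoments_ustat 1 w n).memLp_two.aemeasurable (integral_ustat_one w hn), ← integral_const_mul]
  congr 1; ext X; simp only [mul_pow]

/-- Both indices lie in the `b`-th block of length `M`. -/
abbrev SameBlock (M b : ℕ) (i j : Fin p) : Prop := (i : ℕ) / M = b ∧ (j : ℕ) / M = b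

/-- The indices lie in different blocks of length `M`. -/
abbrev DiffBlock (M : ℕ) (i j : Fin p) : Prop := (i : ℕ) / M ≠ (j : ℕ) / M

lemma sum_maskWeight_blocks (w : Fin p → Fin p → ℝ) (M : ℕ) (f : ℝ → ℝ) (hf : f 0 = 0)
    (i j : Fin p) :
    ∑ b ∈ Finset.range p, f (maskWeight w (SameBlock M b) i j)
      + f (maskWeight w (DiffBlock M) i j) = f (w i j) := by
  unfold maskWeight SameBlock DiffBlock
  by_cases h : (i : ℕ) / M = (j : ℕ) / M
  · rw [Finset.sum_eq_single ((i : ℕ) / M)]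
    · simp [h, hf]
    · intro b _ hb
      rw [if_neg (fun h' => hb h'.1.symm), hf]
    · intro hb
      exact absurd (Finset.mem_range.2 ((Nat.div_le_self _ _).trans_lt i.2)) hb
  · rw [Finset.sum_eq_zero, if_pos h, zero_add]
    intro b _
    rw [if_neg (fun h' => h (h'.1.trans h'.2.symm)), hf]

lemma ustat_eq_sum_blocks (w : Fin p → Fin p → ℝ) (M : ℕ) (X : Sample n p) :
    ustat w n X = ∑ b ∈ Finset.range p, ustat (maskWeight w (SameBlock M b)) n X
      + ustat (maskWeight w (DiffBlock M)) n X := by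
  unfold ustat
  rw [← Finset.mul_sum, ← mul_add]
  congr 1
  rw [Finset.sum_comm (s := Finset.range p), ← Finset.sum_add_distrib]
  refine Finset.sum_congr rfl fun k _ => ?_
  rw [Finset.sum_comm (s := Finset.range p), ← Finset.sum_add_distrib]
  refine Finset.sum_congr rfl fun l _ => ?_
  rw [Finset.sum_comm (s := Finset.range p), ← Finset.sum_add_distrib]
  refine Finset.sum_congr rfl fun i _ => ?_
  rw [Finset.sum_comm (s := Finset.range p), ← Finset.sum_add_distrib]
  refine Finset.sum_congr rfl fun j _ => ?_
  rw [← Finset.sum_mul, ← add_mul]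
  congr 1
  exact (sum_maskWeight_blocks w M id rfl i j).symm

/-! ### Counting pairs within and across blocks -/

lemma card_filter_Ioi_le (i : Fin p) (T : ℕ) :
    ((Finset.Ioi i).filter fun j : Fin p => (j : ℕ) ≤ i + T).card ≤ T := by
  calc _ ≤ (Finset.Ioc (i : ℕ) (i + T)).card := by
        refine Finset.card_le_card_of_injOn (fun j => (j : ℕ)) (fun j hj => ?_)
          (fun a _ b _ h => Fin.ext h)
        simp only [Finset.coe_filter, Finset.mem_Ioi, Set.mem_ofPred_eq] at hj
        simp only [Finset.coe_Ioc, Set.mem_Ioc]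
        exact ⟨hj.1, hj.2⟩
    _ = T := by simp

lemma sum_Ioi_sq_le {w : Fin p → Fin p → ℝ} {T : ℕ} {w₀ : ℝ}
    (hw : ∀ i j, |w i j| ≤ w₀) (hT : ∀ i j : Fin p, (i : ℕ) + T < j → w i j = 0) (i : Fin p) :
    ∑ j ∈ Finset.Ioi i, w i j ^ 2 ≤ T * w₀ ^ 2 := by
  have hsq : ∀ i j, w i j ^ 2 ≤ w₀ ^ 2 := fun i j =>
    sq_le_sq' (abs_le.1 (hw i j)).1 (abs_le.1 (hw i j)).2
  calc _ = ∑ j ∈ (Finset.Ioi i).filter (fun j : Fin p => (j : ℕ) ≤ i + T), w i j ^ 2 := by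
        refine (Finset.sum_filter_of_ne fun j _ hj => ?_).symm
        by_contra h
        exact hj (by rw [hT i j (not_le.1 h)]; simp)
    _ ≤ ((Finset.Ioi i).filter fun j : Fin p => (j : ℕ) ≤ i + T).card • w₀ ^ 2 :=
        Finset.sum_le_card_nsmul _ _ _ fun j _ => hsq i j
    _ ≤ T * w₀ ^ 2 := by
        rw [nsmul_eq_mul]
        exact mul_le_mul_of_nonneg_right (by exact_mod_cast card_filter_Ioi_le i T) (sq_nonneg _)

lemma sum_le_card_mul {w : Fin p → Fin p → ℝ} {T : ℕ} {w₀ : ℝ}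
    (hw : ∀ i j, |w i j| ≤ w₀) (hT : ∀ i j : Fin p, (i : ℕ) + T < j → w i j = 0)
    (I : Finset (Fin p)) (hI : ∀ i ∉ I, ∀ j, i < j → w i j = 0) :
    ∑ i : Fin p, ∑ j ∈ Finset.Ioi i, w i j ^ 2 ≤ I.card * (T * w₀ ^ 2) := by
  rw [← Finset.sum_subset (Finset.subset_univ I)]
  · exact (Finset.sum_le_card_nsmul _ _ _ fun i _ => sum_Ioi_sq_le hw hT i).trans
      (by rw [nsmul_eq_mul])
  · intro i _ hi
    refine Finset.sum_eq_zero fun j hj => ?_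
    rw [hI i hi j (Finset.mem_Ioi.1 hj)]
    simp

lemma card_block_le (M b : ℕ) (hM : 0 < M) :
    (Finset.univ.filter fun i : Fin p => (i : ℕ) / M = b).card ≤ M := by
  calc _ ≤ (Finset.Ico (b * M) (b * M + M)).card := by
        refine Finset.card_le_card_of_injOn (fun j => (j : ℕ)) (fun j hj => ?_)
          (fun a _ b _ h => Fin.ext h)
        simp only [Finset.coe_filter, Finset.mem_univ, true_and, Set.mem_ofPred_eq] at hj
        simp only [Finset.coe_Ico, Set.mem_Ico]
        rw [Nat.div_eq_iff hM] at hj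
        omega
    _ = M := by simp

lemma card_near_boundary_le (M T : ℕ) (hM : 0 < M) (hT : T ≤ M) :
    (Finset.univ.filter fun i : Fin p => M ≤ (i : ℕ) % M + T).card ≤ (p / M + 1) * T := by
  calc _ ≤ (Finset.range (p / M + 1) ×ˢ Finset.Ico (M - T) M).card := by
        refine Finset.card_le_card_of_injOn (fun j => ((j : ℕ) / M, (j : ℕ) % M))
          (fun j hj => ?_) (fun a _ b _ h => ?_)
        · simp only [Finset.coe_filter, Finset.mem_univ, true_and, Set.mem_ofPred_eq] at hj
          simp only [Finset.coe_product, Set.mem_prod, Finset.coe_range, Set.mem_Iio,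
            Finset.coe_Ico, Set.mem_Ico]
          have h1 : (j : ℕ) / M ≤ p / M := Nat.div_le_div_right j.2.le
          have h2 := Nat.mod_lt (j : ℕ) hM
          omega
        · simp only [Prod.mk.injEq] at h
          refine Fin.ext ?_
          rw [← Nat.div_add_mod (a : ℕ) M, ← Nat.div_add_mod (b : ℕ) M, h.1, h.2]
    _ = (p / M + 1) * T := by
        rw [Finset.card_product, Finset.card_range, Nat.card_Ico]
        congr 1
        omega

lemma div_eq_of_mod_add_lt {M T i j : ℕ} (h : i % M + T < M) (hij : i < j) (hj : j ≤ i + T) :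
    i / M = j / M := by
  have h1 := Nat.div_add_mod i M
  symm
  rw [Nat.div_eq_iff (by omega)]
  have h2 : i / M * M = M * (i / M) := mul_comm _ _
  omega

end Null

end CovTest

/-! ### Asymptotic normality for banded weights -/

namespace CovTest

lemma abs_maskWeight_le {p : ℕ} {w : Fin p → Fin p → ℝ} {w₀ : ℝ} (hw : ∀ i j, |w i j| ≤ w₀)
    (B : Fin p → Fin p → Prop) [∀ i j, Decidable (B i j)] (i j : Fin p) :
    |maskWeight w B i j| ≤ w₀ := by
  unfold maskWeight
  split_ifs
  · exact hw i j
  · simpa using (abs_nonneg _).trans (hw i j)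

lemma maskWeight_eq_zero {p : ℕ} {w : Fin p → Fin p → ℝ} {i j : Fin p} (h : w i j = 0)
    (B : Fin p → Fin p → Prop) [∀ i j, Decidable (B i j)] : maskWeight w B i j = 0 := by
  unfold maskWeight
  split_ifs
  · exact h
  · rfl

/-- Normal approximation under the null hypothesis for banded weights. The indices are cut into
blocks of length `M`; the pairs within a block give independent summands, with total variance `V`,
and the pairs across two blocks a remainder of variance `R`. -/
theorem exists_charFun_ustat_le {n p : ℕ} (hn : 2 ≤ n) (hp : 1 ≤ p) {w : Fin p → Fin p → ℝ}
    {w₀ : ℝ} {T M : ℕ} (hM : 0 < M) (hTM : T ≤ M) (hw : ∀ i j, |w i j| ≤ w₀)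
    (hT : ∀ i j : Fin p, (i : ℕ) + T < j → w i j = 0) {s : ℝ} (hs : 0 < s)
    (hs2 : 2 * n / (((n : ℝ) - 1) * p) * (M * (T * w₀ ^ 2)) ≤ s ^ 2) :
    ∃ V R : ℝ, 0 ≤ V ∧ 0 ≤ R ∧
      V + R = 2 * n / (((n : ℝ) - 1) * p) * ∑ i : Fin p, ∑ j ∈ Finset.Ioi i, w i j ^ 2 ∧
      R ≤ 2 * n / (((n : ℝ) - 1) * p) * (((p / M + 1 : ℕ) * T : ℕ) * (T * w₀ ^ 2)) ∧
      ∀ t : ℝ, ‖charFun ((law n (1 : Matrix (Fin p) (Fin p) ℝ)).map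
          fun X => (n : ℝ) * √(p : ℝ) * ustat w n X) t - Complex.exp (-(t ^ 2 * V / 2 : ℝ))‖
        ≤ V * (2 * s * (t ^ 2 + 9 ^ 4 * t ^ 4) + t ^ 4 * s ^ 2) + |t| * √R := by
  have hn' : (2 : ℝ) ≤ n := by exact_mod_cast hn
  have hp' : (1 : ℝ) ≤ p := by exact_mod_cast hp
  have hn1 : (0 : ℝ) < (n : ℝ) - 1 := by linarith
  set P := law n (1 : Matrix (Fin p) (Fin p) ℝ) with hP
  set κ := (n : ℝ) * √(p : ℝ) with hκ
  set ν := 2 * n / (((n : ℝ) - 1) * p) with hν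
  have hν0 : 0 ≤ ν := by positivity
  have hsq : ∀ u : Fin p → Fin p → ℝ, ∫ X, (κ * ustat u n X) ^ 2 ∂P
      = ν * ∑ i : Fin p, ∑ j ∈ Finset.Ioi i, u i j ^ 2 := by
    intro u
    rw [hP, integral_sq_const_mul_ustat u hn, ← mul_assoc, hκ, mul_pow,
      Real.sq_sqrt (by linarith), hν]
    congr 1
    field_simp
  have hmom : ∀ u : Fin p → Fin p → ℝ, HasMoments (fun X => κ * ustat u n X) P :=
    fun u => (hasMoments_ustat 1 u n).const_mul κ
  have hT' : ∀ (B : Fin p → Fin p → Prop) [∀ i j, Decidable (B i j)] (i j : Fin p),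
      (i : ℕ) + T < j → maskWeight w B i j = 0 := fun B _ i j h => maskWeight_eq_zero (hT i j h) B
  set Y : ℕ → Sample n p → ℝ := fun b X => κ * ustat (maskWeight w (SameBlock M b)) n X with hY
  set R := ∫ X, (κ * ustat (maskWeight w (DiffBlock M)) n X) ^ 2 ∂P with hR
  have hZ := isStdGaussianFamily_coord (n := n) (p := p)
  have hYeq : ∀ b, Y b = multilinear (fun (a : Fin n × Fin p) (X : Sample n p) => X a.1 a.2)
      (fun t => κ * (1 / ((n : ℝ) * ((n : ℝ) - 1) * (p : ℝ)) * w t.2.1 t.2.2))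
      monomialSupport (monomials n (SameBlock M b)) :=
    fun b => funext fun X => const_mul_ustat_maskWeight κ w (SameBlock M b) X
  refine ⟨∑ b ∈ Finset.range p, ∫ X, Y b X ^ 2 ∂P, R,
    Finset.sum_nonneg fun b _ => integral_nonneg fun X => sq_nonneg _,
    integral_nonneg fun X => sq_nonneg _, ?_, ?_, fun t => ?_⟩
  · simp only [hR, hY, hsq]
    rw [← Finset.mul_sum, ← mul_add]
    congr 1
    rw [Finset.sum_comm, ← Finset.sum_add_distrib]
    refine Finset.sum_congr rfl fun i _ => ?_
    rw [Finset.sum_comm, ← Finset.sum_add_distrib]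
    refine Finset.sum_congr rfl fun j _ => ?_
    exact sum_maskWeight_blocks w M (fun x => x ^ 2) (by norm_num) i j
  · rw [hR, hsq]
    refine mul_le_mul_of_nonneg_left ?_ hν0
    refine (sum_le_card_mul (abs_maskWeight_le hw _) (hT' _)
      (Finset.univ.filter fun i : Fin p => M ≤ (i : ℕ) % M + T) ?_).trans ?_
    · intro i hi j hij
      simp only [Finset.mem_filter, Finset.mem_univ, true_and, not_le] at hi
      by_cases hj : (j : ℕ) ≤ i + T
      · exact if_neg (not_not.2 (div_eq_of_mod_add_lt hi hij hj))
      · exact hT' _ i j (not_le.1 hj)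
    · exact mul_le_mul_of_nonneg_right (by exact_mod_cast card_near_boundary_le M T hM hTM)
        (by positivity)
  · have hYm : ∀ b, HasMoments (Y b) P := fun b => hmom _
    have hdecomp : (fun X => κ * ustat w n X)
        = fun X => (∑ b ∈ Finset.range p, Y b X) + κ * ustat (maskWeight w (DiffBlock M)) n X := by
      ext X
      rw [ustat_eq_sum_blocks w M X, mul_add, Finset.mul_sum]
    have h1 := norm_charFun_map_add_sub_le (HasMoments.sum (Finset.range p) fun b _ => hYm b)
      (hmom (maskWeight w (DiffBlock M))) t
    have h2 := norm_charFun_sum_sub_le (K := p) hYm (A := 9 ^ 4) (s := s)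
      (fun b => by
        simp only [hY]
        rw [integral_const_mul, hP, integral_ustat_one _ hn, mul_zero])
      (by norm_num) hs
      (fun b => by
        rw [hYeq]
        exact integral_multilinear_pow_four_le hZ _ Finset.univ 4 _ _
          (fun _ _ => Finset.subset_univ _) fun t _ => card_monomialSupport_le t)
      (fun b => by
        simp only [hY, hsq]
        refine le_trans (mul_le_mul_of_nonneg_left ?_ hν0) hs2
        refine (sum_le_card_mul (abs_maskWeight_le hw _) (hT' _)
          (Finset.univ.filter fun i : Fin p => (i : ℕ) / M = b) ?_).trans ?_
        · intro i hi j _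
          simp only [Finset.mem_filter, Finset.mem_univ, true_and] at hi
          exact if_neg fun h => hi h.1
        · exact mul_le_mul_of_nonneg_right (by exact_mod_cast card_block_le M b hM)
            (by positivity))
      t (by
        simp only [hYeq]
        refine charFun_sum_multilinear hZ _ _ _
          (fun b => Finset.univ.filter fun a : Fin n × Fin p => (a.2 : ℕ) / M = b) ?_ ?_ p t
        · intro b b' hb
          rw [Finset.disjoint_left]
          intro a ha ha'
          simp only [Finset.mem_filter, Finset.mem_univ, true_and] at ha ha'
          exact hb (ha.symm.trans ha')
        · intro b t ht a ha
          simp only [monomials, Finset.mem_product, Finset.mem_filter] at ht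
          simp only [monomialSupport, Finset.mem_insert, Finset.mem_singleton] at ha
          simp only [Finset.mem_filter, Finset.mem_univ, true_and]
          obtain ⟨-, -, h3, h4⟩ := ht
          rcases ha with rfl | rfl | rfl | rfl
          exacts [h3, h4, h3, h4])
    rw [hdecomp]
    calc _ ≤ _ := norm_sub_le_norm_sub_add_norm_sub _ _ _
      _ ≤ _ := add_le_add h1 h2
      _ = _ := add_comm _ _

/-- Asymptotic normality under the null hypothesis for banded weights whose band width is small
compared with the dimension. -/
theorem tendsto_charFun_ustat {n p T : ℕ → ℕ} {w : ∀ m, Fin (p m) → Fin (p m) → ℝ}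
    {w₀ : ℕ → ℝ} {B : ℝ} (hn : Tendsto n atTop atTop) (hp : Tendsto p atTop atTop)
    (hT1 : ∀ᶠ m in atTop, 1 ≤ T m)
    (hTp : Tendsto (fun m => (T m : ℝ) / p m) atTop (𝓝 0))
    (hw : ∀ᶠ m in atTop, ∀ i j, |w m i j| ≤ w₀ m)
    (hT : ∀ᶠ m in atTop, ∀ i j : Fin (p m), (i : ℕ) + T m < j → w m i j = 0)
    (hB : ∀ᶠ m in atTop, T m * w₀ m ^ 2 ≤ B)
    (hV : Tendsto (fun m => 2 / (p m : ℝ) * ∑ i : Fin (p m), ∑ j ∈ Finset.Ioi i, w m i j ^ 2)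
      atTop (𝓝 1)) (t : ℝ) :
    Tendsto (fun m => charFun ((law (n m) (1 : Matrix (Fin (p m)) (Fin (p m)) ℝ)).map
      fun X => (n m : ℝ) * √(p m : ℝ) * ustat (w m) (n m) X) t) atTop
      (𝓝 (Complex.exp (-(t ^ 2 / 2 : ℝ)))) := by
  have hnR : Tendsto (fun m => (n m : ℝ)) atTop atTop := tendsto_natCast_atTop_atTop.comp hn
  have hpR : Tendsto (fun m => (p m : ℝ)) atTop atTop := tendsto_natCast_atTop_atTop.comp hp
  have hpinv : Tendsto (fun m => 1 / (p m : ℝ)) atTop (𝓝 0) := by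
    simpa [Pi.inv_def] using hpR.inv_tendsto_atTop
  set ρ : ℕ → ℝ := fun m => (n m : ℝ) / ((n m : ℝ) - 1) with hρ
  have hρ1 : Tendsto ρ atTop (𝓝 1) := by
    have h1 : Tendsto (fun m => 1 + 1 / ((n m : ℝ) - 1)) atTop (𝓝 (1 + 0)) := by
      refine tendsto_const_nhds.add ?_
      simpa [Pi.inv_def, sub_eq_add_neg] using
        (tendsto_atTop_add_const_right _ (-1 : ℝ) hnR).inv_tendsto_atTop
    rw [add_zero] at h1
    refine h1.congr' ?_
    filter_upwards [hnR.eventually_ge_atTop 2] with m hm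
    have : (n m : ℝ) - 1 ≠ 0 := by linarith
    simp only [hρ]
    field_simp
    ring
  -- blocks of length about the geometric mean of `T` and `p`
  set q : ℕ → ℝ := fun m => √((T m : ℝ) / p m) with hq
  have hq0 : Tendsto q atTop (𝓝 0) := by
    simpa [hq, Function.comp_def] using (Real.continuous_sqrt.tendsto 0).comp hTp
  set M : ℕ → ℕ := fun m => ⌈√((T m : ℝ) * p m)⌉₊ with hM
  have hfacts : ∀ᶠ m in atTop, 0 < M m ∧ T m ≤ M m ∧ (M m : ℝ) / p m ≤ q m + 1 / p m ∧
      (T m : ℝ) / M m ≤ q m := by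
    filter_upwards [hT1, hpR.eventually_ge_atTop 1, hTp.eventually_le_const one_pos]
      with m h1 h2 h3
    have h1' : (1 : ℝ) ≤ T m := by exact_mod_cast h1
    have hp0 : (0 : ℝ) < p m := by linarith
    have hTp0 : (0 : ℝ) < T m * p m := by positivity
    have hle : √((T m : ℝ) * p m) ≤ M m := Nat.le_ceil _
    have hs0 : 0 < √((T m : ℝ) * p m) := Real.sqrt_pos.2 hTp0
    have hTle : (T m : ℝ) ≤ √((T m : ℝ) * p m) := by
      refine Real.le_sqrt_of_sq_le ?_
      rw [sq]
      exact mul_le_mul_of_nonneg_left ((div_le_one hp0).1 h3) (by linarith)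
    have e1 : √((T m : ℝ) * p m) / p m = q m := by
      rw [hq]
      simp only
      rw [show (T m : ℝ) / p m = T m * p m / (p m) ^ 2 by field_simp,
        Real.sqrt_div hTp0.le, Real.sqrt_sq hp0.le]
    have e2 : (T m : ℝ) / √((T m : ℝ) * p m) = q m := by
      rw [← e1, div_eq_div_iff hs0.ne' hp0.ne', Real.mul_self_sqrt hTp0.le]
    refine ⟨?_, ?_, ?_, ?_⟩
    · exact_mod_cast hs0.trans_le hle
    · exact_mod_cast hTle.trans hle
    · rw [← e1, ← add_div]
      exact div_le_div_of_nonneg_right (Nat.ceil_lt_add_one hs0.le).le hp0.le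
    · rw [← e2]
      exact div_le_div_of_nonneg_left (by linarith) hs0 hle
  have hB0 : 0 ≤ B := by
    obtain ⟨m, hm⟩ := hB.exists
    exact (by positivity : (0 : ℝ) ≤ T m * w₀ m ^ 2).trans hm
  set s : ℕ → ℝ := fun m => √(2 * ρ m * B * (q m + 1 / p m)) + 1 / ((m : ℝ) + 1) with hs
  have hs0 : Tendsto s atTop (𝓝 0) := by
    have h1 : Tendsto (fun m => 2 * ρ m * B * (q m + 1 / p m)) atTop
        (𝓝 (2 * 1 * B * (0 + 0))) := ((hρ1.const_mul 2).mul_const B).mul (hq0.add hpinv)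
    have h2 := ((Real.continuous_sqrt.tendsto _).comp h1).add
      (tendsto_one_div_add_atTop_nhds_zero_nat (𝕜 := ℝ))
    simpa [hs] using h2
  have hmain : ∀ᶠ m in atTop, ∃ V R : ℝ, 0 ≤ V ∧ 0 ≤ R ∧
      V + R = ρ m * (2 / (p m : ℝ) * ∑ i : Fin (p m), ∑ j ∈ Finset.Ioi i, w m i j ^ 2) ∧
      R ≤ 2 * ρ m * B * (q m + T m / p m) ∧
      ‖charFun ((law (n m) (1 : Matrix (Fin (p m)) (Fin (p m)) ℝ)).map
          fun X => (n m : ℝ) * √(p m : ℝ) * ustat (w m) (n m) X) t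
          - Complex.exp (-(t ^ 2 * V / 2 : ℝ))‖
        ≤ V * (2 * s m * (t ^ 2 + 9 ^ 4 * t ^ 4) + t ^ 4 * s m ^ 2) + |t| * √R := by
    filter_upwards [hfacts, hn.eventually_ge_atTop 2, hp.eventually_ge_atTop 1, hw, hT, hB]
      with m ⟨hM0, hTM, hMp, hTMq⟩ hn2 hp1 hw hT hB
    have hn2' : (2 : ℝ) ≤ n m := by exact_mod_cast hn2
    have hp1' : (1 : ℝ) ≤ p m := by exact_mod_cast hp1
    have hn1 : (0 : ℝ) < (n m : ℝ) - 1 := by linarith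
    have hρ0 : 0 ≤ ρ m := by simp only [hρ]; positivity
    have hν : 2 * (n m : ℝ) / (((n m : ℝ) - 1) * p m) = 2 * ρ m / p m := by
      simp only [hρ]; field_simp
    have hq0 : 0 ≤ q m := Real.sqrt_nonneg _
    have hspos : 0 < s m := by simp only [hs]; positivity
    have hM0' : (0 : ℝ) < M m := by exact_mod_cast hM0
    have hs2 : 2 * (n m : ℝ) / (((n m : ℝ) - 1) * p m) * (M m * (T m * w₀ m ^ 2)) ≤ s m ^ 2 := by
      have h1 : (√(2 * ρ m * B * (q m + 1 / p m))) ^ 2 ≤ s m ^ 2 := by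
        refine pow_le_pow_left₀ (Real.sqrt_nonneg _) ?_ 2
        simp only [hs]
        have : (0 : ℝ) ≤ 1 / ((m : ℝ) + 1) := by positivity
        linarith
      rw [Real.sq_sqrt (by positivity)] at h1
      refine le_trans ?_ h1
      rw [hν]
      calc 2 * ρ m / p m * (M m * (T m * w₀ m ^ 2))
          = 2 * ρ m * (T m * w₀ m ^ 2) * (M m / p m) := by ring
        _ ≤ 2 * ρ m * B * (q m + 1 / p m) := by gcongr
    obtain ⟨V, R, hV0, hR0, hVR, hR, hch⟩ :=
      exists_charFun_ustat_le hn2 hp1 hM0 hTM hw hT hspos hs2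
    refine ⟨V, R, hV0, hR0, ?_, ?_, hch t⟩
    · rw [hVR, hν]; ring
    · refine hR.trans ?_
      rw [hν]
      have hdiv : ((p m / M m : ℕ) : ℝ) ≤ p m / M m := Nat.cast_div_le
      push_cast
      calc 2 * ρ m / p m * ((((p m / M m : ℕ) : ℝ) + 1) * T m * (T m * w₀ m ^ 2))
          ≤ 2 * ρ m / p m * (((p m : ℝ) / M m + 1) * T m * B) := by gcongr
        _ = 2 * ρ m * B * (T m / M m + T m / p m) := by field_simp
        _ ≤ 2 * ρ m * B * (q m + T m / p m) := by gcongr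
  obtain ⟨V, hmain⟩ := hmain.choice
  obtain ⟨R, hmain⟩ := hmain.choice
  have hR0 : Tendsto R atTop (𝓝 0) := by
    have h1 : Tendsto (fun m => 2 * ρ m * B * (q m + T m / p m)) atTop
        (𝓝 (2 * 1 * B * (0 + 0))) := ((hρ1.const_mul 2).mul_const B).mul (hq0.add hTp)
    simp only [add_zero, mul_zero] at h1
    exact tendsto_of_tendsto_of_tendsto_of_le_of_le' tendsto_const_nhds h1
      (hmain.mono fun m h => h.2.1) (hmain.mono fun m h => h.2.2.2.1)
  have hV1 : Tendsto V atTop (𝓝 1) := by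
    have h1 := (hρ1.mul hV).sub hR0
    simp only [mul_one, sub_zero] at h1
    refine h1.congr' ?_
    filter_upwards [hmain] with m h
    linarith [h.2.2.1]
  have hbound : Tendsto (fun m => V m * (2 * s m * (t ^ 2 + 9 ^ 4 * t ^ 4) + t ^ 4 * s m ^ 2)
      + |t| * √(R m)) atTop (𝓝 0) := by
    have h1 := (hV1.mul (((hs0.const_mul 2).mul_const (t ^ 2 + 9 ^ 4 * t ^ 4)).add
      ((hs0.pow 2).const_mul (t ^ 4)))).add
      (((Real.continuous_sqrt.tendsto 0).comp hR0).const_mul |t|)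
    simpa using h1
  have hexp : Tendsto (fun m => Complex.exp (-(t ^ 2 * V m / 2 : ℝ))) atTop
      (𝓝 (Complex.exp (-(t ^ 2 / 2 : ℝ)))) := by
    have hc : Continuous fun x : ℝ => Complex.exp (-(t ^ 2 * x / 2 : ℝ)) := by fun_prop
    simpa [Function.comp_def] using (hc.tendsto 1).comp hV1
  have hdiff := squeeze_zero_norm' (hmain.mono fun m h => h.2.2.2.2) hbound
  simpa using hdiff.add hexp

end CovTest

/-! ### Bounds for quadratic sums over pairs of banded index pairs -/

namespace CovTest

section MatrixBounds

variable {p : ℕ}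

/-- The indicator of `|i - j| ≤ T`. -/
noncomputable def band (T : ℕ) (i j : Fin p) : ℝ :=
  if (i : ℕ) ≤ j + T ∧ (j : ℕ) ≤ i + T then 1 else 0

lemma band_nonneg (T : ℕ) (i j : Fin p) : 0 ≤ band T i j := by
  unfold band; split_ifs <;> norm_num

lemma band_comm (T : ℕ) (i j : Fin p) : band T i j = band T j i := by
  unfold band; simp only [and_comm]

lemma band_mul_self (T : ℕ) (i j : Fin p) : band T i j * band T i j = band T i j := by
  unfold band; split_ifs <;> norm_num

lemma sum_band_le (T : ℕ) (i : Fin p) : ∑ j, band T i j ≤ 2 * T + 1 := by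
  unfold band
  rw [Finset.sum_boole]
  have h : (Finset.univ.filter fun j : Fin p => (i : ℕ) ≤ j + T ∧ (j : ℕ) ≤ i + T).card
      ≤ 2 * T + 1 := by
    calc _ ≤ (Finset.Icc ((i : ℕ) - T) (i + T)).card := by
          refine Finset.card_le_card_of_injOn (fun j => (j : ℕ)) (fun j hj => ?_)
            (fun a _ b _ h => Fin.ext h)
          simp only [Finset.coe_filter, Finset.mem_univ, true_and, Set.mem_ofPred_eq] at hj
          simp only [Finset.coe_Icc, Set.mem_Icc]
          omega
      _ ≤ 2 * T + 1 := by rw [Nat.card_Icc]; omega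
  exact_mod_cast h

lemma sum_band_mul_le {R : Fin p → Fin p → ℝ} (hR : ∀ i j, 0 ≤ R i j) (T : ℕ) :
    ∑ i, ∑ j, ∑ k, ∑ l, band T i j * band T k l * R i k
      ≤ (2 * T + 1) ^ 2 * ∑ i, ∑ k, R i k := by
  rw [Finset.mul_sum]
  refine Finset.sum_le_sum fun i _ => ?_
  have e : ∑ j, ∑ k, ∑ l, band T i j * band T k l * R i k
      = ∑ k, R i k * ((∑ j, band T i j) * ∑ l, band T k l) := by
    rw [Finset.sum_comm]
    refine Finset.sum_congr rfl fun k _ => ?_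
    rw [Finset.sum_mul_sum, Finset.mul_sum]
    refine Finset.sum_congr rfl fun j _ => ?_
    rw [Finset.mul_sum]
    exact Finset.sum_congr rfl fun l _ => by ring
  rw [e, Finset.mul_sum]
  refine Finset.sum_le_sum fun k _ => ?_
  have h1 := sum_band_le T i
  have h2 := sum_band_le T k
  have h3 : 0 ≤ ∑ l, band T k l := Finset.sum_nonneg fun l _ => band_nonneg T k l
  have h4 := mul_le_mul h1 h2 h3 (by positivity)
  nlinarith [mul_le_mul_of_nonneg_left h4 (hR i k)]

/-- All four ways of linking an index of the first pair to an index of the second one. -/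
lemma sum_band_mul_four_le {R : Fin p → Fin p → ℝ} (hR : ∀ i j, 0 ≤ R i j) (T : ℕ) :
    ∑ i, ∑ j, ∑ k, ∑ l, band T i j * band T k l * (R i k + R j l + R i l + R j k)
      ≤ 4 * ((2 * T + 1) ^ 2 * ∑ i, ∑ k, R i k) := by
  have h := sum_band_mul_le hR T
  have e1 : ∑ i, ∑ j, ∑ k, ∑ l, band T i j * band T k l * R i l
      = ∑ i, ∑ j, ∑ k, ∑ l, band T i j * band T k l * R i k := by
    refine Finset.sum_congr rfl fun i _ => Finset.sum_congr rfl fun j _ => ?_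
    rw [Finset.sum_comm]
    exact Finset.sum_congr rfl fun k _ => Finset.sum_congr rfl fun l _ => by rw [band_comm T l k]
  have e2 : ∑ i, ∑ j, ∑ k, ∑ l, band T i j * band T k l * R j k
      = ∑ i, ∑ j, ∑ k, ∑ l, band T i j * band T k l * R i k := by
    rw [Finset.sum_comm]
    exact Finset.sum_congr rfl fun i _ => Finset.sum_congr rfl fun j _ =>
      Finset.sum_congr rfl fun k _ => Finset.sum_congr rfl fun l _ => by rw [band_comm T j i]
  have e3 : ∑ i, ∑ j, ∑ k, ∑ l, band T i j * band T k l * R j l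
      = ∑ i, ∑ j, ∑ k, ∑ l, band T i j * band T k l * R i k := by
    rw [← e1, Finset.sum_comm]
    exact Finset.sum_congr rfl fun i _ => Finset.sum_congr rfl fun j _ =>
      Finset.sum_congr rfl fun k _ => Finset.sum_congr rfl fun l _ => by rw [band_comm T j i]
  simp only [mul_add, Finset.sum_add_distrib]
  rw [e1, e2, e3]
  linarith

/-- The off-diagonal part of a matrix. -/
noncomputable def offDiagPart (S : Matrix (Fin p) (Fin p) ℝ) (i j : Fin p) : ℝ :=
  if i = j then 0 else S i j

lemma sum_eq_sum_indexPairs_add {f : Fin p → Fin p → ℝ} (hf : ∀ i, f i i = 0) :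
    ∑ i, ∑ j, f i j = ∑ a ∈ indexPairs p, (f a.1 a.2 + f a.2 a.1) := by
  have h1 : ∀ i : Fin p, ∑ j, f i j
      = ∑ j, (if i < j then f i j else 0) + ∑ j, (if j < i then f i j else 0) := by
    intro i
    rw [← Finset.sum_add_distrib]
    refine Finset.sum_congr rfl fun j _ => ?_
    rcases lt_trichotomy i j with h | rfl | h
    · simp [h, h.not_gt]
    · simp [hf]
    · simp [h, h.not_gt]
  rw [Finset.sum_congr rfl fun i _ => h1 i, Finset.sum_add_distrib, Finset.sum_comm
    (f := fun i j => if j < i then f i j else 0), ← Finset.sum_add_distrib, indexPairs,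
    Finset.sum_filter, Fintype.sum_prod_type]
  refine Finset.sum_congr rfl fun i _ => ?_
  rw [← Finset.sum_add_distrib]
  refine Finset.sum_congr rfl fun j _ => ?_
  by_cases h : i < j <;> simp [h]

/-- Symmetric weights in `[0, w₀]` on the band `|i - j| ≤ T`. -/
structure BandedWeight (w : Fin p → Fin p → ℝ) (w₀ : ℝ) (T : ℕ) : Prop where
  nonneg : ∀ i j, 0 ≤ w i j
  le : ∀ i j, w i j ≤ w₀
  symm : ∀ i j, w i j = w j i
  eq_zero : ∀ i j : Fin p, (i : ℕ) + T < j → w i j = 0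

/-- A symmetric matrix with unit diagonal and entries in `[-1, 1]`. -/
structure IsCorrelation (S : Matrix (Fin p) (Fin p) ℝ) : Prop where
  symm : ∀ i j, S i j = S j i
  diag : ∀ i, S i i = 1
  sq_le : ∀ i j, S i j ^ 2 ≤ 1

variable {w : Fin p → Fin p → ℝ} {w₀ : ℝ} {T : ℕ} {S : Matrix (Fin p) (Fin p) ℝ}

lemma BandedWeight.le_band (hw : BandedWeight w w₀ T) (i j : Fin p) :
    w i j ≤ w₀ * band T i j := by
  unfold band
  split_ifs with h
  · simpa using hw.le i j
  · rw [not_and_or, not_le, not_le] at h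
    rcases h with h | h
    · rw [hw.symm, hw.eq_zero j i h, mul_zero]
    · rw [hw.eq_zero i j h, mul_zero]

lemma BandedWeight.mul_band (hw : BandedWeight w w₀ T) (i j : Fin p) :
    w i j * band T i j = w i j := by
  by_cases h : band T i j = 0
  · have h1 := hw.le_band i j
    rw [h, mul_zero] at h1 ⊢
    exact le_antisymm (hw.nonneg i j) h1
  · have : band T i j = 1 := by
      unfold band at h ⊢
      split_ifs at h ⊢ with h'
      · rfl
      · exact absurd rfl h
    rw [this, mul_one]

lemma sum_offDiagPart_sq (hS : IsCorrelation S) :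
    ∑ i, ∑ j, offDiagPart S i j ^ 2 = 2 * ∑ a ∈ indexPairs p, S a.1 a.2 ^ 2 := by
  rw [sum_eq_sum_indexPairs_add (f := fun i j => offDiagPart S i j ^ 2)
    (by simp [offDiagPart]), Finset.mul_sum]
  refine Finset.sum_congr rfl fun a ha => ?_
  have := (mem_indexPairs.1 ha).ne
  simp only [offDiagPart, if_neg this, if_neg this.symm, hS.symm a.2 a.1]
  ring

lemma sq_mul_sq_le_offDiagPart (hS : IsCorrelation S) {i j k l : Fin p}
    (h : ¬(i = k ∧ j = l)) :
    S i k ^ 2 * S j l ^ 2 ≤ offDiagPart S i k ^ 2 + offDiagPart S j l ^ 2 := by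
  have h1 := hS.sq_le i k
  have h2 := hS.sq_le j l
  have h3 := sq_nonneg (S i k)
  have h4 := sq_nonneg (S j l)
  unfold offDiagPart
  by_cases hik : i = k
  · have hjl : j ≠ l := fun h' => h ⟨hik, h'⟩
    rw [if_neg hjl]
    nlinarith [sq_nonneg (if i = k then (0 : ℝ) else S i k)]
  · rw [if_neg hik]
    nlinarith [sq_nonneg (if j = l then (0 : ℝ) else S j l)]

/-- The bound behind the estimate of `T₁`: the diagonal terms give the main term `∑ w²`, the
others are controlled by `∑ σ²` through the number of indices in the band. -/
theorem sum_mul_prodCov_sq_le (hw : BandedWeight w w₀ T) (hw₀ : 0 ≤ w₀) (hS : IsCorrelation S) :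
    ∑ a ∈ indexPairs p, ∑ b ∈ indexPairs p, w a.1 a.2 * w b.1 b.2 * prodCov S a b ^ 2
      ≤ ∑ a ∈ indexPairs p, w a.1 a.2 ^ 2
        + 3 * w₀ * ∑ a ∈ indexPairs p, w a.1 a.2 * S a.1 a.2 ^ 2
        + 16 * w₀ ^ 2 * (2 * T + 1) ^ 2 * ∑ a ∈ indexPairs p, S a.1 a.2 ^ 2 := by
  set R : Fin p → Fin p → ℝ := fun i j => offDiagPart S i j ^ 2 with hR
  have hR0 : ∀ i j, 0 ≤ R i j := fun i j => sq_nonneg _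
  set G : Fin p × Fin p → Fin p × Fin p → ℝ := fun a b =>
    band T a.1 a.2 * band T b.1 b.2 * (R a.1 b.1 + R a.2 b.2 + R a.1 b.2 + R a.2 b.1) with hG
  have hG0 : ∀ a b, 0 ≤ G a b := fun a b => mul_nonneg (mul_nonneg (band_nonneg _ _ _)
    (band_nonneg _ _ _)) (add_nonneg (add_nonneg (add_nonneg (hR0 _ _) (hR0 _ _)) (hR0 _ _))
      (hR0 _ _))
  have hpt : ∀ a ∈ indexPairs p, ∀ b ∈ indexPairs p,
      w a.1 a.2 * w b.1 b.2 * prodCov S a b ^ 2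
        ≤ (if a = b then w a.1 a.2 ^ 2 + 3 * w₀ * (w a.1 a.2 * S a.1 a.2 ^ 2) else 0)
          + 2 * w₀ ^ 2 * G a b := by
    intro a ha b hb
    have ha' := mem_indexPairs.1 ha
    have hb' := mem_indexPairs.1 hb
    have hGab : 0 ≤ 2 * w₀ ^ 2 * G a b := mul_nonneg (by positivity) (hG0 a b)
    by_cases hab : a = b
    · subst hab
      rw [if_pos rfl]
      have hV : prodCov S a a = 1 + S a.1 a.2 ^ 2 := by
        unfold prodCov
        rw [hS.diag, hS.diag, hS.symm a.2 a.1]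
        ring
      rw [hV]
      have h1 := hS.sq_le a.1 a.2
      have h2 := sq_nonneg (S a.1 a.2)
      have h3 : (1 + S a.1 a.2 ^ 2) ^ 2 ≤ 1 + 3 * S a.1 a.2 ^ 2 := by nlinarith
      have h4 : w a.1 a.2 * w a.1 a.2 ≤ w₀ * w a.1 a.2 :=
        mul_le_mul_of_nonneg_right (hw.le _ _) (hw.nonneg _ _)
      have h5 : 0 ≤ w a.1 a.2 * w a.1 a.2 := mul_self_nonneg _
      nlinarith [mul_le_mul_of_nonneg_left h3 h5, mul_le_mul_of_nonneg_right h4 h2]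
    · rw [if_neg hab, zero_add]
      have hww : w a.1 a.2 * w b.1 b.2 ≤ w₀ ^ 2 * (band T a.1 a.2 * band T b.1 b.2) := by
        have := mul_le_mul (hw.le_band a.1 a.2) (hw.le_band b.1 b.2) (hw.nonneg _ _)
          (mul_nonneg hw₀ (band_nonneg _ _ _))
        linarith
      have hV : prodCov S a b ^ 2
          ≤ 2 * (R a.1 b.1 + R a.2 b.2 + R a.1 b.2 + R a.2 b.1) := by
        have h1 : S a.1 b.1 ^ 2 * S a.2 b.2 ^ 2 ≤ R a.1 b.1 + R a.2 b.2 :=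
          sq_mul_sq_le_offDiagPart hS fun h => hab (Prod.ext h.1 h.2)
        have h2 : S a.1 b.2 ^ 2 * S a.2 b.1 ^ 2 ≤ R a.1 b.2 + R a.2 b.1 :=
          sq_mul_sq_le_offDiagPart hS fun h =>
            absurd ha' (by rw [h.1, h.2]; exact lt_asymm hb')
        unfold prodCov
        nlinarith [sq_nonneg (S a.1 b.1 * S a.2 b.2 - S a.1 b.2 * S a.2 b.1)]
      calc _ ≤ w₀ ^ 2 * (band T a.1 a.2 * band T b.1 b.2) *
            (2 * (R a.1 b.1 + R a.2 b.2 + R a.1 b.2 + R a.2 b.1)) :=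
            mul_le_mul hww hV (sq_nonneg _) (mul_nonneg (sq_nonneg _)
              (mul_nonneg (band_nonneg _ _ _) (band_nonneg _ _ _)))
        _ = _ := by rw [hG]; ring
  have hGsum : ∑ a ∈ indexPairs p, ∑ b ∈ indexPairs p, G a b
      ≤ 4 * ((2 * T + 1) ^ 2 * (2 * ∑ a ∈ indexPairs p, S a.1 a.2 ^ 2)) := by
    rw [← sum_offDiagPart_sq hS]
    refine le_trans ?_ (sum_band_mul_four_le hR0 T)
    calc _ ≤ ∑ a : Fin p × Fin p, ∑ b : Fin p × Fin p, G a b := by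
          refine (Finset.sum_le_sum fun a _ => Finset.sum_le_univ_sum_of_nonneg
            fun b => hG0 a b).trans (Finset.sum_le_univ_sum_of_nonneg
              fun a => Finset.sum_nonneg fun b _ => hG0 a b)
      _ = _ := by simp only [Fintype.sum_prod_type, hG]
  calc _ ≤ ∑ a ∈ indexPairs p, ∑ b ∈ indexPairs p,
        ((if a = b then w a.1 a.2 ^ 2 + 3 * w₀ * (w a.1 a.2 * S a.1 a.2 ^ 2) else 0)
          + 2 * w₀ ^ 2 * G a b) :=
        Finset.sum_le_sum fun a ha => Finset.sum_le_sum fun b hb => hpt a ha b hb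
    _ = ∑ a ∈ indexPairs p, (w a.1 a.2 ^ 2 + 3 * w₀ * (w a.1 a.2 * S a.1 a.2 ^ 2))
        + 2 * w₀ ^ 2 * ∑ a ∈ indexPairs p, ∑ b ∈ indexPairs p, G a b := by
        simp only [Finset.sum_add_distrib, ← Finset.mul_sum]
        congr 1
        rw [Finset.mul_sum, ← Finset.sum_add_distrib]
        refine Finset.sum_congr rfl fun a ha => ?_
        rw [Finset.sum_ite_eq, if_pos ha]
    _ ≤ _ := by
        have h5 := mul_le_mul_of_nonneg_left hGsum (by positivity : 0 ≤ 2 * w₀ ^ 2)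
        rw [Finset.sum_add_distrib, ← Finset.mul_sum]
        linarith

lemma offDiagPart_sq_le (hS : IsCorrelation S) (i j : Fin p) : offDiagPart S i j ^ 2 ≤ 1 := by
  unfold offDiagPart
  split_ifs
  · norm_num
  · exact hS.sq_le i j

lemma offDiagPart_comm (hS : IsCorrelation S) (i j : Fin p) :
    offDiagPart S i j = offDiagPart S j i := by
  unfold offDiagPart
  by_cases h : i = j
  · rw [if_pos h, if_pos h.symm]
  · rw [if_neg h, if_neg (Ne.symm h), hS.symm]

/-- The entrywise product of the weights with the off-diagonal part of `S`. -/
noncomputable def weightedOffDiag (w : Fin p → Fin p → ℝ) (S : Matrix (Fin p) (Fin p) ℝ)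
    (i j : Fin p) : ℝ := w i j * offDiagPart S i j

lemma weightedOffDiag_comm (hw : BandedWeight w w₀ T) (hS : IsCorrelation S) (i j : Fin p) :
    weightedOffDiag w S i j = weightedOffDiag w S j i := by
  unfold weightedOffDiag
  rw [hw.symm, offDiagPart_comm hS]

lemma weightedOffDiag_of_mem (w : Fin p → Fin p → ℝ) (S : Matrix (Fin p) (Fin p) ℝ)
    {a : Fin p × Fin p} (ha : a ∈ indexPairs p) :
    weightedOffDiag w S a.1 a.2 = w a.1 a.2 * S a.1 a.2 := by
  unfold weightedOffDiag offDiagPart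
  rw [if_neg (mem_indexPairs.1 ha).ne]

lemma weightedOffDiag_mul_band (hw : BandedWeight w w₀ T) (i j : Fin p) :
    weightedOffDiag w S i j * band T i j = weightedOffDiag w S i j := by
  unfold weightedOffDiag
  rw [mul_right_comm, hw.mul_band]

lemma sum_weightedOffDiag_sq_le (hw : BandedWeight w w₀ T) (hS : IsCorrelation S) :
    ∑ i, ∑ j, weightedOffDiag w S i j ^ 2
      ≤ 2 * w₀ * ∑ a ∈ indexPairs p, w a.1 a.2 * S a.1 a.2 ^ 2 := by
  rw [sum_eq_sum_indexPairs_add (f := fun i j => weightedOffDiag w S i j ^ 2)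
    (by simp [weightedOffDiag, offDiagPart]), Finset.mul_sum]
  refine Finset.sum_le_sum fun a ha => ?_
  rw [weightedOffDiag_comm hw hS a.2 a.1, weightedOffDiag_of_mem w S ha]
  have h1 : w a.1 a.2 * w a.1 a.2 ≤ w₀ * w a.1 a.2 :=
    mul_le_mul_of_nonneg_right (hw.le _ _) (hw.nonneg _ _)
  nlinarith [mul_le_mul_of_nonneg_right h1 (sq_nonneg (S a.1 a.2))]

/-- With `A` the weighted off-diagonal matrix, the left side is `tr (A S A S)`. -/
lemma sum_weightedOffDiag_mul (hw : BandedWeight w w₀ T) (hS : IsCorrelation S) :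
    ∑ i, ∑ j, ∑ k, ∑ l, weightedOffDiag w S i j * weightedOffDiag w S k l * (S i k * S j l)
      = 2 * ∑ a ∈ indexPairs p, ∑ b ∈ indexPairs p,
          w a.1 a.2 * w b.1 b.2 * (S a.1 a.2 * S b.1 b.2 * prodCov S a b) := by
  have hd : ∀ i, weightedOffDiag w S i i = 0 := by simp [weightedOffDiag, offDiagPart]
  rw [sum_eq_sum_indexPairs_add (f := fun i j => ∑ k, ∑ l,
    weightedOffDiag w S i j * weightedOffDiag w S k l * (S i k * S j l)) (by simp [hd]),
    Finset.mul_sum]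
  refine Finset.sum_congr rfl fun a ha => ?_
  simp only [← Finset.sum_add_distrib]
  rw [sum_eq_sum_indexPairs_add (f := fun k l =>
    weightedOffDiag w S a.1 a.2 * weightedOffDiag w S k l * (S a.1 k * S a.2 l)
      + weightedOffDiag w S a.2 a.1 * weightedOffDiag w S k l * (S a.2 k * S a.1 l))
    (by simp [hd]), Finset.mul_sum]
  refine Finset.sum_congr rfl fun b hb => ?_
  rw [weightedOffDiag_comm hw hS a.2 a.1, weightedOffDiag_comm hw hS b.2 b.1,
    weightedOffDiag_of_mem w S ha, weightedOffDiag_of_mem w S hb, prodCov]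
  ring

lemma sum_mul_mul_le_of_band {A : Fin p → Fin p → ℝ}
    (hA : ∀ i j, A i j * band T i j = A i j) (hS : IsCorrelation S) :
    ∑ i, ∑ j, ∑ l, A i j * A i l * S j l ≤ (2 * T + 1) * ∑ i, ∑ j, A i j ^ 2 := by
  have hpt : ∀ i j l, A i j * A i l * S j l
      ≤ 1 / 2 * (A i j ^ 2 * band T i l) + 1 / 2 * (A i l ^ 2 * band T i j) := by
    intro i j l
    rw [← hA i j, ← hA i l]
    set x := A i j
    set y := A i l
    have hb1 := band_mul_self T i j
    have hb2 := band_mul_self T i l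
    have e1 : (x * band T i j) ^ 2 * band T i l = band T i j * band T i l * x ^ 2 := by
      rw [mul_pow, sq (band T i j), hb1]; ring
    have e2 : (y * band T i l) ^ 2 * band T i j = band T i j * band T i l * y ^ 2 := by
      rw [mul_pow, sq (band T i l), hb2]; ring
    rw [e1, e2]
    have hbb : 0 ≤ band T i j * band T i l := mul_nonneg (band_nonneg _ _ _) (band_nonneg _ _ _)
    have hxy : x * y * S j l ≤ 1 / 2 * (x ^ 2 + y ^ 2) := by
      have h1 := hS.sq_le j l
      nlinarith [sq_nonneg (x - y * S j l), mul_le_mul_of_nonneg_left h1 (sq_nonneg y)]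
    nlinarith [mul_le_mul_of_nonneg_left hxy hbb]
  have hU : ∑ i, ∑ j, ∑ l, A i j ^ 2 * band T i l ≤ (2 * T + 1) * ∑ i, ∑ j, A i j ^ 2 := by
    rw [Finset.mul_sum]
    refine Finset.sum_le_sum fun i _ => ?_
    rw [Finset.mul_sum]
    refine Finset.sum_le_sum fun j _ => ?_
    rw [← Finset.mul_sum, mul_comm]
    exact mul_le_mul_of_nonneg_right (sum_band_le T i) (sq_nonneg _)
  have hU' : ∑ i, ∑ j, ∑ l, A i l ^ 2 * band T i j = ∑ i, ∑ j, ∑ l, A i j ^ 2 * band T i l :=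
    Finset.sum_congr rfl fun i _ => Finset.sum_comm
  refine (Finset.sum_le_sum fun i _ => Finset.sum_le_sum fun j _ => Finset.sum_le_sum fun l _ =>
    hpt i j l).trans ?_
  have hsplit : ∑ i, ∑ j, ∑ l,
      (1 / 2 * (A i j ^ 2 * band T i l) + 1 / 2 * (A i l ^ 2 * band T i j))
      = 1 / 2 * (∑ i, ∑ j, ∑ l, A i j ^ 2 * band T i l)
        + 1 / 2 * ∑ i, ∑ j, ∑ l, A i l ^ 2 * band T i j := by
    simp only [Finset.mul_sum, Finset.sum_add_distrib]
  rw [hsplit, hU']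
  linarith

lemma sum_mul_offDiagPart_le {A : Fin p → Fin p → ℝ}
    (hA : ∀ i j, A i j * band T i j = A i j) (hS : IsCorrelation S) :
    ∑ i, ∑ j, ∑ k, ∑ l, A i j * A k l * (offDiagPart S i k * offDiagPart S j l)
      ≤ (∑ i, ∑ j, A i j ^ 2) *
        √((2 * T + 1) ^ 2 * ∑ i, ∑ k, offDiagPart S i k ^ 2) := by
  set f : (Fin p × Fin p) × Fin p × Fin p → ℝ := fun q => A q.1.1 q.1.2 * A q.2.1 q.2.2 with hf
  set g : (Fin p × Fin p) × Fin p × Fin p → ℝ := fun q =>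
    band T q.1.1 q.1.2 * band T q.2.1 q.2.2 *
      (offDiagPart S q.1.1 q.2.1 * offDiagPart S q.1.2 q.2.2) with hg
  have hfg : ∑ i, ∑ j, ∑ k, ∑ l, A i j * A k l * (offDiagPart S i k * offDiagPart S j l)
      = ∑ q, f q * g q := by
    simp only [Fintype.sum_prod_type, hf, hg]
    refine Finset.sum_congr rfl fun i _ => Finset.sum_congr rfl fun j _ =>
      Finset.sum_congr rfl fun k _ => Finset.sum_congr rfl fun l _ => ?_
    rw [← hA i j, ← hA k l]
    linear_combination (-(A i j * A k l * (offDiagPart S i k * offDiagPart S j l) *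
      band T k l ^ 2)) * band_mul_self T i j + (-(A i j * A k l * (offDiagPart S i k *
        offDiagPart S j l) * band T i j)) * band_mul_self T k l
  have hf2 : ∑ q, f q ^ 2 = (∑ i, ∑ j, A i j ^ 2) ^ 2 := by
    rw [← Fintype.sum_prod_type' (fun i j => A i j ^ 2), sq, Finset.sum_mul_sum,
      Fintype.sum_prod_type]
    simp only [hf, mul_pow]
  have hg2 : ∑ q, g q ^ 2 ≤ (2 * T + 1) ^ 2 * ∑ i, ∑ k, offDiagPart S i k ^ 2 := by
    refine le_trans ?_ (sum_band_mul_le (R := fun i k => offDiagPart S i k ^ 2)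
      (fun _ _ => sq_nonneg _) T)
    simp only [Fintype.sum_prod_type, hg]
    refine Finset.sum_le_sum fun i _ => Finset.sum_le_sum fun j _ =>
      Finset.sum_le_sum fun k _ => Finset.sum_le_sum fun l _ => ?_
    rw [mul_pow, mul_pow, mul_pow, sq (band T i j), sq (band T k l), band_mul_self, band_mul_self]
    exact mul_le_mul_of_nonneg_left (mul_le_of_le_one_right (sq_nonneg _)
      (offDiagPart_sq_le hS j l)) (mul_nonneg (band_nonneg _ _ _) (band_nonneg _ _ _))
  have hA0 : 0 ≤ ∑ i, ∑ j, A i j ^ 2 :=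
    Finset.sum_nonneg fun i _ => Finset.sum_nonneg fun j _ => sq_nonneg _
  have hCS := Finset.sum_mul_sq_le_sq_mul_sq Finset.univ f g
  rw [hf2] at hCS
  rw [hfg, ← Real.sqrt_sq hA0, ← Real.sqrt_mul (sq_nonneg _)]
  exact Real.le_sqrt_of_sq_le (hCS.trans (mul_le_mul_of_nonneg_left hg2 (sq_nonneg _)))

/-- The bound behind the estimate of `T₂`: in `tr (A S A S)` write `S = 1 + S₀` with `S₀` the
off-diagonal part. The terms containing a factor `1` are at most of order `T ‖A‖²`, and the term
`tr (A S₀ A S₀)` is bounded by the Cauchy-Schwarz inequality. -/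
theorem sum_mul_prodCov_le (hw : BandedWeight w w₀ T) (hS : IsCorrelation S) :
    ∑ a ∈ indexPairs p, ∑ b ∈ indexPairs p,
        w a.1 a.2 * w b.1 b.2 * (S a.1 a.2 * S b.1 b.2 * prodCov S a b)
      ≤ w₀ * (∑ a ∈ indexPairs p, w a.1 a.2 * S a.1 a.2 ^ 2) * (2 * T + 1) *
        (2 + √(2 * ∑ a ∈ indexPairs p, S a.1 a.2 ^ 2)) := by
  set A := weightedOffDiag w S with hA
  have hAb : ∀ i j, A i j * band T i j = A i j := weightedOffDiag_mul_band hw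
  have hAs : ∀ i j, A i j = A j i := weightedOffDiag_comm hw hS
  have hdec : ∀ i j, S i j = (if i = j then 1 else 0) + offDiagPart S i j := by
    intro i j
    unfold offDiagPart
    by_cases h : i = j
    · simp [h, hS.diag]
    · simp [h]
  have hpt : ∀ i j k l, A i j * A k l * (S i k * S j l)
      = (if i = k then A i j * A k l * S j l else 0) + (if j = l then A i j * A k l * S i k else 0)
        - (if i = k then (if j = l then A i j * A k l else 0) else 0)
        + A i j * A k l * (offDiagPart S i k * offDiagPart S j l) := by
    intro i j k l
    rw [hdec i k, hdec j l]
    by_cases h1 : i = k <;> by_cases h2 : j = l <;> simp [h1, h2] <;> ring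
  have e1 : ∑ i, ∑ j, ∑ k, ∑ l, (if i = k then A i j * A k l * S j l else 0)
      = ∑ i, ∑ j, ∑ l, A i j * A i l * S j l := by
    refine Finset.sum_congr rfl fun i _ => Finset.sum_congr rfl fun j _ => ?_
    rw [Finset.sum_comm]
    exact Finset.sum_congr rfl fun l _ => by simp
  have e2 : ∑ i, ∑ j, ∑ k, ∑ l, (if j = l then A i j * A k l * S i k else 0)
      = ∑ i, ∑ j, ∑ l, A i j * A i l * S j l := by
    rw [Finset.sum_comm]
    refine Finset.sum_congr rfl fun j _ => Finset.sum_congr rfl fun i _ =>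
      Finset.sum_congr rfl fun k _ => ?_
    rw [Finset.sum_ite_eq, if_pos (Finset.mem_univ _), hAs i j, hAs k j]
  have e3 : ∑ i, ∑ j, ∑ k, ∑ l, (if i = k then (if j = l then A i j * A k l else 0) else 0)
      = ∑ i, ∑ j, A i j ^ 2 := by
    refine Finset.sum_congr rfl fun i _ => Finset.sum_congr rfl fun j _ => ?_
    rw [Finset.sum_comm]
    simp [sq]
  have hfull := sum_weightedOffDiag_mul hw hS
  rw [← hA] at hfull
  rw [Finset.sum_congr rfl fun i _ => Finset.sum_congr rfl fun j _ => Finset.sum_congr rfl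
    fun k _ => Finset.sum_congr rfl fun l _ => hpt i j k l] at hfull
  simp only [Finset.sum_add_distrib, Finset.sum_sub_distrib] at hfull
  rw [e1, e2, e3] at hfull
  have h1 := sum_mul_mul_le_of_band hAb hS
  have h2 := sum_mul_offDiagPart_le hAb hS
  have h3 : ∑ i, ∑ j, A i j ^ 2
      ≤ 2 * w₀ * ∑ a ∈ indexPairs p, w a.1 a.2 * S a.1 a.2 ^ 2 := sum_weightedOffDiag_sq_le hw hS
  have h0 : 0 ≤ ∑ i, ∑ j, A i j ^ 2 :=
    Finset.sum_nonneg fun i _ => Finset.sum_nonneg fun j _ => sq_nonneg _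
  rw [sum_offDiagPart_sq hS, Real.sqrt_mul (by positivity), Real.sqrt_sq (by positivity)] at h2
  set r := √(2 * ∑ a ∈ indexPairs p, S a.1 a.2 ^ 2)
  have hr : 0 ≤ (2 * (T : ℝ) + 1) * (2 + r) := by positivity
  nlinarith [mul_le_mul_of_nonneg_right h3 hr]

end MatrixBounds

end CovTest

/-! ### The constants and the optimal weights -/

namespace CovTest

/-- The largest value `λ / (2 b(φ))` of the weights. -/
noncomputable def amp (α L φ : ℝ) : ℝ := lam α L φ / (2 * bFun α L φ)

/-- The bandwidth `C_T φ^{-1/α}` before rounding. -/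
noncomputable def tstar (α L φ : ℝ) : ℝ := constT α L * φ ^ (-(1 / α))

/-- The limit `(2α+1)(4α+1)/(16α²)` of `T (λ / (2 b(φ)))²`. -/
noncomputable def kappa (α : ℝ) : ℝ := (2 * α + 1) * (4 * α + 1) / (16 * α ^ 2)

variable {α L φ : ℝ}

lemma kappa_pos (hα : 0 < α) : 0 < kappa α := by unfold kappa; positivity

lemma constT_pos (hα : 0 < α) (hL : 0 < L) : 0 < constT α L := by
  unfold constT; positivity

lemma constLam_eq (hα : 0 < α) (hL : 0 < L) :
    constLam α L = (2 * α + 1) / (2 * α) * (constT α L)⁻¹ := by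
  unfold constLam constT
  rw [Real.rpow_neg (by positivity)]

lemma constC_eq (hα : 0 < α) (hL : 0 < L) :
    constC α L = (2 * α + 1) / (4 * α + 1) * (constT α L)⁻¹ := by
  unfold constC constT
  rw [Real.rpow_neg hL.le, Real.rpow_add (by positivity), Real.rpow_one,
    Real.mul_rpow (by positivity) hL.le]
  field_simp

lemma constC_pos (hα : 0 < α) (hL : 0 < L) : 0 < constC α L := by
  rw [constC_eq hα hL]
  have := constT_pos hα hL
  positivity

lemma tstar_pos (hα : 0 < α) (hL : 0 < L) (hφ : 0 < φ) : 0 < tstar α L φ :=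
  mul_pos (constT_pos hα hL) (Real.rpow_pos_of_pos hφ _)

lemma bFun_pos (hα : 0 < α) (hL : 0 < L) (hφ : 0 < φ) : 0 < bFun α L φ :=
  mul_pos (Real.sqrt_pos.2 (constC_pos hα hL)) (Real.rpow_pos_of_pos hφ _)

lemma lam_pos (hα : 0 < α) (hL : 0 < L) (hφ : 0 < φ) : 0 < lam α L φ := by
  unfold lam
  rw [constLam_eq hα hL]
  have := constT_pos hα hL
  positivity

lemma amp_pos (hα : 0 < α) (hL : 0 < L) (hφ : 0 < φ) : 0 < amp α L φ :=
  div_pos (lam_pos hα hL hφ) (mul_pos two_pos (bFun_pos hα hL hφ))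

lemma rpow_half_sq (hα : 0 < α) (hφ : 0 < φ) :
    (φ ^ (1 / (2 * α))) ^ 2 = φ ^ (1 / α) := by
  rw [← Real.rpow_natCast, ← Real.rpow_mul hφ.le]
  congr 1
  push_cast
  field_simp

lemma lam_eq (hα : 0 < α) (hφ : 0 < φ) :
    lam α L φ = constLam α L * (φ ^ 2 * (φ ^ (1 / (2 * α))) ^ 2) := by
  unfold lam
  rw [rpow_half_sq hα hφ, ← Real.rpow_natCast φ 2, ← Real.rpow_add hφ]
  congr 2
  push_cast
  field_simp

lemma bFun_eq (hφ : 0 < φ) :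
    bFun α L φ = √(constC α L) * (φ ^ 2 * φ ^ (1 / (2 * α))) := by
  unfold bFun
  rw [Real.rpow_add hφ, Real.rpow_two]

lemma amp_eq (hα : 0 < α) (hL : 0 < L) (hφ : 0 < φ) :
    amp α L φ = constLam α L * φ ^ (1 / (2 * α)) / (2 * √(constC α L)) := by
  unfold amp
  rw [lam_eq hα hφ, bFun_eq hφ]
  have h1 : 0 < φ ^ (1 / (2 * α)) := Real.rpow_pos_of_pos hφ _
  have h2 := Real.sqrt_pos.2 (constC_pos hα hL)
  field_simp

lemma amp_sq_mul_tstar (hα : 0 < α) (hL : 0 < L) (hφ : 0 < φ) :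
    amp α L φ ^ 2 * tstar α L φ = kappa α := by
  have h1 : 0 < φ ^ (1 / (2 * α)) := Real.rpow_pos_of_pos hφ _
  have h2 := constC_pos hα hL
  have h3 := constT_pos hα hL
  rw [amp_eq hα hL hφ, tstar, Real.rpow_neg hφ.le, ← rpow_half_sq hα hφ, div_pow, mul_pow,
    mul_pow, Real.sq_sqrt h2.le, constC_eq hα hL, constLam_eq hα hL, kappa]
  field_simp
  ring

lemma bFun_eq_amp (hα : 0 < α) (hL : 0 < L) (hφ : 0 < φ) :
    bFun α L φ = amp α L φ * φ ^ 2 * (4 * α / (4 * α + 1)) := by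
  have h1 : 0 < φ ^ (1 / (2 * α)) := Real.rpow_pos_of_pos hφ _
  have h2 := constC_pos hα hL
  have h3 := constT_pos hα hL
  have h4 : constLam α L = constC α L * ((4 * α + 1) / (2 * α)) := by
    rw [constC_eq hα hL, constLam_eq hα hL]; field_simp
  have h5 : √(constC α L) ^ 2 = constC α L := Real.sq_sqrt h2.le
  have h6 := Real.sqrt_pos.2 h2
  rw [amp_eq hα hL hφ, bFun_eq hφ, h4]
  field_simp
  rw [h5]
  ring

lemma tstar_rpow (hα : 0 < α) (hL : 0 < L) (hφ : 0 < φ) :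
    tstar α L φ ^ (2 * α) = (4 * α + 1) * L / φ ^ 2 := by
  unfold tstar constT
  rw [Real.mul_rpow (by positivity) (by positivity), ← Real.rpow_mul (by positivity),
    ← Real.rpow_mul hφ.le]
  have e1 : 1 / (2 * α) * (2 * α) = 1 := by field_simp
  have e2 : -(1 / α) * (2 * α) = -(2 : ℝ) := by field_simp
  rw [e1, e2, Real.rpow_one, Real.rpow_neg hφ.le, Real.rpow_two, div_eq_mul_inv]

lemma bandT_le_tstar (hα : 0 < α) (hL : 0 < L) (hφ : 0 < φ) :
    (bandT α L φ : ℝ) ≤ tstar α L φ := Nat.floor_le (tstar_pos hα hL hφ).le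

lemma bandT_mul_amp_sq_le (hα : 0 < α) (hL : 0 < L) (hφ : 0 < φ) :
    bandT α L φ * amp α L φ ^ 2 ≤ kappa α := by
  rw [← amp_sq_mul_tstar hα hL hφ, mul_comm]
  exact mul_le_mul_of_nonneg_left (bandT_le_tstar hα hL hφ) (sq_nonneg _)

section Weight

variable {p : ℕ}

lemma idist_comm (i j : Fin p) : idist i j = idist j i := abs_sub_comm _ _

lemma idist_nonneg (i j : Fin p) : 0 ≤ idist i j := abs_nonneg _

lemma idist_of_lt {i j : Fin p} (h : i < j) : idist i j = (((j : ℕ) - (i : ℕ) : ℕ) : ℝ) := by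
  have h' : (i : ℕ) ≤ j := le_of_lt h
  rw [idist, abs_sub_comm, Nat.cast_sub h', abs_of_nonneg]
  exact sub_nonneg.2 (by exact_mod_cast h')

lemma weight_eq (α L φ : ℝ) (i j : Fin p) :
    weight α L φ i j
      = amp α L φ * max (1 - (idist i j / (bandT α L φ : ℝ)) ^ (2 * α)) 0 := rfl

lemma max_one_sub_rpow_eq_zero (hα : 0 < α) {x : ℝ} (hx : 1 ≤ x) :
    max (1 - x ^ (2 * α)) 0 = 0 :=
  max_eq_right (sub_nonpos.2 (Real.one_le_rpow hx (by positivity)))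

lemma bandedWeight_weight (hα : 0 < α) (hL : 0 < L) (hφ : 0 < φ) (hT : 1 ≤ bandT α L φ) :
    BandedWeight (weight α L φ : Fin p → Fin p → ℝ) (amp α L φ) (bandT α L φ) where
  nonneg i j := by
    rw [weight_eq]
    exact mul_nonneg (amp_pos hα hL hφ).le (le_max_right _ _)
  le i j := by
    rw [weight_eq]
    refine mul_le_of_le_one_right (amp_pos hα hL hφ).le (max_le ?_ zero_le_one)
    have : 0 ≤ (idist i j / (bandT α L φ : ℝ)) ^ (2 * α) :=
      Real.rpow_nonneg (div_nonneg (idist_nonneg i j) (Nat.cast_nonneg _)) _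
    linarith
  symm i j := by rw [weight_eq, weight_eq, idist_comm]
  eq_zero i j h := by
    have hlt : i < j := by
      rw [Fin.lt_def]; omega
    rw [weight_eq, max_one_sub_rpow_eq_zero hα, mul_zero]
    have hT' : (0 : ℝ) < bandT α L φ := by exact_mod_cast hT
    rw [idist_of_lt hlt, le_div_iff₀ hT', one_mul]
    exact_mod_cast (by omega)

end Weight

/-! ### The sum of the squared weights -/

section Riemann

lemma sum_Ioi_sub_le {p T : ℕ} {f : ℕ → ℝ} (hf : ∀ d, 0 ≤ f d) (h0 : ∀ d, T < d → f d = 0)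
    (i : Fin p) : ∑ j ∈ Finset.Ioi i, f (j - i) ≤ ∑ e ∈ Finset.range T, f (e + 1) := by
  have hinj : Set.InjOn (fun j : Fin p => (j : ℕ) - i) (Finset.Ioi i : Finset (Fin p)) := by
    intro a ha b hb hab
    simp only [Finset.coe_Ioi, Set.mem_Ioi, Fin.lt_def] at ha hb
    exact Fin.ext (by simp only at hab; omega)
  rw [← Finset.sum_image hinj]
  have e : ∑ e ∈ Finset.range T, f (e + 1) = ∑ d ∈ Finset.Ico 1 (T + 1), f d := by
    rw [Finset.sum_Ico_eq_sum_range]; simp [add_comm]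
  rw [e]
  rw [← Finset.sum_filter_ne_zero]
  refine Finset.sum_le_sum_of_subset_of_nonneg (fun d hd => ?_) fun d _ _ => hf d
  simp only [Finset.mem_filter, Finset.mem_image, Finset.mem_Ioi, Fin.lt_def] at hd
  obtain ⟨⟨j, hj, rfl⟩, hne⟩ := hd
  have : ¬ T < (j : ℕ) - i := fun h => hne (h0 _ h)
  rw [Finset.mem_Ico]
  omega

lemma le_sum_Ioi_sub {p T : ℕ} {f : ℕ → ℝ} (hf : ∀ d, 0 ≤ f d) {i : Fin p}
    (hi : (i : ℕ) + T < p) : ∑ e ∈ Finset.range T, f (e + 1) ≤ ∑ j ∈ Finset.Ioi i, f (j - i) := by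
  have hinj : Set.InjOn (fun j : Fin p => (j : ℕ) - i) (Finset.Ioi i : Finset (Fin p)) := by
    intro a ha b hb hab
    simp only [Finset.coe_Ioi, Set.mem_Ioi, Fin.lt_def] at ha hb
    exact Fin.ext (by simp only at hab; omega)
  rw [← Finset.sum_image hinj]
  have e : ∑ e ∈ Finset.range T, f (e + 1) = ∑ d ∈ Finset.Ico 1 (T + 1), f d := by
    rw [Finset.sum_Ico_eq_sum_range]; simp [add_comm]
  rw [e]
  refine Finset.sum_le_sum_of_subset_of_nonneg (fun d hd => ?_) fun d _ _ => hf d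
  rw [Finset.mem_Ico] at hd
  refine Finset.mem_image.2 ⟨⟨(i : ℕ) + d, by omega⟩, ?_, by simp⟩
  rw [Finset.mem_Ioi, Fin.lt_def]
  simp only
  omega

lemma sum_sum_Ioi_sub_le {p T : ℕ} {f : ℕ → ℝ} (hf : ∀ d, 0 ≤ f d)
    (h0 : ∀ d, T < d → f d = 0) :
    ∑ i : Fin p, ∑ j ∈ Finset.Ioi i, f (j - i) ≤ p * ∑ e ∈ Finset.range T, f (e + 1) := by
  refine (Finset.sum_le_sum fun i _ => sum_Ioi_sub_le hf h0 i).trans ?_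
  simp

lemma le_sum_sum_Ioi_sub {p T : ℕ} {f : ℕ → ℝ} (hf : ∀ d, 0 ≤ f d) :
    ((p : ℝ) - T) * ∑ e ∈ Finset.range T, f (e + 1)
      ≤ ∑ i : Fin p, ∑ j ∈ Finset.Ioi i, f (j - i) := by
  have h1 : ∑ _i ∈ Finset.univ.filter fun i : Fin p => (i : ℕ) < p - T,
      ∑ e ∈ Finset.range T, f (e + 1)
      ≤ ∑ i : Fin p, ∑ j ∈ Finset.Ioi i, f (j - i) := by
    refine (Finset.sum_le_sum fun i hi => le_sum_Ioi_sub (T := T) hf ?_).trans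
      (Finset.sum_le_univ_sum_of_nonneg fun i => Finset.sum_nonneg fun j _ => hf _)
    rw [Finset.mem_filter] at hi
    omega
  refine le_trans ?_ h1
  rw [Finset.sum_const, nsmul_eq_mul, Fin.card_filter_val_lt, min_eq_right (Nat.sub_le _ _)]
  refine mul_le_mul_of_nonneg_right ?_ (Finset.sum_nonneg fun e _ => hf _)
  rw [sub_le_iff_le_add]
  exact_mod_cast (by omega)

lemma tendsto_sum_rpow {s : ℝ} (hs : 0 < s) :
    Tendsto (fun T : ℕ => (∑ e ∈ Finset.range T, (((e + 1 : ℕ) : ℝ) / T) ^ s) / T) atTop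
      (𝓝 (1 / (s + 1))) := by
  have hmono : ∀ T : ℕ, MonotoneOn (fun x : ℝ => x ^ s) (Set.Icc (0 : ℝ) (0 + T)) :=
    fun T x hx y _ hxy => Real.rpow_le_rpow hx.1 hxy hs.le
  have hint : ∀ T : ℕ, ∫ x in (0 : ℝ)..0 + T, x ^ s = (T : ℝ) ^ (s + 1) / (s + 1) := by
    intro T
    rw [integral_rpow (Or.inl (by linarith)), Real.zero_rpow (by positivity), zero_add, sub_zero]
  have hlow : ∀ T : ℕ, (T : ℝ) ^ (s + 1) / (s + 1)
      ≤ ∑ e ∈ Finset.range T, ((e + 1 : ℕ) : ℝ) ^ s := by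
    intro T
    rw [← hint]
    simpa using (hmono T).integral_le_sum
  have hup : ∀ T : ℕ, ∑ e ∈ Finset.range T, ((e + 1 : ℕ) : ℝ) ^ s
      ≤ (T : ℝ) ^ (s + 1) / (s + 1) + (T : ℝ) ^ s := by
    intro T
    have h1 := (hmono T).sum_le_integral
    rw [hint] at h1
    have h2 := Finset.sum_range_succ' (fun e : ℕ => (e : ℝ) ^ s) T
    rw [Finset.sum_range_succ, Nat.cast_zero, Real.zero_rpow hs.ne', add_zero] at h2
    simp only [zero_add] at h1
    linarith
  have hrew : ∀ T : ℕ, 0 < T → (∑ e ∈ Finset.range T, (((e + 1 : ℕ) : ℝ) / T) ^ s) / T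
      = (∑ e ∈ Finset.range T, ((e + 1 : ℕ) : ℝ) ^ s) / (T : ℝ) ^ (s + 1) := by
    intro T hT
    have hT' : (0 : ℝ) < T := by exact_mod_cast hT
    rw [Real.rpow_add hT', Real.rpow_one, ← div_div, Finset.sum_div _ _ ((T : ℝ) ^ s)]
    refine congrArg (· / (T : ℝ)) ?_
    exact Finset.sum_congr rfl fun e _ => Real.div_rpow (by positivity) hT'.le _
  refine tendsto_of_tendsto_of_tendsto_of_le_of_le' tendsto_const_nhds
    (h := fun T : ℕ => 1 / (s + 1) + 1 / (T : ℝ)) ?_ ?_ ?_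
  · simpa using (tendsto_const_nhds (x := 1 / (s + 1))).add
      (tendsto_one_div_atTop_nhds_zero_nat (𝕜 := ℝ))
  · filter_upwards [eventually_gt_atTop 0] with T hT
    have hT' : (0 : ℝ) < T := by exact_mod_cast hT
    rw [hrew T hT, le_div_iff₀ (by positivity)]
    calc _ = (T : ℝ) ^ (s + 1) / (s + 1) := by ring
      _ ≤ _ := hlow T
  · filter_upwards [eventually_gt_atTop 0] with T hT
    have hT' : (0 : ℝ) < T := by exact_mod_cast hT
    rw [hrew T hT, div_le_iff₀ (by positivity)]
    refine (hup T).trans (le_of_eq ?_)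
    rw [Real.rpow_add hT', Real.rpow_one]
    field_simp

/-- The Riemann sum of `(1 - x^{2α})²` over `[0, 1]`. -/
lemma tendsto_sum_one_sub_rpow_sq (hα : 0 < α) :
    Tendsto (fun T : ℕ =>
      (∑ e ∈ Finset.range T, max (1 - (((e + 1 : ℕ) : ℝ) / T) ^ (2 * α)) 0 ^ 2) / T) atTop
      (𝓝 (8 * α ^ 2 / ((2 * α + 1) * (4 * α + 1)))) := by
  have h1 := tendsto_sum_rpow (s := 2 * α) (by positivity)
  have h2 := tendsto_sum_rpow (s := 4 * α) (by positivity)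
  have h3 := ((tendsto_const_nhds (x := (1 : ℝ))).sub (h1.const_mul 2)).add h2
  have e : 1 - 2 * (1 / (2 * α + 1)) + 1 / (4 * α + 1)
      = 8 * α ^ 2 / ((2 * α + 1) * (4 * α + 1)) := by
    field_simp; ring
  rw [e] at h3
  refine h3.congr' ?_
  filter_upwards [eventually_gt_atTop 0] with T hT
  have hT' : (0 : ℝ) < T := by exact_mod_cast hT
  have key : ∀ e ∈ Finset.range T, max (1 - (((e + 1 : ℕ) : ℝ) / T) ^ (2 * α)) 0 ^ 2
      = 1 - 2 * (((e + 1 : ℕ) : ℝ) / T) ^ (2 * α) + (((e + 1 : ℕ) : ℝ) / T) ^ (4 * α) := by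
    intro e he
    have hpos : (0 : ℝ) ≤ ((e + 1 : ℕ) : ℝ) / T := by positivity
    have hle : ((e + 1 : ℕ) : ℝ) / T ≤ 1 := by
      rw [div_le_one hT']
      exact_mod_cast Finset.mem_range.1 he
    rw [max_eq_left (sub_nonneg.2 (Real.rpow_le_one hpos hle (by positivity)))]
    have : (((e + 1 : ℕ) : ℝ) / T) ^ (4 * α) = ((((e + 1 : ℕ) : ℝ) / T) ^ (2 * α)) ^ 2 := by
      rw [← Real.rpow_natCast, ← Real.rpow_mul hpos]
      congr 1; push_cast; ring
    rw [this]; ring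
  rw [Finset.sum_congr rfl key, Finset.sum_add_distrib, Finset.sum_sub_distrib,
    ← Finset.mul_sum, Finset.sum_const, Finset.card_range, nsmul_eq_mul]
  field_simp

end Riemann

end CovTest

/-! ### The asymptotic regime -/

namespace CovTest

variable {α L φ : ℝ}

lemma sum_weight_sq_eq (α L φ : ℝ) (p : ℕ) :
    ∑ i : Fin p, ∑ j ∈ Finset.Ioi i, weight α L φ i j ^ 2
      = amp α L φ ^ 2 * ∑ i : Fin p, ∑ j ∈ Finset.Ioi i,
          max (1 - ((((j : ℕ) - (i : ℕ) : ℕ) : ℝ) / (bandT α L φ : ℝ)) ^ (2 * α)) 0 ^ 2 := by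
  rw [Finset.mul_sum]
  refine Finset.sum_congr rfl fun i _ => ?_
  rw [Finset.mul_sum]
  refine Finset.sum_congr rfl fun j hj => ?_
  rw [weight_eq, idist_of_lt (Finset.mem_Ioi.1 hj), mul_pow]

namespace Regime

variable {n p : ℕ → ℕ} {φ : ℕ → ℝ}

lemma tendsto_tstar (h : Regime α n p φ) (hα : 0 < α) (hL : 0 < L) :
    Tendsto (fun m => tstar α L (φ m)) atTop atTop := by
  have h1 : Tendsto φ atTop (𝓝[>] 0) :=
    tendsto_nhdsWithin_iff.2 ⟨h.tendsto_phi, Eventually.of_forall h.phi_pos⟩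
  exact ((tendsto_rpow_neg_nhdsGT_zero (neg_lt_zero.2 (one_div_pos.2 hα))).comp h1).const_mul_atTop
    (constT_pos hα hL)

lemma tendsto_bandT (h : Regime α n p φ) (hα : 0 < α) (hL : 0 < L) :
    Tendsto (fun m => bandT α L (φ m)) atTop atTop :=
  tendsto_nat_floor_atTop.comp (h.tendsto_tstar hα hL)

lemma one_le_bandT (h : Regime α n p φ) (hα : 0 < α) (hL : 0 < L) :
    ∀ᶠ m in atTop, 1 ≤ bandT α L (φ m) :=
  (h.tendsto_bandT hα hL).eventually_ge_atTop 1

lemma tendsto_bandT_div_tstar (h : Regime α n p φ) (hα : 0 < α) (hL : 0 < L) :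
    Tendsto (fun m => (bandT α L (φ m) : ℝ) / tstar α L (φ m)) atTop (𝓝 1) :=
  tendsto_nat_floor_div_atTop.comp (h.tendsto_tstar hα hL)

lemma tendsto_bandT_div_p (h : Regime α n p φ) (hα : 0 < α) (hL : 0 < L) :
    Tendsto (fun m => (bandT α L (φ m) : ℝ) / p m) atTop (𝓝 0) := by
  have h1 := (h.tendsto_p_phi.inv_tendsto_atTop).const_mul (constT α L)
  rw [mul_zero] at h1
  refine squeeze_zero (fun m => by positivity) (fun m => ?_) h1
  refine (div_le_div_of_nonneg_right (bandT_le_tstar hα hL (h.phi_pos m))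
    (Nat.cast_nonneg _)).trans (le_of_eq ?_)
  rw [tstar, Real.rpow_neg (h.phi_pos m).le, Pi.inv_apply, mul_inv, div_eq_mul_inv]
  ring

lemma tendsto_amp_sq_mul_bandT (h : Regime α n p φ) (hα : 0 < α) (hL : 0 < L) :
    Tendsto (fun m => amp α L (φ m) ^ 2 * bandT α L (φ m)) atTop (𝓝 (kappa α)) := by
  have h1 := (h.tendsto_bandT_div_tstar hα hL).const_mul (kappa α)
  rw [mul_one] at h1
  refine h1.congr fun m => ?_
  have := tstar_pos hα hL (h.phi_pos m)
  rw [← amp_sq_mul_tstar hα hL (h.phi_pos m)]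
  field_simp

/-- The normalization of the weights: the sum of their squares is asymptotically `p / 2`. -/
lemma tendsto_sum_weight_sq (h : Regime α n p φ) (hα : 0 < α) (hL : 0 < L) :
    Tendsto (fun m => 2 / (p m : ℝ) *
      ∑ i : Fin (p m), ∑ j ∈ Finset.Ioi i, weight α L (φ m) i j ^ 2) atTop (𝓝 1) := by
  have hG := ((h.tendsto_amp_sq_mul_bandT hα hL).const_mul 2).mul
    ((tendsto_sum_one_sub_rpow_sq hα).comp (h.tendsto_bandT hα hL))
  have e : 2 * kappa α * (8 * α ^ 2 / ((2 * α + 1) * (4 * α + 1))) = 1 := by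
    unfold kappa; field_simp; norm_num
  rw [e] at hG
  have hlow := ((tendsto_const_nhds (x := (1 : ℝ))).sub (h.tendsto_bandT_div_p hα hL)).mul hG
  rw [sub_zero, one_mul] at hlow
  refine tendsto_of_tendsto_of_tendsto_of_le_of_le' hlow hG ?_ ?_
  all_goals
    filter_upwards [h.one_le_bandT hα hL, h.tendsto_p.eventually_ge_atTop 1] with m hT hp
    have hT' : (0 : ℝ) < bandT α L (φ m) := by exact_mod_cast hT
    have hp' : (0 : ℝ) < p m := by exact_mod_cast hp
    set f : ℕ → ℝ := fun d => max (1 - ((d : ℝ) / (bandT α L (φ m) : ℝ)) ^ (2 * α)) 0 ^ 2 with hf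
    have hf0 : ∀ d, 0 ≤ f d := fun d => sq_nonneg _
    rw [sum_weight_sq_eq]
    simp only [Function.comp_apply]
  · calc _ = 2 / (p m : ℝ) * (amp α L (φ m) ^ 2 * (((p m : ℝ) - bandT α L (φ m)) *
          ∑ e ∈ Finset.range (bandT α L (φ m)), f (e + 1))) := by
            simp only [hf]; field_simp
      _ ≤ _ := by
        refine mul_le_mul_of_nonneg_left (mul_le_mul_of_nonneg_left ?_ (sq_nonneg _))
          (by positivity)
        exact le_sum_sum_Ioi_sub hf0
  · have hf1 : ∀ d, bandT α L (φ m) < d → f d = 0 := fun d hd => by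
      simp only [hf]
      rw [max_one_sub_rpow_eq_zero hα, zero_pow two_ne_zero]
      rw [le_div_iff₀ hT', one_mul]
      exact_mod_cast hd.le
    calc _ ≤ 2 / (p m : ℝ) * (amp α L (φ m) ^ 2 * ((p m : ℝ) *
          ∑ e ∈ Finset.range (bandT α L (φ m)), f (e + 1))) := by
            refine mul_le_mul_of_nonneg_left (mul_le_mul_of_nonneg_left ?_ (sq_nonneg _))
              (by positivity)
            exact sum_sum_Ioi_sub_le hf0 hf1
      _ = _ := by simp only [hf]; field_simp

end Regime

/-! ### Null hypothesis -/

lemma memLp_two_stat (α L φ : ℝ) (n p : ℕ) (S : Matrix (Fin p) (Fin p) ℝ) :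
    MemLp (stat α L φ n p) 2 (law n S) := by
  rw [stat_eq_ustat]
  exact (hasMoments_ustat S _ n).memLp_two

lemma Regime.tendsto_variance_stat {n p : ℕ → ℕ} {φ : ℕ → ℝ} (h : Regime α n p φ) (hα : 0 < α)
    (hL : 0 < L) :
    Tendsto (fun m => Var[stat α L (φ m) (n m) (p m);
        law (n m) (1 : Matrix (Fin (p m)) (Fin (p m)) ℝ)] /
        (1 / ((n m : ℝ) * ((n m : ℝ) - 1) * (p m : ℝ)))) atTop (𝓝 1) := by
  refine (h.tendsto_sum_weight_sq hα hL).congr' ?_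
  filter_upwards [h.tendsto_n.eventually_ge_atTop 2, h.tendsto_p.eventually_ge_atTop 1] with m hn hp
  have hn' : (2 : ℝ) ≤ n m := by exact_mod_cast hn
  have hp' : (0 : ℝ) < p m := by exact_mod_cast hp
  have h1 : (0 : ℝ) < (n m : ℝ) - 1 := by linarith
  rw [stat_eq_ustat, variance_ustat_one _ hn]
  field_simp

lemma Regime.tendstoInDistribution_stat {n p : ℕ → ℕ} {φ : ℕ → ℝ} (h : Regime α n p φ)
    (hα : 0 < α) (hL : 0 < L) :
    TendstoInDistribution
      (fun m (X : Sample (n m) (p m)) =>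
        (n m : ℝ) * √(p m : ℝ) * stat α L (φ m) (n m) (p m) X)
      atTop (id : ℝ → ℝ)
      (fun m => law (n m) (1 : Matrix (Fin (p m)) (Fin (p m)) ℝ))
      (gaussianReal 0 1) where
  forall_aemeasurable m :=
    (memLp_two_stat α L (φ m) (n m) (p m) 1).aestronglyMeasurable.aemeasurable.const_mul _
  aemeasurable_limit := aemeasurable_id
  tendsto := by
    refine ProbabilityMeasure.tendsto_iff_tendsto_charFun.2 fun t => ?_
    simp only [ProbabilityMeasure.coe_mk, Measure.map_id, charFun_gaussianReal]
    have hT := h.one_le_bandT hα hL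
    have := tendsto_charFun_ustat (w := fun m => (weight α L (φ m) : Fin (p m) → Fin (p m) → ℝ))
      (w₀ := fun m => amp α L (φ m)) (T := fun m => bandT α L (φ m)) (B := kappa α)
      h.tendsto_n h.tendsto_p hT (h.tendsto_bandT_div_p hα hL)
      (by
        filter_upwards [hT] with m hT i j
        have hw := bandedWeight_weight (p := p m) hα hL (h.phi_pos m) hT
        rw [abs_of_nonneg (hw.nonneg i j)]
        exact hw.le i j)
      (by
        filter_upwards [hT] with m hT i j hij
        exact (bandedWeight_weight hα hL (h.phi_pos m) hT).eq_zero i j hij)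
      (Eventually.of_forall fun m => bandT_mul_amp_sq_le hα hL (h.phi_pos m))
      (h.tendsto_sum_weight_sq hα hL) t
    convert this using 2
    congr 1
    simp

end CovTest

/-! ### Alternatives -/

namespace CovTest

variable {α L φ : ℝ} {p : ℕ} {S : Matrix (Fin p) (Fin p) ℝ}

lemma isCorrelation_of_posSemidef (hS : S.PosSemidef) (hd : ∀ i, S i i = 1) :
    IsCorrelation S := by
  have hsymm : ∀ i j, S i j = S j i := fun i j => by simpa using hS.isHermitian.apply j i
  refine ⟨hsymm, hd, fun i j => ?_⟩
  rcases eq_or_ne i j with rfl | hij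
  · rw [hd]; norm_num
  have h := (hS.submatrix ![i, j]).det_nonneg
  rw [Matrix.det_fin_two] at h
  simp only [Matrix.submatrix_apply, Matrix.cons_val_zero, Matrix.cons_val_one, hd,
    hsymm j i] at h
  nlinarith

/-- An upper bound for the relative loss in `∑ σ_{ij}²` incurred by the weights, over
`Q(α, L, φ)`. -/
noncomputable def lossRatio (α L φ : ℝ) : ℝ := L / ((bandT α L φ : ℝ) ^ (2 * α) * φ ^ 2)

lemma lossRatio_eq (hα : 0 < α) (hL : 0 < L) (hφ : 0 < φ) (hT : 1 ≤ bandT α L φ) :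
    lossRatio α L φ = ((bandT α L φ / tstar α L φ) ^ (2 * α))⁻¹ / (4 * α + 1) := by
  have hT' : (0 : ℝ) < bandT α L φ := by exact_mod_cast hT
  have h1 : (0 : ℝ) < (bandT α L φ : ℝ) ^ (2 * α) := Real.rpow_pos_of_pos hT' _
  rw [Real.div_rpow hT'.le (tstar_pos hα hL hφ).le, tstar_rpow hα hL hφ, lossRatio]
  field_simp

lemma amp_mul_le_sum_weight (hα : 0 < α) (hL : 0 < L) (hφ : 0 < φ) (hp : 1 ≤ p)
    (hT : 1 ≤ bandT α L φ) (hS : S ∈ classQ α L φ p) :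
    amp α L φ * ((1 - lossRatio α L φ) * ∑ i, ∑ j ∈ Finset.Ioi i, S i j ^ 2)
      ≤ ∑ i, ∑ j ∈ Finset.Ioi i, weight α L φ i j * S i j ^ 2 := by
  obtain ⟨⟨-, -, hF⟩, hQ⟩ := hS
  have hp' : (0 : ℝ) < p := by exact_mod_cast hp
  have hT' : (0 : ℝ) < bandT α L φ := by exact_mod_cast hT
  have ha := amp_pos hα hL hφ
  set T : ℝ := (bandT α L φ : ℝ) with hTdef
  have hTα : 0 < T ^ (2 * α) := Real.rpow_pos_of_pos hT' _
  set N := ∑ i, ∑ j ∈ Finset.Ioi i, S i j ^ 2 with hN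
  set F := ∑ i : Fin p, ∑ j ∈ Finset.Ioi i, S i j ^ 2 * idist i j ^ (2 * α) with hFdef
  have hF' : F ≤ p * L := by
    rw [one_div, inv_mul_le_iff₀ hp'] at hF; exact hF
  have hQ' : p * φ ^ 2 ≤ N := by
    rw [one_div, le_inv_mul_iff₀ hp'] at hQ; exact hQ
  have h1 : amp α L φ * (N - F / T ^ (2 * α))
      ≤ ∑ i, ∑ j ∈ Finset.Ioi i, weight α L φ i j * S i j ^ 2 := by
    rw [hN, hFdef, Finset.sum_div, ← Finset.sum_sub_distrib, Finset.mul_sum]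
    refine Finset.sum_le_sum fun i _ => ?_
    rw [Finset.sum_div, ← Finset.sum_sub_distrib, Finset.mul_sum]
    refine Finset.sum_le_sum fun j _ => ?_
    rw [weight_eq, mul_assoc]
    refine mul_le_mul_of_nonneg_left ?_ ha.le
    calc _ = (1 - (idist i j / T) ^ (2 * α)) * S i j ^ 2 := by
          rw [Real.div_rpow (idist_nonneg i j) hT'.le]; ring
      _ ≤ _ := mul_le_mul_of_nonneg_right (le_max_left _ _) (sq_nonneg _)
  refine le_trans (mul_le_mul_of_nonneg_left ?_ ha.le) h1
  have h2 : F / T ^ (2 * α) ≤ lossRatio α L φ * N := by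
    calc F / T ^ (2 * α) ≤ p * L / T ^ (2 * α) := by gcongr
      _ = lossRatio α L φ * (p * φ ^ 2) := by rw [lossRatio, ← hTdef]; field_simp
      _ ≤ _ := by
        refine mul_le_mul_of_nonneg_left hQ' ?_
        rw [lossRatio]; positivity
  linarith

lemma mul_sq_le_sum_sq (hp : 1 ≤ p) (hS : S ∈ classQ α L φ p) :
    p * φ ^ 2 ≤ ∑ i, ∑ j ∈ Finset.Ioi i, S i j ^ 2 := by
  have hp' : (0 : ℝ) < p := by exact_mod_cast hp
  have h := hS.2
  rwa [one_div, le_inv_mul_iff₀ hp'] at h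

lemma le_integral_stat {n : ℕ} (hα : 0 < α) (hL : 0 < L) (hφ : 0 < φ) (hn : 2 ≤ n) (hp : 1 ≤ p)
    (hT : 1 ≤ bandT α L φ) (hS : S ∈ classQ α L φ p) (hr : lossRatio α L φ ≤ 1) :
    amp α L φ * φ ^ 2 * (1 - lossRatio α L φ) ≤ ∫ X, stat α L φ n p X ∂(law n S) := by
  have hp' : (0 : ℝ) < p := by exact_mod_cast hp
  rw [stat_eq_ustat, integral_ustat hS.1.1 _ hn, one_div, le_inv_mul_iff₀ hp']
  refine le_trans ?_ (amp_mul_le_sum_weight hα hL hφ hp hT hS)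
  calc _ = amp α L φ * ((1 - lossRatio α L φ) * (p * φ ^ 2)) := by ring
    _ ≤ _ := mul_le_mul_of_nonneg_left (mul_le_mul_of_nonneg_left (mul_sq_le_sum_sq hp hS)
      (sub_nonneg.2 hr)) (amp_pos hα hL hφ).le

lemma bFun_le_integral_stat {n N : ℕ} (hα : 0 < α) (hL : 0 < L) (hφ : 0 < φ) (hn : 2 ≤ n)
    (hp : 1 ≤ p) (hS : S ∈ classQ α L φ p) (hN : constT α L * φ ^ (-(1 / α)) = N) :
    bFun α L φ ≤ ∫ X, stat α L φ n p X ∂(law n S) := by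
  have hN' : tstar α L φ = N := hN
  have hb : bandT α L φ = N := by rw [bandT, hN, Nat.floor_natCast]
  have hpos := tstar_pos hα hL hφ
  have hT : 1 ≤ bandT α L φ := by
    rw [hb]; rw [hN'] at hpos; exact_mod_cast hpos
  have hr : lossRatio α L φ = 1 / (4 * α + 1) := by
    rw [lossRatio_eq hα hL hφ hT, hb, ← hN', div_self hpos.ne', Real.one_rpow, inv_one]
  refine le_trans (le_of_eq ?_) (le_integral_stat hα hL hφ hn hp hT hS ?_)
  · rw [bFun_eq_amp hα hL hφ, hr]; field_simp; ring
  · rw [hr, div_le_one (by positivity)]; linarith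

/-- The relative deficit of the lower bound for the expectation with respect to `b(φ)`. -/
noncomputable def deficit (α L φ : ℝ) : ℝ :=
  (lossRatio α L φ - 1 / (4 * α + 1)) * ((4 * α + 1) / (4 * α))

lemma one_sub_deficit_mul (hα : 0 < α) (hL : 0 < L) (hφ : 0 < φ) :
    (1 - deficit α L φ) * bFun α L φ = amp α L φ * φ ^ 2 * (1 - lossRatio α L φ) := by
  rw [bFun_eq_amp hα hL hφ, deficit]
  field_simp
  ring

lemma Regime.tendsto_lossRatio {n p : ℕ → ℕ} {φ : ℕ → ℝ} (h : Regime α n p φ) (hα : 0 < α)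
    (hL : 0 < L) : Tendsto (fun m => lossRatio α L (φ m)) atTop (𝓝 (1 / (4 * α + 1))) := by
  have h1 := (((h.tendsto_bandT_div_tstar hα hL).rpow_const (p := 2 * α)
    (Or.inl one_ne_zero)).inv₀ (by simp)).div_const (4 * α + 1)
  rw [Real.one_rpow, inv_one] at h1
  refine h1.congr' ?_
  filter_upwards [h.one_le_bandT hα hL] with m hT
  rw [lossRatio_eq hα hL (h.phi_pos m) hT]

lemma Regime.tendsto_deficit {n p : ℕ → ℕ} {φ : ℕ → ℝ} (h : Regime α n p φ) (hα : 0 < α)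
    (hL : 0 < L) : Tendsto (fun m => deficit α L (φ m)) atTop (𝓝 0) := by
  have h1 := ((h.tendsto_lossRatio hα hL).sub_const (1 / (4 * α + 1))).mul_const
    ((4 * α + 1) / (4 * α))
  simpa only [deficit, sub_self, zero_mul] using h1

lemma sqrt_amp_mul_le (hα : 0 < α) (hL : 0 < L) (hφ : 0 < φ) :
    √(amp α L φ) * (bandT α L φ : ℝ) ^ (1 / 4 : ℝ) ≤ kappa α ^ (1 / 4 : ℝ) := by
  have h := Real.rpow_le_rpow (by positivity) (bandT_mul_amp_sq_le hα hL hφ)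
    (by norm_num : (0 : ℝ) ≤ 1 / 4)
  rw [Real.mul_rpow (Nat.cast_nonneg _) (sq_nonneg _), ← Real.rpow_natCast,
    ← Real.rpow_mul (amp_pos hα hL hφ).le] at h
  rw [Real.sqrt_eq_rpow, mul_comm]
  convert h using 3
  norm_num

/-- The upper bounds for `T₁` and `T₂` with explicit constants. -/
lemma term_bounds (hα : 0 < α) (hL : 0 < L) (hφ : 0 < φ) (hp : 1 ≤ p)
    (hT : 1 ≤ bandT α L φ) (hS : S ∈ classQ α L φ p) (hr : lossRatio α L φ ≤ 1 / 2)
    {k r A : ℝ} (hk : k = kappa α ^ (1 / 4 : ℝ)) (hr' : r = (bandT α L φ : ℝ) ^ (1 / 4 : ℝ))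
    (hA : A = ∑ i, ∑ j ∈ Finset.Ioi i, weight α L φ i j * S i j ^ 2) :
    term₁ α L φ S ≤ 2 * ∑ i : Fin p, ∑ j ∈ Finset.Ioi i, weight α L φ i j ^ 2
        + 582 * k ^ 2 * r ^ 6 * A ∧
      term₂ α L φ S ≤ 24 * k ^ 2 * r ^ 2 * A + 24 * k * r ^ 3 * (A * √A) := by
  have hw := bandedWeight_weight (p := p) hα hL hφ hT
  have hC := isCorrelation_of_posSemidef hS.1.1 hS.1.2.1
  have ha := amp_pos hα hL hφ
  have hlow := amp_mul_le_sum_weight hα hL hφ hp hT hS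
  rw [← hA] at hlow
  have h1 := sum_mul_prodCov_sq_le hw ha.le hC
  have h2 := sum_mul_prodCov_le hw hC
  rw [term₁_eq hS.1.1, term₂_eq hS.1.1]
  simp only [sum_Ioi_eq_sum_indexPairs] at hlow hA ⊢
  have e1 : ∑ a ∈ indexPairs p, weight α L φ a.1 a.2 * S a.1 a.2 ^ 2 = A := hA.symm
  rw [e1] at h1 h2
  set N := ∑ a ∈ indexPairs p, S a.1 a.2 ^ 2 with hN
  set W := ∑ a ∈ indexPairs p, weight α L φ a.1 a.2 ^ 2 with hW
  have hN0 : 0 ≤ N := Finset.sum_nonneg fun a _ => sq_nonneg _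
  have hA0 : 0 ≤ A := hA ▸ Finset.sum_nonneg fun a _ =>
    mul_nonneg (hw.nonneg _ _) (sq_nonneg _)
  set s := √(amp α L φ) with hs
  have hs0 : 0 ≤ s := Real.sqrt_nonneg _
  have hs2 : amp α L φ = s ^ 2 := (Real.sq_sqrt ha.le).symm
  have hsr : s * r ≤ k := by rw [hr', hk]; exact sqrt_amp_mul_le hα hL hφ
  have hr0 : 0 ≤ r := hr' ▸ Real.rpow_nonneg (Nat.cast_nonneg _) _
  have hk0 : 0 ≤ k := hk ▸ Real.rpow_nonneg (kappa_pos hα).le _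
  have hr4 : (bandT α L φ : ℝ) = r ^ 4 := by
    rw [hr', ← Real.rpow_natCast, ← Real.rpow_mul (Nat.cast_nonneg _)]
    norm_num
  have hT' : (1 : ℝ) ≤ bandT α L φ := by exact_mod_cast hT
  have hsk : s ^ 2 * r ^ 2 ≤ k ^ 2 := by
    rw [← mul_pow]; exact pow_le_pow_left₀ (by positivity) hsr 2
  have hNA : s ^ 2 * N ≤ 2 * A := by
    rw [hs2] at hlow
    have : s ^ 2 * (1 / 2 * N) ≤ s ^ 2 * ((1 - lossRatio α L φ) * N) :=
      mul_le_mul_of_nonneg_left (mul_le_mul_of_nonneg_right (by linarith) hN0) (sq_nonneg _)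
    linarith
  have hT1 : 2 * (bandT α L φ : ℝ) + 1 ≤ 3 * r ^ 4 := by rw [← hr4]; linarith
  have hr41 : 1 ≤ r ^ 4 := hr4 ▸ hT'
  rw [hs2] at h1 h2
  constructor
  · have h3 : (2 * (bandT α L φ : ℝ) + 1) ^ 2 ≤ 9 * r ^ 8 := by
      calc _ ≤ (3 * r ^ 4) ^ 2 := pow_le_pow_left₀ (by positivity) hT1 2
        _ = _ := by ring
    have h4 : s ^ 2 * (s ^ 2 * N) * (2 * (bandT α L φ : ℝ) + 1) ^ 2
        ≤ s ^ 2 * (2 * A) * (9 * r ^ 8) := by gcongr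
    have h5 : s ^ 2 * A * 1 ≤ s ^ 2 * A * r ^ 8 := by
      refine mul_le_mul_of_nonneg_left ?_ (by positivity)
      nlinarith
    have h6 : s ^ 2 * r ^ 2 * (r ^ 6 * A) ≤ k ^ 2 * (r ^ 6 * A) := by gcongr
    linarith
  · have h3 : s * √(2 * N) ≤ 2 * √A := by
      refine abs_le_of_sq_le_sq' ?_ (by positivity) |>.2
      rw [mul_pow, mul_pow, Real.sq_sqrt (by positivity : 0 ≤ 2 * N), Real.sq_sqrt hA0]
      linarith
    have h4 : s ^ 2 * A * (2 * (bandT α L φ : ℝ) + 1) * (2 + √(2 * N))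
        ≤ s ^ 2 * A * (3 * r ^ 4) * (2 + √(2 * N)) := by gcongr
    have h5 : s * A * (3 * r ^ 4) * (s * √(2 * N)) ≤ s * A * (3 * r ^ 4) * (2 * √A) := by gcongr
    have h6 : s ^ 2 * r ^ 2 * (r ^ 2 * A) ≤ k ^ 2 * (r ^ 2 * A) := by gcongr
    have h7 : s * r * (r ^ 3 * (A * √A)) ≤ k * (r ^ 3 * (A * √A)) := by gcongr
    linarith

/-- The error `ε` collects the deficit of the lower bound for the expectation and the deviation of
the sum of the squared weights from `p / 2`. Neither involves `Σ`, so the bounds are uniform. -/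
lemma Regime.eventually_bounds {n p : ℕ → ℕ} {φ : ℕ → ℝ} (h : Regime α n p φ) (hα : 1 / 2 < α)
    (hL : 0 < L) {C : ℝ}
    (hC : C = 582 * (kappa α ^ (1 / 4 : ℝ)) ^ 2 + 24 * kappa α ^ (1 / 4 : ℝ)) :
    ∃ ε : ℕ → ℝ, Tendsto ε atTop (𝓝 0) ∧
      ∀ᶠ m in atTop, ∀ S ∈ classQ α L (φ m) (p m),
        ∀ E : ℝ, E = ∫ X, stat α L (φ m) (n m) (p m) X ∂(law (n m) S) →
        ∀ T : ℝ, T = (bandT α L (φ m) : ℝ) →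
          (1 - ε m) * bFun α L (φ m) ≤ E ∧
          term₁ α L (φ m) S ≤ (p m : ℝ) * (1 + ε m) + (p m : ℝ) * E * (C * (T * √T)) ∧
          term₂ α L (φ m) S
            ≤ (p m : ℝ) * E * (C * √T)
              + (p m : ℝ) ^ (3 / 2 : ℝ) *
                  (E ^ (3 / 2 : ℝ) * (C * T ^ (3 / 4 : ℝ)) + E * ε m) := by
  have hα0 : 0 < α := by linarith
  have hW := h.tendsto_sum_weight_sq hα0 hL
  refine ⟨fun m => |deficit α L (φ m)| + |2 / (p m : ℝ) *
    ∑ i : Fin (p m), ∑ j ∈ Finset.Ioi i, weight α L (φ m) i j ^ 2 - 1|, ?_, ?_⟩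
  · have h1 := (h.tendsto_deficit hα0 hL).abs.add (hW.sub_const 1).abs
    simpa using h1
  -- the limit `1 / (4α + 1)` of the loss ratio is below `1 / 2` because `α > 1 / 2`
  have hloss : ∀ᶠ m in atTop, lossRatio α L (φ m) < 1 / 2 :=
    (h.tendsto_lossRatio hα0 hL).eventually_lt_const
      (one_div_lt_one_div_of_lt two_pos (by linarith))
  filter_upwards [hloss, h.one_le_bandT hα0 hL, h.tendsto_n.eventually_ge_atTop 2,
    h.tendsto_p.eventually_ge_atTop 1] with m hr hT hn hp S hS E hE T hTdef
  have hφ := h.phi_pos m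
  have hp' : (0 : ℝ) < p m := by exact_mod_cast hp
  have hb := bFun_pos hα0 hL hφ
  set ε₁ := deficit α L (φ m) with hε₁
  set W := ∑ i : Fin (p m), ∑ j ∈ Finset.Ioi i, weight α L (φ m) i j ^ 2 with hWdef
  have hE1 : (1 - ε₁) * bFun α L (φ m) ≤ E := by
    rw [hε₁, one_sub_deficit_mul hα0 hL hφ, hE]
    exact le_integral_stat hα0 hL hφ hn hp hT hS (by linarith)
  have hEA : p m * E = ∑ i, ∑ j ∈ Finset.Ioi i, weight α L (φ m) i j * S i j ^ 2 := by
    rw [hE, stat_eq_ustat, integral_ustat hS.1.1 _ hn]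
    field_simp
  have hE0 : 0 ≤ E := by
    refine le_of_mul_le_mul_left ?_ hp'
    rw [hEA, mul_zero]
    exact Finset.sum_nonneg fun i _ => Finset.sum_nonneg fun j _ =>
      mul_nonneg ((bandedWeight_weight hα0 hL hφ hT).nonneg _ _) (sq_nonneg _)
  obtain ⟨hb1, hb2⟩ := term_bounds hα0 hL hφ hp hT hS hr.le rfl rfl hEA
  rw [← hTdef] at hb1 hb2
  have hT0 : 0 ≤ T := hTdef ▸ Nat.cast_nonneg _
  set k := kappa α ^ (1 / 4 : ℝ) with hk
  have hk0 : 0 ≤ k := Real.rpow_nonneg (kappa_pos hα0).le _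
  set r := T ^ (1 / 4 : ℝ) with hrdef
  have hr0 : 0 ≤ r := Real.rpow_nonneg hT0 _
  have hpow : ∀ q : ℕ, r ^ q = T ^ ((q : ℝ) / 4) := fun q => by
    rw [hrdef, ← Real.rpow_natCast, ← Real.rpow_mul hT0]
    congr 1; ring
  have hr4 : T = r ^ 4 := by rw [hpow]; norm_num
  have hr2 : √T = r ^ 2 := by rw [hpow, Real.sqrt_eq_rpow]; norm_num
  have hr3 : T ^ (3 / 4 : ℝ) = r ^ 3 := by rw [hpow]; norm_num
  have h32 : ∀ x : ℝ, 0 ≤ x → x ^ (3 / 2 : ℝ) = x * √x := fun x hx => by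
    rw [Real.sqrt_eq_rpow, ← Real.rpow_one_add' hx (by norm_num)]; norm_num
  have hTT : T * √T = r ^ 6 := by rw [hr2, hr4]; ring
  have hW1 : 2 * W ≤ p m * (1 + (|ε₁| + |2 / (p m : ℝ) * W - 1|)) := by
    have e : 2 * W = p m * (1 + (2 / (p m : ℝ) * W - 1)) := by field_simp; ring
    rw [e]
    refine mul_le_mul_of_nonneg_left ?_ hp'.le
    have := le_abs_self (2 / (p m : ℝ) * W - 1)
    have := abs_nonneg ε₁
    linarith
  have hCk : 582 * k ^ 2 ≤ C := by rw [hC]; linarith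
  have hCk2 : 24 * k ^ 2 ≤ C := by nlinarith [sq_nonneg k]
  have hCk3 : 24 * k ≤ C := by rw [hC]; nlinarith [sq_nonneg k]
  refine ⟨?_, ?_, ?_⟩
  · refine le_trans (mul_le_mul_of_nonneg_right ?_ hb.le) hE1
    have := le_abs_self ε₁
    have := abs_nonneg (2 / (p m : ℝ) * W - 1)
    linarith
  · rw [hTT]
    refine hb1.trans (add_le_add hW1 ?_)
    calc 582 * k ^ 2 * r ^ 6 * (p m * E) ≤ C * r ^ 6 * (p m * E) := by gcongr
      _ = _ := by ring
  · rw [hr2, hr3, h32 _ hp'.le, h32 _ hE0]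
    have hsplit : √(p m * E) = √(p m : ℝ) * √E := Real.sqrt_mul hp'.le _
    rw [hsplit] at hb2
    have h1 : 24 * k ^ 2 * r ^ 2 * (p m * E) ≤ C * r ^ 2 * (p m * E) := by gcongr
    have h2 : 24 * k * r ^ 3 * (p m * E * (√(p m : ℝ) * √E))
        ≤ C * r ^ 3 * (p m * E * (√(p m : ℝ) * √E)) := by gcongr
    have h3 : 0 ≤ p m * √(p m : ℝ) * (E * (|ε₁| + |2 / (p m : ℝ) * W - 1|)) := by positivity
    linarith

end CovTest

theorem proposition1 (α L : ℝ) (hα : 0 < α) (hL : 0 < L) :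
    -- moments under the null hypothesis
    (∀ (n p : ℕ) (φ : ℝ), 2 ≤ n → 1 ≤ p → 0 < φ →
      MemLp (CovTest.stat α L φ n p) 2 (CovTest.law n (1 : Matrix (Fin p) (Fin p) ℝ)) ∧
      ∫ X, CovTest.stat α L φ n p X ∂(CovTest.law n (1 : Matrix (Fin p) (Fin p) ℝ)) = 0 ∧
      Var[CovTest.stat α L φ n p; CovTest.law n (1 : Matrix (Fin p) (Fin p) ℝ)]
        = 2 / ((n : ℝ) * ((n : ℝ) - 1) * (p : ℝ) ^ 2) *
            ∑ i : Fin p, ∑ j ∈ Finset.Ioi i, CovTest.weight α L φ i j ^ 2) ∧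
    -- asymptotic variance and asymptotic normality under the null hypothesis
    (∀ (n p : ℕ → ℕ) (φ : ℕ → ℝ), CovTest.Regime α n p φ →
      Tendsto (fun m =>
          Var[CovTest.stat α L (φ m) (n m) (p m);
            CovTest.law (n m) (1 : Matrix (Fin (p m)) (Fin (p m)) ℝ)] /
          (1 / ((n m : ℝ) * ((n m : ℝ) - 1) * (p m : ℝ)))) atTop (𝓝 1) ∧
      TendstoInDistribution
        (fun m (X : CovTest.Sample (n m) (p m)) =>
          (n m : ℝ) * √(p m : ℝ) * CovTest.stat α L (φ m) (n m) (p m) X)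
        atTop (id : ℝ → ℝ)
        (fun m => CovTest.law (n m) (1 : Matrix (Fin (p m)) (Fin (p m)) ℝ))
        (gaussianReal 0 1)) ∧
    -- moments under the alternative
    (1 / 2 < α →
      (∀ (n p : ℕ) (φ : ℝ), 2 ≤ n → 1 ≤ p → 0 < φ → ∀ S ∈ CovTest.classQ α L φ p,
        MemLp (CovTest.stat α L φ n p) 2 (CovTest.law n S) ∧
        ∫ X, CovTest.stat α L φ n p X ∂(CovTest.law n S)
          = 1 / (p : ℝ) * ∑ i : Fin p, ∑ j ∈ Finset.Ioi i,
              CovTest.weight α L φ i j * S i j ^ 2 ∧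
        ((∃ N : ℕ, CovTest.constT α L * φ ^ (-(1 / α)) = N) →
          CovTest.bFun α L φ ≤ ∫ X, CovTest.stat α L φ n p X ∂(CovTest.law n S)) ∧
        Var[CovTest.stat α L φ n p; CovTest.law n S]
          = CovTest.term₁ α L φ S / ((n : ℝ) * ((n : ℝ) - 1) * (p : ℝ) ^ 2)
            + CovTest.term₂ α L φ S / ((n : ℝ) * (p : ℝ) ^ 2)) ∧
      -- the constant in the `O` terms depends only on `α` and `L`; the `o(1)` terms are uniform
      -- over the class
      ∃ C : ℝ, 0 < C ∧
        ∀ (n p : ℕ → ℕ) (φ : ℕ → ℝ), CovTest.Regime α n p φ →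
          ∃ ε : ℕ → ℝ, Tendsto ε atTop (𝓝 0) ∧
            ∀ᶠ m in atTop, ∀ S ∈ CovTest.classQ α L (φ m) (p m),
              ∀ E : ℝ,
                E = ∫ X, CovTest.stat α L (φ m) (n m) (p m) X ∂(CovTest.law (n m) S) →
              ∀ T : ℝ, T = (CovTest.bandT α L (φ m) : ℝ) →
                (1 - ε m) * CovTest.bFun α L (φ m) ≤ E ∧
                CovTest.term₁ α L (φ m) S
                  ≤ (p m : ℝ) * (1 + ε m) + (p m : ℝ) * E * (C * (T * √T)) ∧
                CovTest.term₂ α L (φ m) S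
                  ≤ (p m : ℝ) * E * (C * √T)
                    + (p m : ℝ) ^ (3 / 2 : ℝ) *
                        (E ^ (3 / 2 : ℝ) * (C * T ^ (3 / 4 : ℝ)) + E * ε m)) := by
  refine ⟨fun n p φ hn _ _ => ⟨CovTest.memLp_two_stat α L φ n p 1, ?_, ?_⟩, fun n p φ h =>
    ⟨h.tendsto_variance_stat hα hL, h.tendstoInDistribution_stat hα hL⟩, fun hα' =>
    ⟨fun n p φ hn hp hφ S hS => ⟨CovTest.memLp_two_stat α L φ n p S, ?_, ?_, ?_⟩, ?_⟩⟩
  · rw [CovTest.stat_eq_ustat, CovTest.integral_ustat_one _ hn]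
  · rw [CovTest.stat_eq_ustat, CovTest.variance_ustat_one _ hn]
  · rw [CovTest.stat_eq_ustat, CovTest.integral_ustat hS.1.1 _ hn]
  · rintro ⟨N, hN⟩
    exact CovTest.bFun_le_integral_stat hα hL hφ hn hp hS hN
  · rw [CovTest.stat_eq_ustat, CovTest.variance_ustat hS.1.1 _ hn, CovTest.term₁_eq hS.1.1,
      CovTest.term₂_eq hS.1.1]
  · have hk := Real.rpow_pos_of_pos (CovTest.kappa_pos hα) (1 / 4 : ℝ)
    exact ⟨_, by positivity, fun n p φ h => h.eventually_bounds hα' hL rfl⟩
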